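/- Let $\Bbbk$ be a field of prime characteristic $p$, let $n\ge 2$, and let $A_n^!$ be the quotient of the path algebra over $\Bbbk$ of the quiver with vertices $1,\dots,n$ and one arrow $(i|j)$ from $i$ to $j$ whenever $|i-j|=1$ (paths are composed from left to right, $(i|j)(j|l)=(i|j|l)$) by the relations $(i|i-1|i)=(i|i+1|i)$ for $1<i<n$ and $(1|2|1)=0$. It is graded by path length. For $\lambda\in\mathbb F_p$ it is a $p$-DG algebra with the derivation $\partial_\lambda$ of degree two determined by $\partial_\lambda(i)=0$, $\partial_\lambda(i|i+1)=\lambda\,(i|i+1|i|i+1)$ and $\partial_\lambda(i|i-1)=(1-\lambda)\,(i|i-1|i|i-1)$. With $A'$ the ideal spanned by the paths of positive length, let $L_i=A_n^!(i)/A'A_n^!(i)$ and ${}_iL=(i)A_n^!/(i)A_n^!A'$ be the simple left and right $p$-DG modules at the vertex $i$ (with trivial differential). A $p$-complex is a $\mathbb Z$-graded $\Bbbk$-vector space with an endomorphism $\partial$ of degree two such that $\partial^p=0$. Homotopy equivalence of $p$-complexes means isomorphism in the homotopy category, where maps of the form $\sum_{s=0}^{p-1}\partial^{p-1-s}h\,\partial^{s}$,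 with $h$ linear of degree $2-2p$, are identified with zero. For $0\le m<p$ let $\widetilde V_m$ be the $p$-complex with basis $v_0,\dots,v_m$, $\deg v_s=2s-m$, $\partial v_s=v_{s+1}$ for $s<m$ and $\partial v_m=0$. Write $C\{l\}$ for the grading shift $C\{l\}^r=C^{r-l}$, and $C[1]=C\otimes\widetilde V_{p-2}\{-p\}$, $C[-1]=C\otimes\widetilde V_{p-2}\{p\}$, $C[\pm2]=C[\pm1][\pm1]$. A map of $p$-DG modules is a quasi-isomorphism if it is a homotopy equivalence of the underlying $p$-complexes. For $p$-DG modules $M,N$ let $\mathrm{HOM}(M,N)$ be the $p$-complex given by the direct sum over $l\in\mathbb Z$ of the spaces of module maps $M\to N$ of degree $l$, with differential $f\mapsto\partial f-f\partial$; $M$ is cofibrant if $\mathrm{HOM}(M,-)$ sends surjective quasi-isomorphisms to homotopy equivalences. Let $\mathbf R\mathrm{HOM}(M,N)=\mathrm{HOM}(\mathbf pM,N)$ and, for a right module $N$, $N\otimes^{\mathbf L}M=N\otimes_{A_n^!}\mathbf pM$, where $\mathbf pM$ is any cofibrant $p$-DG module with a surjective quasi-isomorphism onto $M$. Let $\lambda\in\{0,1\}$,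 $1\le i\le n-1$ and $1\le j\le n$. Then $L_i$ has such a cofibrant replacement, and for every choice of it there are homotopy equivalences of $p$-complexes \[ \mathbf R\mathrm{HOM}_{A_n^!}(L_i,L_j)\simeq \begin{cases} \widetilde V_0\oplus\widetilde V_0\{2p-2\}\simeq \widetilde V_0\oplus\widetilde V_0\{-2\}[-2] & \text{if } j=i,\\ \widetilde V_{p-2}\{p-1\}\simeq\widetilde V_0\{-1\}[-1] & \text{if } j=i\pm1,\\ 0 & \text{if } |j-i|>1, \end{cases} \] \[ {}_jL\otimes^{\mathbf L}_{A_n^!}L_i\simeq \begin{cases} \widetilde V_0[2]\{2\}\oplus\widetilde V_0 & \text{if } j=i,\\ \widetilde V_{p-2}\{1-p\}\simeq\widetilde V_0[1]\{1\} & \text{if } j=i\pm1,\\ 0 & \text{if } |j-i|>1. \end{cases} \] -/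

import Mathlib

universe u

open scoped TensorProduct

/-! ## Graded vector spaces -/

section Grading

variable {k : Type*} [Field k] {V W : Type*} [AddCommGroup V] [Module k V]
  [AddCommGroup W] [Module k W]

theorem iSupIndep_of_test (gr : ℤ → Submodule k V)
    (K : ℤ → Submodule k V) (hK : ∀ l m, m ≠ l → gr m ≤ K l)
    (hd : ∀ l x, x ∈ gr l → x ∈ K l → x = 0) : iSupIndep gr := by
  rw [iSupIndep_def]
  intro l
  refine Disjoint.mono_right (iSup₂_le fun m hm => hK l m hm) ?_
  rw [Submodule.disjoint_def]
  exact hd l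

theorem iSupIndep_of_coaction (gr : ℤ → Submodule k V) (j : V →ₗ[k] W)
    (hj : Function.Injective j) (r : V →ₗ[k] (ℤ →₀ W))
    (hr : ∀ l x, x ∈ gr l → r x = Finsupp.single l (j x)) : iSupIndep gr := by
  refine iSupIndep_of_test gr (fun l => LinearMap.ker (Finsupp.lapply l ∘ₗ r)) ?_ ?_
  · intro l m hm x hx
    simp [hr m x hx, hm]
  · intro l x hx hx'
    have : j x = 0 := by simpa [hr l x hx] using hx'
    exact hj (by simpa using this)

theorem isInternal_of_coaction (gr : ℤ → Submodule k V) (htop : ⨆ l, gr l = ⊤)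
    (r : V →ₗ[k] (ℤ →₀ V))
    (hr : ∀ l x, x ∈ gr l → r x = Finsupp.single l x) : DirectSum.IsInternal gr :=
  (DirectSum.isInternal_submodule_iff_iSupIndep_and_iSup_eq_top gr).2
    ⟨iSupIndep_of_coaction gr LinearMap.id Function.injective_id r hr, htop⟩

/-- The map sending a vector to the finitely supported family of its homogeneous components. -/
noncomputable def gradedComponents (gr : ℤ → Submodule k V) (h : DirectSum.IsInternal gr) :
    V →ₗ[k] (ℤ →₀ V) :=
  letI := h.chooseDecomposition
  DirectSum.toModule k ℤ (ℤ →₀ V) (fun l => Finsupp.lsingle l ∘ₗ (gr l).subtype) ∘ₗ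
    (DirectSum.decomposeLinearEquiv gr).toLinearMap

theorem gradedComponents_of_mem (gr : ℤ → Submodule k V) (h : DirectSum.IsInternal gr)
    {l : ℤ} {x : V} (hx : x ∈ gr l) : gradedComponents gr h x = Finsupp.single l x := by
  let := h.chooseDecomposition
  simp only [gradedComponents, LinearMap.comp_apply, LinearEquiv.coe_coe,
    DirectSum.decomposeLinearEquiv_apply]
  rw [DirectSum.decompose_of_mem gr hx]
  exact (DirectSum.toModule_lof k l _).trans (by simp)

/-- The projection of a graded vector space onto its component of degree `l`. -/
noncomputable def gradedProj (gr : ℤ → Submodule k V) (h : DirectSum.IsInternal gr) (l : ℤ) :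
    V →ₗ[k] V := Finsupp.lapply l ∘ₗ gradedComponents gr h

theorem gradedProj_of_mem (gr : ℤ → Submodule k V) (h : DirectSum.IsInternal gr)
    {l : ℤ} {x : V} (hx : x ∈ gr l) : gradedProj gr h l x = x := by
  simp [gradedProj, gradedComponents_of_mem gr h hx]

theorem gradedProj_of_mem_ne (gr : ℤ → Submodule k V) (h : DirectSum.IsInternal gr)
    {l m : ℤ} (hlm : m ≠ l) {x : V} (hx : x ∈ gr m) : gradedProj gr h l x = 0 := by
  simp [gradedProj, gradedComponents_of_mem gr h hx, hlm]

theorem graded_induction (gr : ℤ → Submodule k V) (h : DirectSum.IsInternal gr)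
    {P : V → Prop} (h0 : P 0) (hadd : ∀ x y, P x → P y → P (x + y))
    (hmem : ∀ l x, x ∈ gr l → P x) (x : V) : P x := by
  have hx : x ∈ ⨆ l, gr l := by rw [h.submodule_iSup_eq_top]; trivial
  exact Submodule.iSup_induction gr (motive := P) hx hmem h0 hadd

theorem gradedProj_mem (gr : ℤ → Submodule k V) (h : DirectSum.IsInternal gr) (l : ℤ) (x : V) :
    gradedProj gr h l x ∈ gr l := by
  refine graded_induction gr h (P := fun x => gradedProj gr h l x ∈ gr l) (by simp) ?_ ?_ x
  · intro x y hx hy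
    rw [map_add]; exact add_mem hx hy
  · intro m x hx
    by_cases hm : m = l
    · subst hm; rwa [gradedProj_of_mem gr h hx]
    · rw [gradedProj_of_mem_ne gr h hm hx]; exact zero_mem _

theorem mem_iSup_of_gradedProj (gr : ℤ → Submodule k V) (h : DirectSum.IsInternal gr) (x : V)
    (Q : Submodule k V) (hx : ∀ l, gradedProj gr h l x ∈ Q) : x ∈ Q := by
  have key : ∀ y : V, (gradedComponents gr h y).sum (fun _ v => v) = y := by
    intro y
    refine graded_induction gr h (P := fun y => (gradedComponents gr h y).sum (fun _ v => v) = y)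
      (by simp) ?_ ?_ y
    · intro x y hx hy
      rw [map_add, Finsupp.sum_add_index (by simp) (by simp), hx, hy]
    · intro l x hx
      rw [gradedComponents_of_mem gr h hx, Finsupp.sum_single_index rfl]
  rw [← key x]
  exact Submodule.sum_mem _ fun l _ => hx l

/-- The Frobenius identity for commuting endomorphisms of a vector space in characteristic `p`. -/
theorem end_add_pow {p : ℕ} [Fact p.Prime] [CharP k p] {f g : Module.End k V}
    (hc : Commute f g) : (f + g) ^ p = f ^ p + g ^ p := by
  obtain ⟨r, hr⟩ := hc.exists_add_pow_prime_eq (Fact.out : p.Prime)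
  have hp : (p : Module.End k V) = 0 := by
    ext x
    rw [Module.End.natCast_apply, ← Nat.cast_smul_eq_nsmul k, CharP.cast_eq_zero]; simp
  rw [hr, hp]; simp

theorem end_add_pow_char {p : ℕ} [Fact p.Prime] [CharP k p] {f g : Module.End k V}
    (hc : Commute f g) (hf : f ^ p = 0) (hg : g ^ p = 0) : (f + g) ^ p = 0 := by
  rw [end_add_pow hc, hf, hg, add_zero]

theorem end_sub_pow_char {p : ℕ} [Fact p.Prime] [CharP k p] {f g : Module.End k V}
    (hc : Commute f g) (hf : f ^ p = 0) (hg : g ^ p = 0) : (f - g) ^ p = 0 := by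
  rw [sub_eq_add_neg]
  exact end_add_pow_char hc.neg_right hf (by rw [neg_pow, hg, mul_zero])

end Grading

/-! ## `p`-complexes -/

/-- A `p`-complex over `k`, i.e. a graded module over the graded Hopf algebra `k[d]/(d^p)` with
`deg d = 2`: a `ℤ`-graded vector space with a degree-two endomorphism `d` such that `d ^ p = 0`. -/
structure PComplex (k : Type u) [Field k] (p : ℕ) where
  carrier : Type u
  [addCommGroup : AddCommGroup carrier]
  [module : Module k carrier]
  /-- the homogeneous components -/
  gr : ℤ → Submodule k carrier
  internal : DirectSum.IsInternal gr
  /-- the differential -/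
  d : carrier →ₗ[k] carrier
  d_mem : ∀ (l : ℤ) (x : carrier), x ∈ gr l → d x ∈ gr (l + 2)
  d_pow : d ^ p = 0

attribute [instance] PComplex.addCommGroup PComplex.module

namespace PComplex

variable {k : Type u} [Field k] {p : ℕ}

/-- A morphism of `p`-complexes: a degree-zero linear map commuting with the differentials. -/
structure Hom (C D : PComplex k p) where
  toLin : C.carrier →ₗ[k] D.carrier
  map_gr : ∀ (l : ℤ) (x : C.carrier), x ∈ C.gr l → toLin x ∈ D.gr l
  map_d : ∀ x : C.carrier, toLin (C.d x) = D.d (toLin x)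

/-- A map of `p`-complexes is null-homotopic if it is of the form
`∑_{s=0}^{p-1} d^{p-1-s} h d^s` for a linear map `h` of degree `2 - 2p` (equivalently, if it
factors through a projective-injective graded `k[d]/(d^p)`-module). -/
def NullHomotopic {C D : PComplex k p} (f : C.carrier →ₗ[k] D.carrier) : Prop :=
  ∃ h : C.carrier →ₗ[k] D.carrier,
    (∀ (l : ℤ) (x : C.carrier), x ∈ C.gr l → h x ∈ D.gr (l + (2 - 2 * (p : ℤ)))) ∧
    f = ∑ s ∈ Finset.range p, (D.d ^ (p - 1 - s)) ∘ₗ h ∘ₗ (C.d ^ s)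

/-- A morphism of `p`-complexes is a homotopy equivalence if it is invertible in the homotopy
category, that is, modulo null-homotopic maps. -/
def Hom.IsHomotopyEquiv {C D : PComplex k p} (f : Hom C D) : Prop :=
  ∃ g : Hom D C,
    NullHomotopic (C := C) (D := C) (g.toLin ∘ₗ f.toLin - LinearMap.id) ∧
    NullHomotopic (C := D) (D := D) (f.toLin ∘ₗ g.toLin - LinearMap.id)

/-- Two `p`-complexes are homotopy equivalent (isomorphic in the homotopy category). -/
def HomotopyEquivalent (C D : PComplex k p) : Prop :=
  ∃ f : Hom C D, f.IsHomotopyEquiv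

/-- The zero `p`-complex. -/
def zero (k : Type u) [Field k] (p : ℕ) [Fact p.Prime] : PComplex k p where
  carrier := PUnit
  gr := fun _ => ⊤
  internal := isInternal_of_coaction _ (by simp) 0 (fun _ _ _ => by
    ext)
  d := 0
  d_mem := fun _ _ _ => trivial
  d_pow := zero_pow (Fact.out : p.Prime).ne_zero

/-- The grading shift `C{m}`, with `C{m}^l = C^{l-m}`. -/
def shift (C : PComplex k p) (m : ℤ) : PComplex k p where
  carrier := C.carrier
  gr := fun l => C.gr (l - m)
  internal := by
    have h := C.internal
    rw [DirectSum.isInternal_submodule_iff_iSupIndep_and_iSup_eq_top] at h ⊢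
    refine ⟨h.1.comp (sub_left_injective (b := m)), ?_⟩
    rw [← h.2]
    exact (Equiv.subRight m).iSup_comp (g := C.gr)
  d := C.d
  d_mem := fun l x hx => by
    have := C.d_mem _ x hx
    rwa [show l + 2 - m = l - m + 2 by ring]
  d_pow := C.d_pow

/-- The direct sum of two `p`-complexes. -/
noncomputable def directSum (C D : PComplex k p) : PComplex k p where
  carrier := C.carrier × D.carrier
  gr := fun l => (C.gr l).prod (D.gr l)
  internal := by
    refine isInternal_of_coaction _ ?_
      ((Finsupp.mapRange.linearMap (LinearMap.inl k C.carrier D.carrier)) ∘ₗ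
        gradedComponents C.gr C.internal ∘ₗ LinearMap.fst k _ _ +
       (Finsupp.mapRange.linearMap (LinearMap.inr k C.carrier D.carrier)) ∘ₗ
        gradedComponents D.gr D.internal ∘ₗ LinearMap.snd k _ _) ?_
    · rw [eq_top_iff]
      rintro ⟨x, y⟩ -
      have h1 : (x, (0 : D.carrier)) ∈ ⨆ l, (C.gr l).prod (D.gr l) := by
        refine graded_induction C.gr C.internal
          (P := fun x => (x, (0 : D.carrier)) ∈ ⨆ l, (C.gr l).prod (D.gr l)) (zero_mem _) ?_ ?_ x
        · intro a b ha hb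
          simpa using add_mem ha hb
        · intro l a ha
          exact Submodule.mem_iSup_of_mem l ⟨ha, zero_mem _⟩
      have h2 : ((0 : C.carrier), y) ∈ ⨆ l, (C.gr l).prod (D.gr l) := by
        refine graded_induction D.gr D.internal
          (P := fun y => ((0 : C.carrier), y) ∈ ⨆ l, (C.gr l).prod (D.gr l)) (zero_mem _) ?_ ?_ y
        · intro a b ha hb
          simpa using add_mem ha hb
        · intro l a ha
          exact Submodule.mem_iSup_of_mem l ⟨zero_mem _, ha⟩
      simpa using add_mem h1 h2
    · rintro l ⟨x, y⟩ ⟨hx, hy⟩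
      have hx' := gradedComponents_of_mem C.gr C.internal hx
      have hy' := gradedComponents_of_mem D.gr D.internal hy
      simp only [LinearMap.add_apply, LinearMap.comp_apply, LinearMap.fst_apply,
        LinearMap.snd_apply] at hx' hy' ⊢
      rw [hx', hy']
      simp [← Finsupp.single_add]
  d := C.d.prodMap D.d
  d_mem := fun l x hx => ⟨C.d_mem l _ hx.1, D.d_mem l _ hx.2⟩
  d_pow := by
    have : ∀ m : ℕ, (C.d.prodMap D.d) ^ m = (C.d ^ m).prodMap (D.d ^ m) := by
      intro m
      induction m with
      | zero => ext <;> rfl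
      | succ m ih => rw [pow_succ, ih, pow_succ, pow_succ]; ext <;> rfl
    rw [this, C.d_pow, D.d_pow]; ext <;> rfl

/-- The shift operator `v_s ↦ v_{s+1}` on `k^{m+1}` (with `v_m ↦ 0`), in coordinates. -/
def balancedD (k : Type u) [Field k] (m : ℕ) : (Fin (m + 1) → k) →ₗ[k] (Fin (m + 1) → k) where
  toFun := fun x s => if h : s.val = 0 then 0 else x ⟨s.val - 1, by omega⟩
  map_add' := fun x y => by
    ext s; dsimp only [Pi.add_apply]; split <;> simp
  map_smul' := fun c x => by
    ext s; dsimp only [Pi.smul_apply, RingHom.id_apply]; split <;> simp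

theorem balancedD_apply_zero (k : Type u) [Field k] (m : ℕ) (x : Fin (m + 1) → k)
    (s : Fin (m + 1)) (h : s.val = 0) : balancedD k m x s = 0 := dif_pos h

theorem balancedD_apply (k : Type u) [Field k] (m : ℕ) (x : Fin (m + 1) → k)
    (s : Fin (m + 1)) (h : s.val ≠ 0) :
    balancedD k m x s = x ⟨s.val - 1, by omega⟩ := dif_neg h

/-- The balanced indecomposable `p`-complex `Ṽ_m` (for `m < p`), with basis `v_0, …, v_m`,
`deg v_s = 2 s - m`, `d v_s = v_{s+1}` for `s < m` and `d v_m = 0`. A vector is given by its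
coordinates. -/
def balanced (k : Type u) [Field k] {p : ℕ} (m : ℕ) (hm : m < p) : PComplex k p where
  carrier := Fin (m + 1) → k
  gr := fun l =>
    { carrier := {x | ∀ s : Fin (m + 1), x s ≠ 0 → 2 * (s.val : ℤ) - m = l}
      zero_mem' := fun s hs => absurd rfl hs
      add_mem' := fun {x y} hx hy s hs => by
        by_cases h : x s = 0
        · exact hy s (by simpa [h] using hs)
        · exact hx s h
      smul_mem' := fun c x hx s hs => hx s (by
        intro h; exact hs (by simp [h])) }
  internal := by
    refine isInternal_of_coaction _ ?_
      (∑ s : Fin (m + 1), Finsupp.lsingle (2 * (s.val : ℤ) - m) ∘ₗ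
        LinearMap.single k (fun _ => k) s ∘ₗ LinearMap.proj s) ?_
    · rw [eq_top_iff]
      intro x _
      rw [← Finset.univ_sum_single x]
      refine Submodule.sum_mem _ fun s _ => Submodule.mem_iSup_of_mem (2 * (s.val : ℤ) - m) ?_
      intro t ht
      by_cases hts : t = s
      · rw [hts]
      · simp [hts] at ht
    · intro l x hx
      have hx' : ∀ s : Fin (m + 1), x s ≠ 0 → 2 * (s.val : ℤ) - m = l := hx
      conv_rhs => rw [← Finset.univ_sum_single x, ← Finsupp.lsingle_apply (R := k), map_sum]
      simp only [LinearMap.sum_apply]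
      refine Finset.sum_congr rfl fun s _ => ?_
      by_cases h : x s = 0
      · simp [h]
      · simp [hx' s h]
  d := balancedD k m
  d_mem := fun l x hx s hs => by
    by_cases h : s.val = 0
    · exact absurd (balancedD_apply_zero k m x s h) hs
    · rw [balancedD_apply k m x s h] at hs
      have := hx ⟨s.val - 1, by omega⟩ hs
      push_cast [Nat.one_le_iff_ne_zero.2 h] at this
      linarith
  d_pow := by
    have key : ∀ (r : ℕ) (x : Fin (m + 1) → k) (s : Fin (m + 1)), s.val < r →
        ((balancedD k m) ^ r) x s = 0 := by
      intro r
      induction r with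
      | zero => intro x s hs; omega
      | succ r ih =>
        intro x s hs
        rw [pow_succ', Module.End.mul_apply]
        by_cases h : s.val = 0
        · exact balancedD_apply_zero k m _ s h
        · rw [balancedD_apply k m _ s h]
          exact ih x ⟨s.val - 1, by omega⟩ (by simp only; omega)
    ext x s
    exact key p _ s (by omega)

end PComplex

namespace PComplex

variable {k : Type u} [Field k] {p : ℕ}

/-- The homogeneous component of degree `l` of an element. -/
noncomputable def proj (C : PComplex k p) (l : ℤ) : C.carrier →ₗ[k] C.carrier :=
  gradedProj C.gr C.internal l

section SubQuot

variable {R : Type u} [Ring R] [Algebra k R]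

/-- A submodule is stable if it is a graded subspace that is closed under the differential. -/
structure Stable (C : PComplex k p) [Module R C.carrier] (S : Submodule R C.carrier) : Prop where
  proj_mem : ∀ (l : ℤ) (x : C.carrier), x ∈ S → C.proj l x ∈ S
  d_mem : ∀ x : C.carrier, x ∈ S → C.d x ∈ S

variable (C : PComplex k p) [Module R C.carrier] [IsScalarTower k R C.carrier]
  (S : Submodule R C.carrier) (hS : C.Stable S)

/-- The restriction of the differential to a stable submodule. -/
def subD : S →ₗ[k] S where
  toFun := fun x => ⟨C.d x.1, hS.d_mem x.1 x.2⟩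
  map_add' := fun x y => Subtype.ext (map_add C.d x.1 y.1)
  map_smul' := fun c x => Subtype.ext (map_smul C.d c x.1)

/-- The `p`-complex structure on a stable submodule. -/
noncomputable def sub : PComplex k p where
  carrier := S
  gr := fun l => (C.gr l).comap (S.subtype.restrictScalars k)
  internal := by
    refine (DirectSum.isInternal_submodule_iff_iSupIndep_and_iSup_eq_top _).2
      ⟨iSupIndep_of_coaction _ (S.subtype.restrictScalars k) S.subtype_injective
        (gradedComponents C.gr C.internal ∘ₗ (S.subtype.restrictScalars k)) ?_, ?_⟩
    · intro l x hx
      exact gradedComponents_of_mem C.gr C.internal hx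
    · rw [eq_top_iff]
      rintro ⟨x, hx⟩ -
      have : x ∈ (⨆ l, (C.gr l).comap (S.subtype.restrictScalars k)).map
          (S.subtype.restrictScalars k) := by
        refine mem_iSup_of_gradedProj C.gr C.internal x _ fun l => ?_
        exact ⟨⟨C.proj l x, hS.proj_mem l x hx⟩,
          Submodule.mem_iSup_of_mem l (gradedProj_mem C.gr C.internal l x), rfl⟩
      obtain ⟨y, hy, hyx⟩ := this
      have : y = ⟨x, hx⟩ := Subtype.ext hyx
      rwa [← this]
  d := C.subD S hS
  d_mem := fun l x hx => C.d_mem l x.1 hx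
  d_pow := by
    have : ∀ (m : ℕ) (x : S), (((C.subD S hS) ^ m) x).1 = (C.d ^ m) x.1 := by
      intro m
      induction m with
      | zero => intro x; rfl
      | succ m ih =>
        intro x
        rw [pow_succ, Module.End.mul_apply, pow_succ, Module.End.mul_apply]
        exact ih _
    ext x
    exact (this p x).trans (by rw [C.d_pow]; rfl)

/-- The `p`-complex structure on the quotient by a stable submodule. -/
noncomputable def quot : PComplex k p where
  carrier := C.carrier ⧸ S
  gr := fun l => (C.gr l).map (S.mkQ.restrictScalars k)
  internal := by
    have hker : ∀ x ∈ S.restrictScalars k,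
        (Finsupp.mapRange.linearMap (α := ℤ) (S.mkQ.restrictScalars k) ∘ₗ
          gradedComponents C.gr C.internal) x = 0 := by
      intro x hx
      ext l
      simp only [LinearMap.comp_apply, Finsupp.mapRange.linearMap_apply, Finsupp.mapRange_apply,
        Finsupp.zero_apply]
      exact (Submodule.Quotient.mk_eq_zero S).2 (hS.proj_mem l x hx)
    refine isInternal_of_coaction _ ?_
      (((S.restrictScalars k).liftQ _ hker) ∘ₗ
        (Submodule.Quotient.restrictScalarsEquiv k S).symm.toLinearMap) ?_
    · rw [← Submodule.map_iSup, C.internal.submodule_iSup_eq_top, Submodule.map_top,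
        LinearMap.range_eq_top]
      exact S.mkQ_surjective
    · rintro l _ ⟨x, hx, rfl⟩
      have : (Finsupp.mapRange.linearMap (α := ℤ) (S.mkQ.restrictScalars k) ∘ₗ
          gradedComponents C.gr C.internal) x = Finsupp.single l (S.mkQ x) := by
        rw [LinearMap.comp_apply, gradedComponents_of_mem C.gr C.internal hx]
        simp
      exact this
  d := (Submodule.Quotient.restrictScalarsEquiv k S).toLinearMap ∘ₗ
    ((S.restrictScalars k).mapQ (S.restrictScalars k) C.d hS.d_mem) ∘ₗ
    (Submodule.Quotient.restrictScalarsEquiv k S).symm.toLinearMap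
  d_mem := by
    rintro l _ ⟨x, hx, rfl⟩
    exact ⟨C.d x, C.d_mem l x hx, rfl⟩
  d_pow := by
    set D : Module.End k (C.carrier ⧸ S) :=
      (Submodule.Quotient.restrictScalarsEquiv k S).toLinearMap ∘ₗ
      ((S.restrictScalars k).mapQ (S.restrictScalars k) C.d hS.d_mem) ∘ₗ
      (Submodule.Quotient.restrictScalarsEquiv k S).symm.toLinearMap
    have : ∀ (m : ℕ) (x : C.carrier), (D ^ m) (S.mkQ x) = S.mkQ ((C.d ^ m) x) := by
      intro m
      induction m with
      | zero => intro x; rfl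
      | succ m ih =>
        intro x
        rw [pow_succ, Module.End.mul_apply, pow_succ, Module.End.mul_apply]
        exact ih _
    ext x
    obtain ⟨x, rfl⟩ := S.mkQ_surjective x
    rw [this, C.d_pow]
    simp

end SubQuot

/-- The tensor product over `k` of two `p`-complexes, with `d(x ⊗ y) = dx ⊗ y + x ⊗ dy`. -/
noncomputable def tensor [Fact p.Prime] [CharP k p] (C D : PComplex k p) : PComplex k p where
  carrier := C.carrier ⊗[k] D.carrier
  gr := fun l => ⨆ i : ℤ, Submodule.map₂ (TensorProduct.mk k C.carrier D.carrier)
    (C.gr i) (D.gr (l - i))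
  internal := by
    refine isInternal_of_coaction _ ?_
      (Finsupp.lmapDomain _ k (fun q : ℤ × ℤ => q.1 + q.2) ∘ₗ
        (finsuppTensorFinsupp k k C.carrier D.carrier ℤ ℤ).toLinearMap ∘ₗ
        TensorProduct.map (gradedComponents C.gr C.internal)
          (gradedComponents D.gr D.internal)) ?_
    · rw [eq_top_iff]
      intro z _
      induction z using TensorProduct.induction_on with
      | zero => exact zero_mem _
      | add x y hx hy => exact add_mem (hx trivial) (hy trivial)
      | tmul x y =>
        refine graded_induction C.gr C.internal (P := fun x => x ⊗ₜ[k] y ∈ _) ?_ ?_ ?_ x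
        · rw [TensorProduct.zero_tmul]; exact zero_mem _
        · intro a b ha hb
          rw [TensorProduct.add_tmul]; exact add_mem ha hb
        · intro i a ha
          refine graded_induction D.gr D.internal (P := fun y => a ⊗ₜ[k] y ∈ _) ?_ ?_ ?_ y
          · rw [TensorProduct.tmul_zero]; exact zero_mem _
          · intro b c hb hc
            rw [TensorProduct.tmul_add]; exact add_mem hb hc
          · intro j b hb
            refine Submodule.mem_iSup_of_mem (i + j) (Submodule.mem_iSup_of_mem i ?_)
            exact Submodule.apply_mem_map₂ _ ha (by rwa [add_sub_cancel_left])
    · intro l z hz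
      refine Submodule.iSup_induction _ (motive := fun z => _ = Finsupp.single l z) hz ?_ ?_ ?_
      · intro i z hz
        refine Submodule.map₂_le (r := LinearMap.eqLocus _ (Finsupp.lsingle l)).2 ?_ hz
        intro a ha b hb
        simp only [TensorProduct.mk_apply, LinearMap.mem_eqLocus, LinearMap.comp_apply,
          TensorProduct.map_tmul, LinearEquiv.coe_coe]
        rw [gradedComponents_of_mem C.gr C.internal ha, gradedComponents_of_mem D.gr D.internal hb,
          finsuppTensorFinsupp_single]
        simp [Finsupp.lmapDomain_apply, Finsupp.mapDomain_single]
      · simp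
      · intro x y hx hy
        rw [map_add, hx, hy, Finsupp.single_add]
  d := C.d.rTensor D.carrier + D.d.lTensor C.carrier
  d_mem := by
    intro l z hz
    refine Submodule.iSup_induction _ (motive := fun z =>
      (C.d.rTensor D.carrier + D.d.lTensor C.carrier) z ∈ _) hz ?_ ?_ ?_
    · intro i z hz
      refine Submodule.map₂_le (r := Submodule.comap
        (C.d.rTensor D.carrier + D.d.lTensor C.carrier) (⨆ i : ℤ, Submodule.map₂
          (TensorProduct.mk k C.carrier D.carrier) (C.gr i) (D.gr (l + 2 - i)))).2 ?_ hz
      intro a ha b hb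
      simp only [TensorProduct.mk_apply, Submodule.mem_comap, LinearMap.add_apply,
        LinearMap.rTensor_tmul, LinearMap.lTensor_tmul]
      refine add_mem (Submodule.mem_iSup_of_mem (i + 2) ?_) (Submodule.mem_iSup_of_mem i ?_)
      · refine Submodule.apply_mem_map₂ _ (C.d_mem i a ha) ?_
        rwa [show l + 2 - (i + 2) = l - i by ring]
      · refine Submodule.apply_mem_map₂ _ ha ?_
        rw [show l + 2 - i = l - i + 2 by ring]
        exact D.d_mem _ b hb
    · rw [map_zero]; exact zero_mem _
    · intro x y hx hy
      rw [map_add]; exact add_mem hx hy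
  d_pow := by
    refine end_add_pow_char ?_ ?_ ?_
    · ext x y
      simp
    · exact (LinearMap.rTensor_pow C.d p).trans (by rw [C.d_pow, LinearMap.rTensor_zero])
    · exact (LinearMap.lTensor_pow D.d p).trans (by rw [D.d_pow, LinearMap.lTensor_zero])

/-- The one-dimensional `p`-complex `Ṽ_0`, concentrated in degree zero. -/
abbrev V0 (k : Type u) [Field k] (p : ℕ) [hp : Fact p.Prime] : PComplex k p :=
  balanced k 0 hp.out.pos

/-- The `(p-1)`-dimensional balanced indecomposable `p`-complex `Ṽ_{p-2}`. -/
abbrev Vp2 (k : Type u) [Field k] (p : ℕ) [hp : Fact p.Prime] : PComplex k p :=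
  balanced k (p - 2) (Nat.sub_lt hp.out.pos two_pos)

/-- The homological shift `C[1] = C ⊗ Ṽ_{p-2}{-p}`. -/
noncomputable def hshift [Fact p.Prime] [CharP k p] (C : PComplex k p) : PComplex k p :=
  C.tensor ((Vp2 k p).shift (-(p : ℤ)))

/-- The inverse homological shift `C[-1] = C ⊗ Ṽ_{p-2}{p}`. -/
noncomputable def hunshift [Fact p.Prime] [CharP k p] (C : PComplex k p) : PComplex k p :=
  C.tensor ((Vp2 k p).shift (p : ℤ))

/-- The `p`-complex on an internal direct sum of a linearly independent family of subspaces of a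
vector space with an endomorphism shifting the family by two. -/
noncomputable def ofIndep {W : Type u} [AddCommGroup W] [Module k W] (G : ℤ → Submodule k W)
    (hG : iSupIndep G) (D : W →ₗ[k] W) (hD : ∀ l x, x ∈ G l → D x ∈ G (l + 2))
    (hDp : D ^ p = 0) : PComplex k p :=
  have hD' : ∀ x ∈ (⨆ l, G l), D x ∈ (⨆ l, G l) := fun x hx =>
    Submodule.iSup_induction G (motive := fun x => D x ∈ ⨆ l, G l) hx
      (fun l x hx => Submodule.mem_iSup_of_mem (l + 2) (hD l x hx))
      (by rw [map_zero]; exact zero_mem _)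
      (fun x y hx hy => by rw [map_add]; exact add_mem hx hy)
  { carrier := (⨆ l, G l : Submodule k W)
    gr := fun l => (G l).comap (⨆ l, G l).subtype
    internal := by
      rw [DirectSum.isInternal_submodule_iff_iSupIndep_and_iSup_eq_top]
      have hmap : ∀ l, ((G l).comap (⨆ l, G l).subtype).map (⨆ l, G l).subtype = G l := by
        intro l
        rw [Submodule.map_comap_subtype]
        exact inf_eq_right.2 (le_iSup G l)
      constructor
      · rw [iSupIndep_def] at hG ⊢
        intro l
        rw [Submodule.disjoint_def]
        intro x hx hx'
        have h1 := (Submodule.disjoint_def.1 (hG l)) x.1 hx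
        have h2 : x.1 ∈ ⨆ m, ⨆ (_ : m ≠ l), G m := by
          have := Submodule.mem_map_of_mem (f := (⨆ l, G l).subtype) hx'
          simp only [Submodule.map_iSup, hmap] at this
          exact this
        exact Subtype.ext (h1 h2)
      · apply Submodule.map_injective_of_injective (⨆ l, G l).subtype_injective
        rw [Submodule.map_iSup, Submodule.map_top, Submodule.range_subtype]
        simp only [hmap]
    d := D.restrict hD'
    d_mem := fun l x hx => hD l x.1 hx
    d_pow := by
      have : ∀ (m : ℕ) (x : (⨆ l, G l : Submodule k W)),
          (((D.restrict hD') ^ m) x).1 = (D ^ m) x.1 := by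
        intro m
        induction m with
        | zero => intro x; rfl
        | succ m ih =>
          intro x
          rw [pow_succ, Module.End.mul_apply, pow_succ, Module.End.mul_apply]
          exact ih _
      ext x
      exact (this p x).trans (by rw [hDp]; rfl) }

end PComplex

/-! ## `p`-DG algebras and modules -/

/-- A `p`-DG algebra structure on a `k`-algebra `A`: a `ℤ`-grading and a degree-two derivation `d`
with `d ^ p = 0`. -/
structure PDGAlgebra (k : Type u) [Field k] (p : ℕ) (A : Type u) [Ring A] [Algebra k A] where
  gr : ℤ → Submodule k A
  internal : DirectSum.IsInternal gr
  one_mem : (1 : A) ∈ gr 0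
  mul_mem : ∀ (i j : ℤ) (a b : A), a ∈ gr i → b ∈ gr j → a * b ∈ gr (i + j)
  d : A →ₗ[k] A
  d_mem : ∀ (i : ℤ) (a : A), a ∈ gr i → d a ∈ gr (i + 2)
  d_mul : ∀ a b : A, d (a * b) = d a * b + a * d b
  d_pow : d ^ p = 0

namespace PDGAlgebra

variable {k : Type u} [Field k] {p : ℕ} {A : Type u} [Ring A] [Algebra k A]

/-- The opposite `p`-DG algebra. Right `p`-DG modules over `A` are left `p`-DG modules over its
opposite. -/
def op (𝔸 : PDGAlgebra k p A) : PDGAlgebra k p Aᵐᵒᵖ where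
  gr := fun l => (𝔸.gr l).comap (MulOpposite.opLinearEquiv k).symm.toLinearMap
  internal := by
    refine isInternal_of_coaction _ ?_
      (Finsupp.mapRange.linearMap (MulOpposite.opLinearEquiv k).toLinearMap ∘ₗ
        gradedComponents 𝔸.gr 𝔸.internal ∘ₗ
        (MulOpposite.opLinearEquiv k).symm.toLinearMap) ?_
    · rw [eq_top_iff]
      rintro x -
      refine graded_induction 𝔸.gr 𝔸.internal (P := fun y => MulOpposite.op y ∈ _) ?_ ?_ ?_ x.unop
      · exact zero_mem _
      · intro a b ha hb
        exact add_mem ha hb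
      · intro l a ha
        exact Submodule.mem_iSup_of_mem l ha
    · intro l x hx
      have hx' : (MulOpposite.opLinearEquiv k).symm.toLinearMap x ∈ 𝔸.gr l := hx
      rw [LinearMap.comp_apply, LinearMap.comp_apply,
        gradedComponents_of_mem 𝔸.gr 𝔸.internal hx']
      simp
  one_mem := 𝔸.one_mem
  mul_mem := fun i j a b ha hb => by
    have := 𝔸.mul_mem j i _ _ hb ha
    rwa [add_comm] at this
  d := (MulOpposite.opLinearEquiv k).toLinearMap ∘ₗ 𝔸.d ∘ₗ
    (MulOpposite.opLinearEquiv k).symm.toLinearMap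
  d_mem := fun i a ha => 𝔸.d_mem i _ ha
  d_mul := fun a b => MulOpposite.unop_injective
    ((𝔸.d_mul b.unop a.unop).trans (add_comm _ _))
  d_pow := by
    set D : Module.End k Aᵐᵒᵖ := (MulOpposite.opLinearEquiv k).toLinearMap ∘ₗ 𝔸.d ∘ₗ
      (MulOpposite.opLinearEquiv k).symm.toLinearMap
    have : ∀ (m : ℕ) (x : Aᵐᵒᵖ), (D ^ m) x = MulOpposite.op ((𝔸.d ^ m) x.unop) := by
      intro m
      induction m with
      | zero => intro x; rfl
      | succ m ih =>
        intro x
        rw [pow_succ, Module.End.mul_apply, pow_succ, Module.End.mul_apply]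
        exact ih _
    ext x
    rw [this, 𝔸.d_pow]; rfl

end PDGAlgebra

/-- A (left) `p`-DG module over a `p`-DG algebra. -/
structure PDGModule {k : Type u} [Field k] {p : ℕ} {A : Type u} [Ring A] [Algebra k A]
    (𝔸 : PDGAlgebra k p A) extends PComplex k p where
  [moduleA : Module A carrier]
  [tower : IsScalarTower k A carrier]
  smul_mem : ∀ (i j : ℤ) (a : A) (x : carrier), a ∈ 𝔸.gr i → x ∈ gr j → a • x ∈ gr (i + j)
  d_smul : ∀ (a : A) (x : carrier), d (a • x) = 𝔸.d a • x + a • d x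

attribute [instance] PDGModule.moduleA PDGModule.tower

namespace PDGModule

variable {k : Type u} [Field k] {p : ℕ} {A : Type u} [Ring A] [Algebra k A]
  {𝔸 : PDGAlgebra k p A}

/-- A morphism of `p`-DG modules: a degree-zero `A`-linear map commuting with differentials. -/
structure Hom (M N : PDGModule 𝔸) extends PComplex.Hom M.toPComplex N.toPComplex where
  map_smul : ∀ (a : A) (x : M.carrier), toLin (a • x) = a • toLin x

/-- A morphism of `p`-DG modules is a quasi-isomorphism if it is a homotopy equivalence of the
underlying `p`-complexes of `k`-vector spaces. -/
def Hom.IsQuasiIso {M N : PDGModule 𝔸} (f : Hom M N) : Prop := f.toHom.IsHomotopyEquiv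

theorem proj_smul (M : PDGModule 𝔸) (i l : ℤ) (a : A) (ha : a ∈ 𝔸.gr i) (x : M.carrier) :
    M.proj l (a • x) = a • M.proj (l - i) x := by
  refine graded_induction M.gr M.internal
    (P := fun x => M.proj l (a • x) = a • M.proj (l - i) x) (by simp) ?_ ?_ x
  · intro x y hx hy
    rw [smul_add, map_add, hx, hy, map_add, smul_add]
  · intro j x hx
    have hax := M.smul_mem i j a x ha hx
    by_cases hj : j = l - i
    · subst hj
      rw [show i + (l - i) = l by ring] at hax
      exact (gradedProj_of_mem M.gr M.internal hax).trans
        (congrArg _ (gradedProj_of_mem M.gr M.internal hx).symm)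
    · refine (gradedProj_of_mem_ne M.gr M.internal (fun h => hj ?_) hax).trans ?_
      · linarith
      · rw [PComplex.proj, gradedProj_of_mem_ne M.gr M.internal hj hx, smul_zero]

/-- A submodule spanned by a set of elements whose components and differentials stay in the
submodule is stable. -/
theorem stable_span (M : PDGModule 𝔸) (T : Set M.carrier)
    (hproj : ∀ (l : ℤ) (x : M.carrier), x ∈ T → M.proj l x ∈ Submodule.span A T)
    (hd : ∀ x : M.carrier, x ∈ T → M.d x ∈ Submodule.span A T) :
    M.toPComplex.Stable (Submodule.span A T) where
  proj_mem := by
    intro l x hx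
    revert l
    refine Submodule.span_induction (p := fun x _ => ∀ l, M.proj l x ∈ Submodule.span A T)
      (fun x hx l => hproj l x hx) (fun l => by rw [map_zero]; exact zero_mem _)
      (fun x y _ _ h1 h2 l => by rw [map_add]; exact add_mem (h1 l) (h2 l)) ?_ hx
    intro a x _ h
    refine graded_induction 𝔸.gr 𝔸.internal
      (P := fun a => ∀ l, M.proj l (a • x) ∈ Submodule.span A T) ?_ ?_ ?_ a
    · intro l; rw [zero_smul, map_zero]; exact zero_mem _
    · intro a b ha hb l
      rw [add_smul, map_add]; exact add_mem (ha l) (hb l)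
    · intro i a ha l
      rw [proj_smul M i l a ha]
      exact Submodule.smul_mem _ _ (h _)
  d_mem := by
    intro x hx
    refine Submodule.span_induction (p := fun x _ => M.d x ∈ Submodule.span A T)
      (fun x hx => hd x hx) (by rw [map_zero]; exact zero_mem _)
      (fun x y _ _ h1 h2 => by rw [map_add]; exact add_mem h1 h2) ?_ hx
    intro a x hx h
    rw [M.d_smul]
    exact add_mem (Submodule.smul_mem _ _ hx) (Submodule.smul_mem _ _ h)

/-- The `p`-DG submodule structure on a stable submodule. -/
noncomputable def sub (M : PDGModule 𝔸) (S : Submodule A M.carrier)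
    (hS : M.toPComplex.Stable S) : PDGModule 𝔸 where
  toPComplex := M.toPComplex.sub S hS
  moduleA := inferInstanceAs (Module A S)
  tower := inferInstanceAs (IsScalarTower k A S)
  smul_mem := fun i j a x ha hx => M.smul_mem i j a x.1 ha hx
  d_smul := fun a x => Subtype.ext (M.d_smul a x.1)

/-- The quotient `p`-DG module by a stable submodule. -/
noncomputable def quot (M : PDGModule 𝔸) (S : Submodule A M.carrier)
    (hS : M.toPComplex.Stable S) : PDGModule 𝔸 where
  toPComplex := M.toPComplex.quot S hS
  moduleA := inferInstanceAs (Module A (M.carrier ⧸ S))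
  tower := inferInstanceAs (IsScalarTower k A (M.carrier ⧸ S))
  smul_mem := by
    rintro i j a _ ha ⟨x, hx, rfl⟩
    exact ⟨a • x, M.smul_mem i j a x ha hx, rfl⟩
  d_smul := by
    intro a x
    obtain ⟨x, rfl⟩ := S.mkQ_surjective x
    exact congrArg S.mkQ (M.d_smul a x)

/-- The regular left module. -/
def regular (𝔸 : PDGAlgebra k p A) : PDGModule 𝔸 where
  carrier := A
  gr := 𝔸.gr
  internal := 𝔸.internal
  d := 𝔸.d
  d_mem := 𝔸.d_mem
  d_pow := 𝔸.d_pow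
  smul_mem := 𝔸.mul_mem
  d_smul := 𝔸.d_mul

theorem span_singleton_stable (M : PDGModule 𝔸) (e : M.carrier) (he : e ∈ M.gr 0)
    (hde : M.d e = 0) : M.toPComplex.Stable (Submodule.span A {e}) := by
  refine stable_span M {e} ?_ ?_
  · intro l x hx
    obtain rfl : x = e := hx
    by_cases hl : (0 : ℤ) = l
    · subst hl
      rw [PComplex.proj, gradedProj_of_mem M.gr M.internal he]
      exact Submodule.subset_span rfl
    · rw [PComplex.proj, gradedProj_of_mem_ne M.gr M.internal hl he]
      exact zero_mem _
  · intro x hx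
    obtain rfl : x = e := hx
    rw [hde]
    exact zero_mem _

/-- The `p`-DG module `A e`, for a degree-zero element `e` with `d e = 0`. -/
noncomputable def principal (𝔸 : PDGAlgebra k p A) (e : A) (he : e ∈ 𝔸.gr 0) (hde : 𝔸.d e = 0) :
    PDGModule 𝔸 :=
  (regular 𝔸).sub (Submodule.span A ({e} : Set (regular 𝔸).carrier))
    (span_singleton_stable (regular 𝔸) e he hde)

/-- The subspace `A' = ⨁_{l > 0} A^l`. -/
def _root_.PDGAlgebra.augmentation (𝔸 : PDGAlgebra k p A) : Submodule k A :=
  ⨆ l : {l : ℤ // 0 < l}, 𝔸.gr l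

/-- The submodule `A' M` of a `p`-DG module `M`. -/
def augSubmodule (M : PDGModule 𝔸) : Submodule A M.carrier :=
  Submodule.span A {y | ∃ a ∈ 𝔸.augmentation, ∃ x : M.carrier, y = a • x}

theorem augSubmodule_stable (M : PDGModule 𝔸) : M.toPComplex.Stable M.augSubmodule := by
  refine stable_span M _ ?_ ?_
  · rintro l _ ⟨a, ha, x, rfl⟩
    refine Submodule.iSup_induction _ (motive := fun a => M.proj l (a • x) ∈ _) ha ?_ ?_ ?_
    · rintro i a ha
      rw [proj_smul M i l a ha]
      exact Submodule.subset_span ⟨a, Submodule.mem_iSup_of_mem i ha, _, rfl⟩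
    · rw [zero_smul, map_zero]; exact zero_mem _
    · intro a b ha hb
      rw [add_smul, map_add]; exact add_mem ha hb
  · rintro _ ⟨a, ha, x, rfl⟩
    rw [M.d_smul]
    refine add_mem ?_ (Submodule.subset_span ⟨a, ha, _, rfl⟩)
    refine Submodule.subset_span ⟨𝔸.d a, ?_, x, rfl⟩
    refine Submodule.iSup_induction _ (motive := fun a => 𝔸.d a ∈ 𝔸.augmentation) ha ?_ ?_ ?_
    · rintro ⟨i, hi⟩ a ha
      exact Submodule.mem_iSup_of_mem (⟨i + 2, by omega⟩ : {l : ℤ // 0 < l}) (𝔸.d_mem i a ha)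
    · rw [map_zero]; exact zero_mem _
    · intro a b ha hb
      rw [map_add]; exact add_mem ha hb

/-- The `p`-DG module `A e / A' A e`. -/
noncomputable def simple (𝔸 : PDGAlgebra k p A) (e : A) (he : e ∈ 𝔸.gr 0) (hde : 𝔸.d e = 0) :
    PDGModule 𝔸 :=
  (principal 𝔸 e he hde).quot _ (augSubmodule_stable _)

/-- The `A`-linear maps `M → N` that are homogeneous of degree `l`. -/
def homDeg (M N : PDGModule 𝔸) (l : ℤ) : Submodule k (M.carrier →ₗ[k] N.carrier) where
  carrier := {f | (∀ (a : A) (x : M.carrier), f (a • x) = a • f x) ∧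
    ∀ (i : ℤ) (x : M.carrier), x ∈ M.gr i → f x ∈ N.gr (i + l)}
  zero_mem' := ⟨fun a x => (smul_zero a).symm, fun i x _ => zero_mem _⟩
  add_mem' := fun {f g} hf hg =>
    ⟨fun a x => by rw [LinearMap.add_apply, hf.1, hg.1, LinearMap.add_apply, smul_add],
      fun i x hx => add_mem (hf.2 i x hx) (hg.2 i x hx)⟩
  smul_mem' := fun c f hf =>
    ⟨fun a x => by rw [LinearMap.smul_apply, hf.1, LinearMap.smul_apply, smul_comm],
      fun i x hx => Submodule.smul_mem _ _ (hf.2 i x hx)⟩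

theorem homDeg_iSupIndep (M N : PDGModule 𝔸) : iSupIndep (homDeg M N) := by
  refine iSupIndep_of_test _ (fun l => ⨅ i : ℤ, ⨅ x : M.gr i,
    LinearMap.ker (N.proj (i + l) ∘ₗ LinearMap.applyₗ x.1)) ?_ ?_
  · intro l m hm f hf
    simp only [Submodule.mem_iInf, LinearMap.mem_ker, LinearMap.comp_apply]
    intro i x
    exact gradedProj_of_mem_ne N.gr N.internal (fun h => hm (by linarith)) (hf.2 i x.1 x.2)
  · intro l f hf hf'
    simp only [Submodule.mem_iInf, LinearMap.mem_ker, LinearMap.comp_apply] at hf'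
    ext x
    refine graded_induction M.gr M.internal (P := fun x => f x = 0) (map_zero f) ?_ ?_ x
    · intro x y hx hy
      rw [map_add, hx, hy, add_zero]
    · intro i x hx
      exact (gradedProj_of_mem N.gr N.internal (hf.2 i x hx)).symm.trans (hf' i ⟨x, hx⟩)

/-- The endomorphism `f ↦ d ∘ f - f ∘ d` of the space of linear maps. -/
def homD (M N : PDGModule 𝔸) : Module.End k (M.carrier →ₗ[k] N.carrier) :=
  LinearMap.compRight k N.d - LinearMap.lcomp k N.carrier M.d

/-- The `p`-complex `HOM_A(M, N)`: the direct sum over `l` of the spaces of `A`-linear maps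
`M → N` of degree `l`, with differential `f ↦ d ∘ f - f ∘ d`. -/
noncomputable def HOM [Fact p.Prime] [CharP k p] (M N : PDGModule 𝔸) : PComplex k p :=
  PComplex.ofIndep (homDeg M N) (homDeg_iSupIndep M N) (homD M N)
    (by
      intro l f hf
      refine ⟨fun a x => ?_, fun i x hx => ?_⟩
      · change N.d (f (a • x)) - f (M.d (a • x)) = a • (N.d (f x) - f (M.d x))
        rw [hf.1, N.d_smul, M.d_smul, map_add, hf.1, hf.1, smul_sub]
        abel
      · change N.d (f x) - f (M.d x) ∈ _
        refine sub_mem ?_ ?_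
        · have := N.d_mem _ _ (hf.2 i x hx)
          rwa [add_assoc] at this
        · have := hf.2 _ _ (M.d_mem i x hx)
          rwa [show i + 2 + l = i + (l + 2) by ring] at this)
    (by
      refine end_sub_pow_char ?_ ?_ ?_
      · ext f x
        simp
      · have : ∀ (m : ℕ) (f : M.carrier →ₗ[k] N.carrier),
            ((LinearMap.compRight k N.d : Module.End k (M.carrier →ₗ[k] N.carrier)) ^ m) f =
              (N.d ^ m) ∘ₗ f := by
          intro m
          induction m with
          | zero => intro f; rfl
          | succ m ih => intro f; rw [pow_succ, Module.End.mul_apply, ih, pow_succ]; rfl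
        ext f x
        rw [this, N.d_pow]; rfl
      · have : ∀ (m : ℕ) (f : M.carrier →ₗ[k] N.carrier),
            ((LinearMap.lcomp k N.carrier M.d : Module.End k (M.carrier →ₗ[k] N.carrier)) ^ m) f =
              f ∘ₗ (M.d ^ m) := by
          intro m
          induction m with
          | zero => intro f; rfl
          | succ m ih => intro f; rw [pow_succ, Module.End.mul_apply, ih, pow_succ']; rfl
        ext f x
        rw [this, M.d_pow]; simp)

/-- The map of `p`-complexes `HOM_A(M, N₁) → HOM_A(M, N₂)` given by composition with a morphism
`g : N₁ → N₂`. -/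
noncomputable def HOM.postcomp [Fact p.Prime] [CharP k p] (M : PDGModule 𝔸) {N₁ N₂ : PDGModule 𝔸}
    (g : Hom N₁ N₂) : PComplex.Hom (HOM M N₁) (HOM M N₂) :=
  have hg : ∀ l f, f ∈ homDeg M N₁ l → g.toLin ∘ₗ f ∈ homDeg M N₂ l := fun l f hf =>
    ⟨fun a x => by rw [LinearMap.comp_apply, hf.1, g.map_smul]; rfl,
      fun i x hx => g.map_gr _ _ (hf.2 i x hx)⟩
  { toLin := (LinearMap.compRight k g.toLin).restrict
      (p := ⨆ l, homDeg M N₁ l) (q := ⨆ l, homDeg M N₂ l) (fun f hf =>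
        Submodule.iSup_induction _
          (motive := fun f => LinearMap.compRight k g.toLin f ∈ ⨆ l, homDeg M N₂ l) hf
          (fun l f hf => Submodule.mem_iSup_of_mem l (hg l f hf))
          (by rw [map_zero]; exact zero_mem _)
          (fun f f' h h' => by rw [map_add]; exact add_mem h h'))
    map_gr := fun l f hf => hg l f.1 hf
    map_d := fun f => Subtype.ext (LinearMap.ext fun x => by
      change g.toLin (N₁.d (f.1 x) - f.1 (M.d x)) = N₂.d (g.toLin (f.1 x)) - g.toLin (f.1 (M.d x))
      rw [map_sub, g.map_d]) }

/-- A `p`-DG module `M` is cofibrant if for every surjective quasi-isomorphism `N₁ → N₂` the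
induced map `HOM_A(M, N₁) → HOM_A(M, N₂)` is a homotopy equivalence of `p`-complexes. -/
def IsCofibrant [Fact p.Prime] [CharP k p] (M : PDGModule 𝔸) : Prop :=
  ∀ (N₁ N₂ : PDGModule 𝔸) (g : Hom N₁ N₂), Function.Surjective g.toLin → g.IsQuasiIso →
    (HOM.postcomp M g).IsHomotopyEquiv

/-- A morphism `P → M` is a cofibrant replacement of `M` if it is a surjective quasi-isomorphism
and `P` is cofibrant. -/
structure IsCofibrantReplacement [Fact p.Prime] [CharP k p] {P M : PDGModule 𝔸} (f : Hom P M) :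
    Prop where
  cofibrant : P.IsCofibrant
  surjective : Function.Surjective f.toLin
  quasiIso : f.IsQuasiIso

/-- The subspace of `N ⊗_k M` spanned by the elements `n a ⊗ m - n ⊗ a m`. -/
noncomputable def balancing [Fact p.Prime] [CharP k p] (N : PDGModule 𝔸.op) (M : PDGModule 𝔸) :
    Submodule k (N.toPComplex.tensor M.toPComplex).carrier :=
  Submodule.span k {z : N.carrier ⊗[k] M.carrier |
    ∃ (n : N.carrier) (a : A) (m : M.carrier),
      z = (MulOpposite.op a • n) ⊗ₜ[k] m - n ⊗ₜ[k] (a • m)}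

theorem mem_balancing [Fact p.Prime] [CharP k p] (N : PDGModule 𝔸.op) (M : PDGModule 𝔸)
    (n : N.carrier) (a : A) (m : M.carrier) :
    (MulOpposite.op a • n) ⊗ₜ[k] m - n ⊗ₜ[k] (a • m) ∈ balancing N M :=
  Submodule.subset_span ⟨n, a, m, rfl⟩

theorem tmul_mem_gr [Fact p.Prime] [CharP k p] (C D : PComplex k p) (i j : ℤ)
    (x : C.carrier) (y : D.carrier) (hx : x ∈ C.gr i) (hy : y ∈ D.gr j) :
    x ⊗ₜ[k] y ∈ (C.tensor D).gr (i + j) :=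
  Submodule.mem_iSup_of_mem i
    (Submodule.apply_mem_map₂ (TensorProduct.mk k C.carrier D.carrier) hx
      (by rwa [add_sub_cancel_left]))

theorem balancing_proj [Fact p.Prime] [CharP k p] (N : PDGModule 𝔸.op) (M : PDGModule 𝔸)
    (l : ℤ) (n : N.carrier) (a : A) (m : M.carrier) :
    (N.toPComplex.tensor M.toPComplex).proj l
      ((MulOpposite.op a • n) ⊗ₜ[k] m - n ⊗ₜ[k] (a • m)) ∈ balancing N M := by
  let C := N.toPComplex.tensor M.toPComplex
  let F : N.carrier → A → M.carrier → C.carrier :=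
    fun n a m => (MulOpposite.op a • n) ⊗ₜ[k] m - n ⊗ₜ[k] (a • m)
  have F1 : ∀ n n' a m, F (n + n') a m = F n a m + F n' a m := by
    intro n n' a m
    change (_ : N.carrier ⊗[k] M.carrier) = _
    simp only [F, smul_add, TensorProduct.add_tmul]
    exact add_sub_add_comm _ _ _ _
  have F2 : ∀ n a a' m, F n (a + a') m = F n a m + F n a' m := by
    intro n a a' m
    change (_ : N.carrier ⊗[k] M.carrier) = _
    simp only [F, MulOpposite.op_add, add_smul, TensorProduct.add_tmul, TensorProduct.tmul_add]
    exact add_sub_add_comm _ _ _ _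
  have F3 : ∀ n a m m', F n a (m + m') = F n a m + F n a m' := by
    intro n a m m'
    change (_ : N.carrier ⊗[k] M.carrier) = _
    simp only [F, smul_add, TensorProduct.tmul_add]
    exact add_sub_add_comm _ _ _ _
  have z1 : ∀ a m, F 0 a m = 0 := fun a m => by simpa using F1 0 0 a m
  have z2 : ∀ n m, F n 0 m = 0 := fun n m => by simpa using F2 n 0 0 m
  have z3 : ∀ n a, F n a 0 = 0 := fun n a => by simpa using F3 n a 0 0
  change C.proj l (F n a m) ∈ balancing N M
  refine graded_induction N.gr N.internal (P := fun n => C.proj l (F n a m) ∈ balancing N M)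
    (by rw [z1, map_zero]; exact zero_mem _)
    (fun x y hx hy => by rw [F1, map_add]; exact add_mem hx hy) ?_ n
  intro i n hn
  refine graded_induction 𝔸.gr 𝔸.internal (P := fun a => C.proj l (F n a m) ∈ balancing N M)
    (by rw [z2, map_zero]; exact zero_mem _)
    (fun x y hx hy => by rw [F2, map_add]; exact add_mem hx hy) ?_ a
  intro j a ha
  refine graded_induction M.gr M.internal (P := fun m => C.proj l (F n a m) ∈ balancing N M)
    (by rw [z3, map_zero]; exact zero_mem _)
    (fun x y hx hy => by rw [F3, map_add]; exact add_mem hx hy) ?_ m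
  intro r m hm
  have hF : F n a m ∈ C.gr (i + (j + r)) := by
    refine sub_mem ?_ (tmul_mem_gr _ _ i (j + r) n (a • m) hn (M.smul_mem j r a m ha hm))
    rw [show i + (j + r) = j + i + r by ring]
    exact tmul_mem_gr N.toPComplex M.toPComplex (j + i) r _ m (N.smul_mem j i _ n ha hn) hm
  by_cases hl : i + (j + r) = l
  · subst hl
    rw [PComplex.proj, gradedProj_of_mem C.gr C.internal hF]
    exact mem_balancing N M n a m
  · rw [PComplex.proj, gradedProj_of_mem_ne C.gr C.internal hl hF]
    exact zero_mem _

theorem balancing_d [Fact p.Prime] [CharP k p] (N : PDGModule 𝔸.op) (M : PDGModule 𝔸)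
    (n : N.carrier) (a : A) (m : M.carrier) :
    (N.toPComplex.tensor M.toPComplex).d
      ((MulOpposite.op a • n) ⊗ₜ[k] m - n ⊗ₜ[k] (a • m)) ∈ balancing N M := by
  have key : (N.toPComplex.tensor M.toPComplex).d
      ((MulOpposite.op a • n) ⊗ₜ[k] m - n ⊗ₜ[k] (a • m)) =
      ((MulOpposite.op (𝔸.d a) • n) ⊗ₜ[k] m - n ⊗ₜ[k] (𝔸.d a • m)) +
      ((MulOpposite.op a • N.d n) ⊗ₜ[k] m - N.d n ⊗ₜ[k] (a • m)) +
      ((MulOpposite.op a • n) ⊗ₜ[k] M.d m - n ⊗ₜ[k] (a • M.d m)) := by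
    change (N.d.rTensor M.carrier + M.d.lTensor N.carrier)
      ((MulOpposite.op a • n) ⊗ₜ[k] m - n ⊗ₜ[k] (a • m)) = _
    rw [map_sub]
    simp only [LinearMap.add_apply, LinearMap.rTensor_tmul, LinearMap.lTensor_tmul, N.d_smul,
      M.d_smul, TensorProduct.add_tmul, TensorProduct.tmul_add]
    change (MulOpposite.op (𝔸.d a) • n) ⊗ₜ[k] m + _ + _ - _ = _
    abel
  rw [key]
  exact add_mem (add_mem (mem_balancing N M n _ m) (mem_balancing N M _ a m))
    (mem_balancing N M n a _)

theorem balancing_stable [Fact p.Prime] [CharP k p] (N : PDGModule 𝔸.op) (M : PDGModule 𝔸) :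
    (N.toPComplex.tensor M.toPComplex).Stable (balancing N M) where
  proj_mem := fun l x hx => by
    refine (Submodule.span_le (p := (balancing N M).comap
      ((N.toPComplex.tensor M.toPComplex).proj l))).2 ?_ hx
    rintro _ ⟨n, a, m, rfl⟩
    exact balancing_proj N M l n a m
  d_mem := fun x hx => by
    refine (Submodule.span_le (p := (balancing N M).comap
      (N.toPComplex.tensor M.toPComplex).d)).2 ?_ hx
    rintro _ ⟨n, a, m, rfl⟩
    exact balancing_d N M n a m

/-- The tensor product `N ⊗_A M` of a right and a left `p`-DG module, with its grading and the
differential `d(n ⊗ m) = dn ⊗ m + n ⊗ dm`. -/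
noncomputable def tensor [Fact p.Prime] [CharP k p] (N : PDGModule 𝔸.op) (M : PDGModule 𝔸) :
    PComplex k p :=
  (N.toPComplex.tensor M.toPComplex).quot (balancing N M) (balancing_stable N M)

/-- `RHOM_A(M, N)` is homotopy equivalent to `C`. Here `RHOM_A(M, N) = HOM_A(P, N)` for a
cofibrant replacement `P → M`; we require that such a replacement exists, and that
`HOM_A(P, N)` is homotopy equivalent to `C` whichever of them is used. -/
def RHOMEquiv [Fact p.Prime] [CharP k p] (M N : PDGModule 𝔸) (C : PComplex k p) : Prop :=
  (∃ (P : PDGModule 𝔸) (f : Hom P M), IsCofibrantReplacement f) ∧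
  ∀ (P : PDGModule 𝔸) (f : Hom P M), IsCofibrantReplacement f → (HOM P N).HomotopyEquivalent C

/-- The derived tensor product of `N` and `M` over `A` is homotopy equivalent to `C`. Here the
derived tensor product is `N ⊗_A P` for a cofibrant replacement `P → M`; we require that such a
replacement exists, and that `N ⊗_A P` is homotopy equivalent to `C` whichever of them is used. -/
def LTensorEquiv [Fact p.Prime] [CharP k p] (N : PDGModule 𝔸.op) (M : PDGModule 𝔸)
    (C : PComplex k p) : Prop :=
  (∃ (P : PDGModule 𝔸) (f : Hom P M), IsCofibrantReplacement f) ∧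
  ∀ (P : PDGModule 𝔸) (f : Hom P M), IsCofibrantReplacement f → (tensor N P).HomotopyEquivalent C

end PDGModule

/-! ## The zigzag algebra `A_n^!` -/

namespace Zigzag

/-- Two vertices of the quiver `1 ⇄ 2 ⇄ ⋯ ⇄ n` are neighbours. (The vertices `1, …, n` are
represented by the elements `0, …, n - 1` of `Fin n`.) -/
abbrev Adj {n : ℕ} (i j : Fin n) : Prop := i.val + 1 = j.val ∨ j.val + 1 = i.val

/-- The generators of the path algebra: the trivial paths `(i)` and the arrows `(i|j)`. -/
inductive Gen (n : ℕ) : Type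
  | vertex (i : Fin n) : Gen n
  | arrow (i j : Fin n) (h : Adj i j) : Gen n

/-- The length of a generator as a path. -/
def Gen.deg {n : ℕ} : Gen n → ℤ
  | vertex _ => 0
  | arrow _ _ _ => 1

variable (k : Type u) [Field k] (n : ℕ)

open Gen in
/-- The defining relations: the first five say that the generators multiply by composition of
paths (the path `(i|j|⋯)` starts at `i`, and `(i|j)(j|l) = (i|j|l)`), so that they present the path
algebra of the quiver; the last two are `(i|i-1|i) = (i|i+1|i)` for `1 < i < n` and
`(1|2|1) = 0`. -/
inductive Rel : FreeAlgebra k (Gen n) → FreeAlgebra k (Gen n) → Prop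
  | vertex_sq (i : Fin n) :
      Rel (FreeAlgebra.ι k (vertex i) * FreeAlgebra.ι k (vertex i)) (FreeAlgebra.ι k (vertex i))
  | vertex_ne (i j : Fin n) (h : i ≠ j) :
      Rel (FreeAlgebra.ι k (vertex i) * FreeAlgebra.ι k (vertex j)) 0
  | vertex_sum : Rel (∑ i, FreeAlgebra.ι k (vertex i)) 1
  | source (i j : Fin n) (h : Adj i j) :
      Rel (FreeAlgebra.ι k (vertex i) * FreeAlgebra.ι k (arrow i j h))
        (FreeAlgebra.ι k (arrow i j h))
  | target (i j : Fin n) (h : Adj i j) :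
      Rel (FreeAlgebra.ι k (arrow i j h) * FreeAlgebra.ι k (vertex j))
        (FreeAlgebra.ι k (arrow i j h))
  | loop (h i j : Fin n) (hi : h.val + 1 = i.val) (hj : i.val + 1 = j.val) :
      Rel (FreeAlgebra.ι k (arrow i h (.inr hi)) * FreeAlgebra.ι k (arrow h i (.inl hi)))
        (FreeAlgebra.ι k (arrow i j (.inl hj)) * FreeAlgebra.ι k (arrow j i (.inr hj)))
  | first (i j : Fin n) (hi : i.val = 0) (hj : i.val + 1 = j.val) :
      Rel (FreeAlgebra.ι k (arrow i j (.inl hj)) * FreeAlgebra.ι k (arrow j i (.inr hj))) 0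

/-- The algebra `A_n^!`, the quotient of the path algebra of the quiver `1 ⇄ 2 ⇄ ⋯ ⇄ n` by the
relations `(i|i-1|i) = (i|i+1|i)` for `1 < i < n` and `(1|2|1) = 0`. -/
def Alg : Type u := RingQuot (Rel k n)

instance : Ring (Alg k n) := inferInstanceAs (Ring (RingQuot (Rel k n)))

instance : Algebra k (Alg k n) := inferInstanceAs (Algebra k (RingQuot (Rel k n)))

variable {n}

/-- The image of a generator in `A_n^!`. -/
noncomputable def gen (g : Gen n) : Alg k n :=
  RingQuot.mkAlgHom k (Rel k n) (FreeAlgebra.ι k g)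

/-- The idempotent `(i)`. -/
noncomputable def e (i : Fin n) : Alg k n := gen k (.vertex i)

/-- The arrow `(i|j)`. -/
noncomputable def arr (i j : Fin n) (h : Adj i j) : Alg k n := gen k (.arrow i j h)

theorem e_mul_self (i : Fin n) : e k i * e k i = e k i := by
  have := RingQuot.mkAlgHom_rel k (Rel.vertex_sq (k := k) i)
  rwa [map_mul] at this

theorem e_mul_ne (i j : Fin n) (h : i ≠ j) : e k i * e k j = 0 := by
  have := RingQuot.mkAlgHom_rel k (Rel.vertex_ne (k := k) i j h)
  rwa [map_mul, map_zero] at this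

theorem e_mul_arr (i j : Fin n) (h : Adj i j) : e k i * arr k i j h = arr k i j h := by
  have := RingQuot.mkAlgHom_rel k (Rel.source (k := k) i j h)
  rwa [map_mul] at this

theorem arr_mul_e (i j : Fin n) (h : Adj i j) : arr k i j h * e k j = arr k i j h := by
  have := RingQuot.mkAlgHom_rel k (Rel.target (k := k) i j h)
  rwa [map_mul] at this

theorem arr_loop (h i j : Fin n) (hi : h.val + 1 = i.val) (hj : i.val + 1 = j.val) :
    arr k i h (.inr hi) * arr k h i (.inl hi) = arr k i j (.inl hj) * arr k j i (.inr hj) := by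
  have := RingQuot.mkAlgHom_rel k (Rel.loop (k := k) h i j hi hj)
  rwa [map_mul, map_mul] at this

theorem arr_first (i j : Fin n) (hi : i.val = 0) (hj : i.val + 1 = j.val) :
    arr k i j (.inl hj) * arr k j i (.inr hj) = 0 := by
  have := RingQuot.mkAlgHom_rel k (Rel.first (k := k) i j hi hj)
  rwa [map_mul, map_zero] at this

variable (n) in
theorem sum_e : ∑ i : Fin n, e k i = 1 := by
  have := RingQuot.mkAlgHom_rel k (Rel.vertex_sum (k := k) (n := n))
  rwa [map_sum, map_one] at this

variable {k}

/-- An algebra map out of `A_n^!` is given by the images of the generators. -/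
noncomputable def lift {B : Type*} [Ring B] [Algebra k B] (f : Gen n → B)
    (hf : ∀ ⦃x y⦄, Rel k n x y → FreeAlgebra.lift k f x = FreeAlgebra.lift k f y) :
    Alg k n →ₐ[k] B :=
  RingQuot.liftAlgHom k ⟨FreeAlgebra.lift k f, hf⟩

theorem lift_gen {B : Type*} [Ring B] [Algebra k B] (f : Gen n → B)
    (hf : ∀ ⦃x y⦄, Rel k n x y → FreeAlgebra.lift k f x = FreeAlgebra.lift k f y) (g : Gen n) :
    lift f hf (gen k g) = f g := by
  rw [lift, gen]
  exact (RingQuot.liftAlgHom_mkAlgHom_apply k _ _ _).trans (FreeAlgebra.lift_ι_apply f g)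

theorem alg_induction {P : Alg k n → Prop} (hs : ∀ c : k, P (algebraMap k _ c))
    (hg : ∀ g : Gen n, P (gen k g)) (hadd : ∀ a b, P a → P b → P (a + b))
    (hmul : ∀ a b, P a → P b → P (a * b)) (a : Alg k n) : P a := by
  obtain ⟨a, rfl⟩ := RingQuot.mkAlgHom_surjective k (Rel k n) a
  refine FreeAlgebra.induction k (Gen n)
    (motive := fun a => P (RingQuot.mkAlgHom k (Rel k n) a)) ?_ ?_ ?_ ?_ a
  · intro c
    rw [AlgHom.commutes]; exact hs c
  · exact hg
  · intro a b ha hb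
    rw [map_mul]; exact hmul _ _ ha hb
  · intro a b ha hb
    rw [map_add]; exact hadd _ _ ha hb

variable (k n)

/-- The grading of `A_n^!` by path length: the component of degree `l` is spanned by the products
of generators of total length `l`. -/
noncomputable def gr (l : ℤ) : Submodule k (Alg k n) :=
  Submodule.span k {a | ∃ w : List (Gen n), (w.map Gen.deg).sum = l ∧ a = (w.map (gen k)).prod}

theorem gr_one : (1 : Alg k n) ∈ gr k n 0 := Submodule.subset_span ⟨[], rfl, rfl⟩

variable {k n}

theorem gen_mem_gr (g : Gen n) : gen k g ∈ gr k n g.deg :=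
  Submodule.subset_span ⟨[g], by simp, by simp⟩

theorem e_mem_gr (i : Fin n) : e k i ∈ gr k n 0 := gen_mem_gr (.vertex i)

theorem arr_mem_gr (i j : Fin n) (h : Adj i j) : arr k i j h ∈ gr k n 1 :=
  gen_mem_gr (.arrow i j h)

theorem gr_mul {i j : ℤ} {a b : Alg k n} (ha : a ∈ gr k n i) (hb : b ∈ gr k n j) :
    a * b ∈ gr k n (i + j) := by
  have : gr k n i * gr k n j ≤ gr k n (i + j) := by
    rw [gr, gr, Submodule.span_mul_span]
    refine Submodule.span_le.2 ?_
    rintro _ ⟨_, ⟨w, hw, rfl⟩, _, ⟨v, hv, rfl⟩, rfl⟩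
    exact Submodule.subset_span ⟨w ++ v, by simp [hw, hv], by simp⟩
  exact this (Submodule.mul_mem_mul ha hb)

variable (k n)

/-- The coaction `A_n^! → A_n^![ℤ]` encoding the grading. -/
noncomputable def coaction : Alg k n →ₐ[k] AddMonoidAlgebra (Alg k n) ℤ :=
  lift (fun g => AddMonoidAlgebra.single g.deg (gen k g)) (by
    intro x y h
    induction h with
    | vertex_sq i =>
      simp only [map_mul, FreeAlgebra.lift_ι_apply, AddMonoidAlgebra.single_mul_single]
      exact congrArg _ (e_mul_self k i)
    | vertex_ne i j h =>
      simp only [map_mul, FreeAlgebra.lift_ι_apply, AddMonoidAlgebra.single_mul_single, map_zero]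
      exact (congrArg _ (e_mul_ne k i j h)).trans (by simp)
    | vertex_sum =>
      simp only [map_sum, FreeAlgebra.lift_ι_apply, map_one]
      rw [AddMonoidAlgebra.one_def, ← sum_e k n]
      exact (map_sum (AddMonoidAlgebra.singleAddHom (0 : ℤ)) _ _).symm
    | source i j h =>
      simp only [map_mul, FreeAlgebra.lift_ι_apply, AddMonoidAlgebra.single_mul_single]
      exact congrArg _ (e_mul_arr k i j h)
    | target i j h =>
      simp only [map_mul, FreeAlgebra.lift_ι_apply, AddMonoidAlgebra.single_mul_single]
      exact congrArg _ (arr_mul_e k i j h)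
    | loop h i j hi hj =>
      simp only [map_mul, FreeAlgebra.lift_ι_apply, AddMonoidAlgebra.single_mul_single]
      exact congrArg _ (arr_loop k h i j hi hj)
    | first i j hi hj =>
      simp only [map_mul, FreeAlgebra.lift_ι_apply, AddMonoidAlgebra.single_mul_single, map_zero]
      exact (congrArg _ (arr_first k i j hi hj)).trans (by simp))

theorem gr_internal : DirectSum.IsInternal (gr k n) := by
  refine isInternal_of_coaction _ ?_
    ((AddMonoidAlgebra.coeffLinearEquiv k).toLinearMap ∘ₗ (coaction k n).toLinearMap) ?_
  · rw [eq_top_iff]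
    rintro a -
    have hmul : ∀ a b : Alg k n, a ∈ ⨆ l, gr k n l → b ∈ ⨆ l, gr k n l →
        a * b ∈ ⨆ l, gr k n l := by
      intro a b ha hb
      refine Submodule.iSup_induction _ (motive := fun a => a * b ∈ ⨆ l, gr k n l) ha ?_ ?_ ?_
      · intro i a ha
        refine Submodule.iSup_induction _ (motive := fun b => a * b ∈ ⨆ l, gr k n l) hb ?_ ?_ ?_
        · intro j b hb
          exact Submodule.mem_iSup_of_mem (i + j) (gr_mul ha hb)
        · rw [mul_zero]; exact zero_mem _
        · intro x y hx hy
          rw [mul_add]; exact add_mem hx hy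
      · rw [zero_mul]; exact zero_mem _
      · intro x y hx hy
        rw [add_mul]; exact add_mem hx hy
    refine alg_induction (P := fun a => a ∈ ⨆ l, gr k n l) ?_ ?_ ?_ hmul a
    · intro c
      rw [Algebra.algebraMap_eq_smul_one]
      exact Submodule.smul_mem _ _ (Submodule.mem_iSup_of_mem 0 (gr_one k n))
    · intro g
      exact Submodule.mem_iSup_of_mem _ (gen_mem_gr g)
    · intro a b ha hb
      exact add_mem ha hb
  · intro l a ha
    have hw : ∀ w : List (Gen n), coaction k n (w.map (gen k)).prod =
        AddMonoidAlgebra.single (w.map Gen.deg).sum (w.map (gen k)).prod := by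
      intro w
      induction w with
      | nil => exact (map_one (coaction k n)).trans AddMonoidAlgebra.one_def
      | cons g w ih =>
        rw [List.map_cons, List.prod_cons, map_mul, ih, List.map_cons, List.sum_cons, coaction,
          lift_gen, AddMonoidAlgebra.single_mul_single]
    have : gr k n l ≤ LinearMap.eqLocus
        ((AddMonoidAlgebra.coeffLinearEquiv k).toLinearMap ∘ₗ (coaction k n).toLinearMap)
        (Finsupp.lsingle l) := by
      refine Submodule.span_le.2 ?_
      rintro _ ⟨w, rfl, rfl⟩
      exact congrArg AddMonoidAlgebra.coeff (hw w)
    exact this ha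

variable {k n}

/-- The value of the differential on a generator: `∂(i) = 0`,
`∂(i|i+1) = c (i|i+1|i|i+1)` and `∂(i|i-1) = (1 - c) (i|i-1|i|i-1)`. -/
noncomputable def genD (c : k) : Gen n → Alg k n
  | .vertex _ => 0
  | .arrow i j h =>
      (if i.val + 1 = j.val then c else 1 - c) • (arr k i j h * arr k j i h.symm * arr k i j h)

theorem genD_vertex (c : k) (i : Fin n) : genD c (.vertex i) = 0 := rfl

theorem genD_arrow (c : k) (i j : Fin n) (h : Adj i j) : genD c (.arrow i j h) =
    (if i.val + 1 = j.val then c else 1 - c) •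
      (arr k i j h * arr k j i h.symm * arr k i j h) := rfl

theorem genD_loop (c : k) (i j : Fin n) (h : Adj i j) :
    arr k i j h * genD c (.arrow j i h.symm) + genD c (.arrow i j h) * arr k j i h.symm =
      (arr k i j h * arr k j i h.symm) * (arr k i j h * arr k j i h.symm) := by
  have : (if j.val + 1 = i.val then c else 1 - c) + (if i.val + 1 = j.val then c else 1 - c)
      = 1 := by
    rcases h with h | h
    · rw [if_neg (by omega), if_pos h]; ring
    · rw [if_pos h, if_neg (by omega)]; ring
  rw [genD_arrow, genD_arrow, mul_smul_comm, smul_mul_assoc]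
  simp only [← mul_assoc]
  rw [← add_smul, this, one_smul]

/-- The element `a + b ε` of the dual numbers over `A_n^!`. -/
def dual (a b : Alg k n) : DualNumber (Alg k n) := TrivSqZeroExt.inl a + TrivSqZeroExt.inr b

theorem dual_fst (a b : Alg k n) : (dual a b).fst = a := add_zero a

theorem dual_snd (a b : Alg k n) : (dual a b).snd = b := zero_add b

theorem dual_mul (a b a' b' : Alg k n) : dual a b * dual a' b' = dual (a * a') (a * b' + b * a') := by
  refine TrivSqZeroExt.ext ?_ ?_
  · rw [TrivSqZeroExt.fst_mul]
    simp only [dual_fst]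
  · rw [TrivSqZeroExt.snd_mul]
    simp only [dual_fst, dual_snd]
    rfl

theorem dual_zero : dual (0 : Alg k n) 0 = 0 :=
  TrivSqZeroExt.ext (dual_fst _ _) (dual_snd _ _)

theorem genD_rel (c : k) ⦃x y : FreeAlgebra k (Gen n)⦄ (h : Rel k n x y) :
    FreeAlgebra.lift k (fun g => dual (gen k g) (genD c g)) x =
    FreeAlgebra.lift k (fun g => dual (gen k g) (genD c g)) y := by
  induction h with
  | vertex_sq i =>
    simp only [map_mul, FreeAlgebra.lift_ι_apply, dual_mul, genD_vertex, mul_zero, zero_mul,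
      add_zero]
    exact congrArg (dual · 0) (e_mul_self k i)
  | vertex_ne i j h =>
    simp only [map_mul, FreeAlgebra.lift_ι_apply, dual_mul, genD_vertex, mul_zero, zero_mul,
      add_zero, map_zero]
    exact (congrArg (dual · 0) (e_mul_ne k i j h)).trans dual_zero
  | vertex_sum =>
    simp only [map_sum, FreeAlgebra.lift_ι_apply, map_one, genD_vertex]
    refine TrivSqZeroExt.ext ?_ ?_
    · refine (map_sum (TrivSqZeroExt.fstHom k (Alg k n) (Alg k n)) _ _).trans ?_
      exact (Finset.sum_congr rfl fun i _ => dual_fst (gen k (.vertex i)) 0).trans (sum_e k n)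
    · rw [TrivSqZeroExt.snd_sum]
      exact Finset.sum_eq_zero fun i _ => dual_snd (gen k (.vertex i)) 0
  | source i j h =>
    simp only [map_mul, FreeAlgebra.lift_ι_apply, dual_mul, genD_vertex, zero_mul, add_zero]
    refine congrArg₂ dual (e_mul_arr k i j h) ?_
    have : gen k (.vertex i) * arr k i j h = arr k i j h := e_mul_arr k i j h
    rw [genD_arrow, mul_smul_comm, ← mul_assoc, ← mul_assoc, this]
  | target i j h =>
    simp only [map_mul, FreeAlgebra.lift_ι_apply, dual_mul, genD_vertex, mul_zero, zero_add]
    refine congrArg₂ dual (arr_mul_e k i j h) ?_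
    have : arr k i j h * gen k (.vertex j) = arr k i j h := arr_mul_e k i j h
    rw [genD_arrow, smul_mul_assoc, mul_assoc, this]
  | loop h i j hi hj =>
    simp only [map_mul, FreeAlgebra.lift_ι_apply, dual_mul]
    refine congrArg₂ dual (arr_loop k h i j hi hj) ?_
    refine (genD_loop c i h (.inr hi)).trans (Eq.trans ?_ (genD_loop c i j (.inl hj)).symm)
    exact congrArg₂ (· * ·) (arr_loop k h i j hi hj) (arr_loop k h i j hi hj)
  | first i j hi hj =>
    simp only [map_mul, FreeAlgebra.lift_ι_apply, dual_mul, map_zero]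
    refine (congrArg₂ dual (arr_first k i j hi hj) ?_).trans dual_zero
    refine (genD_loop c i j (.inl hj)).trans ?_
    rw [arr_first k i j hi hj, zero_mul]

/-- The algebra map `a ↦ a + ∂(a) ε` to the dual numbers over `A_n^!`. -/
noncomputable def dualMap (c : k) : Alg k n →ₐ[k] DualNumber (Alg k n) :=
  lift (fun g => dual (gen k g) (genD c g)) (genD_rel c)

theorem dualMap_fst (c : k) (a : Alg k n) : (dualMap c a).fst = a := by
  refine alg_induction (P := fun a => (dualMap c a).fst = a) ?_ ?_ ?_ ?_ a
  · intro r
    rw [AlgHom.commutes]; rfl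
  · intro g
    rw [dualMap, lift_gen, dual_fst]
  · intro a b ha hb
    rw [map_add, TrivSqZeroExt.fst_add, ha, hb]
  · intro a b ha hb
    rw [map_mul, TrivSqZeroExt.fst_mul, ha, hb]

/-- The derivation `∂` of `A_n^!` with `∂(i) = 0`, `∂(i|i+1) = c (i|i+1|i|i+1)` and
`∂(i|i-1) = (1 - c) (i|i-1|i|i-1)`. -/
noncomputable def dLin (c : k) : Alg k n →ₗ[k] Alg k n where
  toFun := fun a => (dualMap c a).snd
  map_add' := fun a b => by rw [map_add, TrivSqZeroExt.snd_add]
  map_smul' := fun r a => by rw [map_smul, TrivSqZeroExt.snd_smul, RingHom.id_apply]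

theorem dLin_mul (c : k) (a b : Alg k n) : dLin c (a * b) = dLin c a * b + a * dLin c b := by
  change (dualMap c (a * b)).snd = (dualMap c a).snd * b + a * (dualMap c b).snd
  rw [map_mul, TrivSqZeroExt.snd_mul, dualMap_fst, dualMap_fst, add_comm]
  rfl

theorem dLin_gen (c : k) (g : Gen n) : dLin c (gen k g) = genD c g := by
  change (dualMap c (gen k g)).snd = _
  rw [dualMap, lift_gen, dual_snd]

theorem dLin_e (c : k) (i : Fin n) : dLin c (e k i) = 0 := dLin_gen c (.vertex i)

theorem dLin_arr_up (c : k) (i j : Fin n) (h : i.val + 1 = j.val) :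
    dLin c (arr k i j (.inl h)) =
      c • (arr k i j (.inl h) * arr k j i (.inr h) * arr k i j (.inl h)) := by
  refine (dLin_gen c (.arrow i j (.inl h))).trans ?_
  rw [genD_arrow, if_pos h]

theorem dLin_arr_down (c : k) (i j : Fin n) (h : j.val + 1 = i.val) :
    dLin c (arr k i j (.inr h)) =
      (1 - c) • (arr k i j (.inr h) * arr k j i (.inl h) * arr k i j (.inr h)) := by
  refine (dLin_gen c (.arrow i j (.inr h))).trans ?_
  rw [genD_arrow, if_neg (by omega)]

theorem dLin_one (c : k) : dLin c (1 : Alg k n) = 0 := by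
  have := dLin_mul c (1 : Alg k n) 1
  simpa using this

theorem dLin_mem (c : k) (l : ℤ) (a : Alg k n) (ha : a ∈ gr k n l) :
    dLin c a ∈ gr k n (l + 2) := by
  have hg : ∀ g : Gen n, genD c g ∈ gr k n (g.deg + 2) := by
    rintro (i | ⟨i, j, h⟩)
    · exact zero_mem _
    · have := gr_mul (gr_mul (arr_mem_gr (k := k) i j h) (arr_mem_gr j i h.symm))
        (arr_mem_gr i j h)
      rw [show (1 : ℤ) + 1 + 1 = 1 + 2 by norm_num] at this
      rw [genD_arrow]
      exact Submodule.smul_mem _ _ this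
  have hw : ∀ w : List (Gen n), (w.map (gen k)).prod ∈ gr k n (w.map Gen.deg).sum :=
    fun w => Submodule.subset_span ⟨w, rfl, rfl⟩
  have : gr k n l ≤ (gr k n (l + 2)).comap (dLin c) := by
    refine Submodule.span_le.2 ?_
    rintro _ ⟨w, rfl, rfl⟩
    change dLin c _ ∈ gr k n _
    clear ha
    induction w with
    | nil =>
      change dLin c 1 ∈ gr k n _
      rw [dLin_one]; exact zero_mem _
    | cons g w ih =>
      change dLin c (gen k g * (w.map (gen k)).prod) ∈ gr k n (g.deg + (w.map Gen.deg).sum + 2)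
      rw [dLin_mul, dLin_gen]
      refine add_mem ?_ ?_
      · rw [show g.deg + (w.map Gen.deg).sum + 2 = g.deg + 2 + (w.map Gen.deg).sum by ring]
        exact gr_mul (hg g) (hw w)
      · rw [add_assoc]
        exact gr_mul (gen_mem_gr g) ih
  exact this ha

theorem dLin_pow_arr (c m : k) (u w : Alg k n) (hu : dLin c u = m • (u * w * u))
    (hw : dLin c w = (1 - m) • (w * u * w)) (r : ℕ) :
    ((dLin c) ^ r) u = (∏ s ∈ Finset.range r, (m + s)) • ((u * w) ^ r * u) := by
  have huw : dLin c (u * w) = (u * w) * (u * w) := by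
    rw [dLin_mul, hu, hw, mul_smul_comm, smul_mul_assoc]
    simp only [← mul_assoc]
    rw [← add_smul]; simp
  have hpow : ∀ r : ℕ, dLin c ((u * w) ^ r) = (r : k) • (u * w) ^ (r + 1) := by
    intro r
    induction r with
    | zero => simp [dLin_one]
    | succ r ih =>
      rw [pow_succ, dLin_mul, ih, huw, smul_mul_assoc, ← pow_succ, ← mul_assoc, ← pow_succ,
        ← pow_succ]
      push_cast
      rw [add_smul, one_smul]
  induction r with
  | zero => simp
  | succ r ih =>
    rw [pow_succ', Module.End.mul_apply, ih, map_smul, dLin_mul, hpow, hu, Finset.prod_range_succ,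
      mul_smul_comm, smul_mul_assoc, ← mul_assoc, ← pow_succ, ← add_smul, smul_smul, add_comm m]

theorem prod_add_eq_zero {p : ℕ} [Fact p.Prime] [CharP k p] (m : ZMod p) :
    ∏ s ∈ Finset.range p, (ZMod.castHom (dvd_refl p) k m + s) = 0 := by
  refine Finset.prod_eq_zero (i := (-m).val) (Finset.mem_range.2 (ZMod.val_lt _)) ?_
  have : (((-m).val : ℕ) : k) = ZMod.castHom (dvd_refl p) k (-m) := by
    rw [← map_natCast (ZMod.castHom (dvd_refl p) k), ZMod.natCast_zmod_val]
  rw [this, ← map_add, add_neg_cancel, map_zero]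

theorem dLin_pow_mul {p : ℕ} [Fact p.Prime] [CharP k p] (c : k) (a b : Alg k n) :
    ((dLin c) ^ p) (a * b) = ((dLin c) ^ p) a * b + a * ((dLin c) ^ p) b := by
  let D : Module.End k (Alg k n ⊗[k] Alg k n) :=
    (dLin c).rTensor (Alg k n) + (dLin c).lTensor (Alg k n)
  have h1 : ∀ (r : ℕ) (z : Alg k n ⊗[k] Alg k n),
      LinearMap.mul' k (Alg k n) ((D ^ r) z) = ((dLin c) ^ r) (LinearMap.mul' k (Alg k n) z) := by
    have h0 : ∀ z : Alg k n ⊗[k] Alg k n,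
        LinearMap.mul' k (Alg k n) (D z) = dLin c (LinearMap.mul' k (Alg k n) z) := by
      intro z
      induction z using TensorProduct.induction_on with
      | zero => simp
      | add x y hx hy => simp only [map_add, hx, hy]
      | tmul x y => simp [D, dLin_mul]
    intro r
    induction r with
    | zero => intro z; rfl
    | succ r ih =>
      intro z
      rw [pow_succ, Module.End.mul_apply, ih, h0, pow_succ, Module.End.mul_apply]
  have h2 : D ^ p = ((dLin c) ^ p).rTensor (Alg k n) + ((dLin c) ^ p).lTensor (Alg k n) := by
    rw [← LinearMap.rTensor_pow, ← LinearMap.lTensor_pow]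
    refine end_add_pow ?_
    ext x y
    simp
  have h3 := h1 p (a ⊗ₜ b)
  rw [h2] at h3
  simpa using h3.symm

theorem dLin_pow {p : ℕ} [Fact p.Prime] [CharP k p] (m : ZMod p) :
    (dLin (n := n) (ZMod.castHom (dvd_refl p) k m)) ^ p = 0 := by
  have hz : ∀ a : Alg k n, dLin (ZMod.castHom (dvd_refl p) k m) a = 0 →
      ((dLin (ZMod.castHom (dvd_refl p) k m)) ^ p) a = 0 := by
    intro a ha
    obtain ⟨q, hq⟩ := Nat.exists_eq_succ_of_ne_zero (Fact.out : p.Prime).ne_zero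
    generalize dLin (ZMod.castHom (dvd_refl p) k m) = D at ha
    rw [hq, pow_succ, Module.End.mul_apply, ha, map_zero]
  ext a
  rw [LinearMap.zero_apply]
  refine alg_induction (P := fun a => ((dLin (ZMod.castHom (dvd_refl p) k m)) ^ p) a = 0)
    ?_ ?_ ?_ ?_ a
  · intro r
    rw [Algebra.algebraMap_eq_smul_one, map_smul, hz _ (dLin_one _), smul_zero]
  · rintro (i | ⟨i, j, h⟩)
    · exact hz _ (dLin_e _ i)
    · rcases h with h | h
      · refine (dLin_pow_arr _ (ZMod.castHom (dvd_refl p) k m) (arr k i j (.inl h))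
          (arr k j i (.inr h)) (dLin_arr_up _ i j h) (dLin_arr_down _ j i h) p).trans ?_
        rw [prod_add_eq_zero, zero_smul]
      · refine (dLin_pow_arr _ (ZMod.castHom (dvd_refl p) k (1 - m)) (arr k i j (.inr h))
          (arr k j i (.inl h)) ?_ ?_ p).trans ?_
        · rw [dLin_arr_down _ i j h, map_sub, map_one]
        · rw [dLin_arr_up _ j i h, map_sub, map_one, sub_sub_cancel]
        · rw [prod_add_eq_zero, zero_smul]
  · intro a b ha hb
    rw [map_add, ha, hb, add_zero]
  · intro a b ha hb
    rw [dLin_pow_mul, ha, hb, zero_mul, mul_zero, add_zero]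

variable (k n)

/-- The `p`-DG algebra `(A_n^!, ∂_λ)`, for `λ` in the prime field: the algebra is graded by path
length, and `∂_λ` is the derivation with `∂_λ(i) = 0`, `∂_λ(i|i+1) = λ (i|i+1|i|i+1)` and
`∂_λ(i|i-1) = (1 - λ) (i|i-1|i|i-1)`. -/
noncomputable def pdg {p : ℕ} [Fact p.Prime] [CharP k p] (lam : ZMod p) :
    PDGAlgebra k p (Alg k n) where
  gr := gr k n
  internal := gr_internal k n
  one_mem := gr_one k n
  mul_mem := fun _ _ _ _ ha hb => gr_mul ha hb
  d := dLin (ZMod.castHom (dvd_refl p) k lam)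
  d_mem := dLin_mem _
  d_mul := dLin_mul _
  d_pow := dLin_pow lam

variable {n}

/-- The simple left `p`-DG module `L_i = P_i / A' P_i` over `(A_n^!, ∂_λ)`, where
`P_i = A_n^! (i)`. -/
noncomputable def L {p : ℕ} [Fact p.Prime] [CharP k p] (lam : ZMod p) (i : Fin n) :
    PDGModule (pdg k n lam) :=
  PDGModule.simple (pdg k n lam) (e k i) (e_mem_gr i) (dLin_e _ i)

/-- The simple right `p`-DG module `_iL = _iP / _iP A'` over `(A_n^!, ∂_λ)`, where
`_iP = (i) A_n^!`. -/
noncomputable def R {p : ℕ} [Fact p.Prime] [CharP k p] (lam : ZMod p) (i : Fin n) :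
    PDGModule (pdg k n lam).op :=
  PDGModule.simple (pdg k n lam).op (MulOpposite.op (e k i)) (e_mem_gr i)
    (congrArg MulOpposite.op (dLin_e _ i))

end Zigzag

/-! ## Homotopy theory of `p`-complexes -/

/-! Everything is computed from one explicit cofibrant replacement of `L_i`. Put `P_0 = 0`. Because
`i < n`, the module without differential has the resolution `P_i → P_{i-1} ⊕ P_{i+1} → P_i → L_i`,
with injective first map; the maps are right multiplications by arrows, and the composite vanishes
because of `(i|i-1|i) = (i|i+1|i)`, or `(1|2|1) = 0` when `i = 1`. Write the four arrows as a square
`P q = r s`.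

For `λ = 0` or `λ = 1` one of the two arrows across each edge is killed by `∂`, so `q` and `r` can
be taken to be cycles, while `∂P = PqP` and `∂s = s P q`. In the `p`-DG setting a two-step complex
is folded into one module by replacing each middle term by a string of `p - 1` cells (`v_t` and
`z_t`) and placing the top cell `y` in degree `2 - 2p`. The first string ends in `q g`, with `g` the
bottom cell. Since `s` is not a cycle, the second one must end in the corrected element `s g + ∑
(-1)^{m+1} (m+1)! s x^m P v_{p-2-m}`, where `x = P q` is the loop. The same coefficients make this
element a cycle, because `p! = 0`, and make the `p`-th power of the differential vanish on `y`,
because `binom(p-1, i) = (-1)^i` in characteristic `p`.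

The module so obtained is semifree with a triangular differential, hence cofibrant
(`CellData.isCofibrant`), and exactness of the underlying resolution makes the kernel of its map to
`L_i` acyclic (`SquareData.Resolves.isCofibrantReplacement`). Against the one-dimensional modules
`L_j` and `_jL` all paths of positive length act by zero, so only the cells with idempotent `(j)`
survive: the bottom and top cells for `j = i`, one string, which is a shift of `Ṽ_{p-2}` or its
dual, for `j = i ± 1`, and none otherwise. The reformulations with `[±2]` come from `Ṽ_{p-2} ⊗
Ṽ_{p-2} ≃ Ṽ_0`.

Two general facts make this legitimate. A surjective map of `p`-complexes is a homotopy equivalence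
exactly when every cycle of its kernel is `d^{p-1}` of an element of the kernel. And `∑ d^{p-1-s} h
d^s` is the `(p-1)`-st power of the commutator with `d` applied to `h`, so null-homotopies are
`(p-1)`-fold boundaries in `HOM`; this gives uniqueness of cofibrant replacements up to homotopies
that are module maps, which `HOM` and the tensor product preserve. Exactness over the zigzag algebra
is read off from the normal form of paths (descend, then ascend), whose coordinates are detected by
an explicit right action. -/

theorem gradedProj_comm {k : Type*} [Field k] {V W : Type*} [AddCommGroup V] [Module k V]
    [AddCommGroup W] [Module k W] {gV : ℤ → Submodule k V} (hV : DirectSum.IsInternal gV)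
    {gW : ℤ → Submodule k W} (hW : DirectSum.IsInternal gW) (T : V →ₗ[k] W) (m : ℤ)
    (hT : ∀ l x, x ∈ gV l → T x ∈ gW (l + m)) (l : ℤ) (x : V) :
    gradedProj gW hW (l + m) (T x) = T (gradedProj gV hV l x) := by
  refine graded_induction gV hV
    (P := fun x => gradedProj gW hW (l + m) (T x) = T (gradedProj gV hV l x)) (by simp) ?_ ?_ x
  · intro x y hx hy
    simp only [map_add, hx, hy]
  · intro j x hx
    by_cases hj : j = l
    · subst hj
      rw [gradedProj_of_mem gW hW (hT _ _ hx), gradedProj_of_mem gV hV hx]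
    · rw [gradedProj_of_mem_ne gV hV hj hx,
        gradedProj_of_mem_ne gW hW (fun h => hj (by linarith)) (hT _ _ hx), map_zero]

theorem graded_eq_of_forall_proj {k : Type*} [Field k] {V W : Type*} [AddCommGroup V] [Module k V]
    [AddCommGroup W] [Module k W] {gV : ℤ → Submodule k V} (hV : DirectSum.IsInternal gV)
    (S T : V →ₗ[k] W) (x : V) (h : ∀ l, S (gradedProj gV hV l x) = T (gradedProj gV hV l x)) :
    S x = T x :=
  mem_iSup_of_gradedProj gV hV x (LinearMap.eqLocus S T) h

/-- A linear map on a graded space with prescribed restrictions to the components. -/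
theorem exists_linearMap_of_graded {k : Type*} [Field k] {V W : Type*} [AddCommGroup V]
    [Module k V] [AddCommGroup W] [Module k W] {gV : ℤ → Submodule k V}
    (hV : DirectSum.IsInternal gV) (H : ℤ → V →ₗ[k] W) :
    ∃ T : V →ₗ[k] W, ∀ l x, x ∈ gV l → T x = H l x :=
  ⟨Finsupp.lsum k H ∘ₗ gradedComponents gV hV, fun l x hx => by
    rw [LinearMap.comp_apply, gradedComponents_of_mem gV hV hx]; simp⟩

/-- A linear section over a subspace, with values in a subspace. -/
theorem exists_linear_section {k : Type*} [Field k] {V W : Type*} [AddCommGroup V]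
    [Module k V] [AddCommGroup W] [Module k W] (T : W →ₗ[k] V) (W' : Submodule k W)
    (Z : Submodule k V) (h : ∀ z ∈ Z, ∃ w ∈ W', T w = z) :
    ∃ S : V →ₗ[k] W, (∀ v, S v ∈ W') ∧ ∀ z ∈ Z, T (S z) = z := by
  let Y : Submodule k W := W' ⊓ Z.comap T
  let R : Y →ₗ[k] Z := (T ∘ₗ Y.subtype).codRestrict Z (fun y => y.2.2)
  have hR : LinearMap.range R = ⊤ := by
    rw [LinearMap.range_eq_top]
    rintro ⟨z, hz⟩
    obtain ⟨w, hw, rfl⟩ := h z hz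
    exact ⟨⟨w, hw, hz⟩, rfl⟩
  obtain ⟨S, hS⟩ := R.exists_rightInverse_of_surjective hR
  obtain ⟨S', hS'⟩ := S.exists_extend
  refine ⟨Y.subtype ∘ₗ S', fun v => (S' v).2.1, fun z hz => ?_⟩
  have h1 : S' z = S ⟨z, hz⟩ := LinearMap.congr_fun hS' ⟨z, hz⟩
  have h2 : R (S ⟨z, hz⟩) = ⟨z, hz⟩ := LinearMap.congr_fun hS ⟨z, hz⟩
  rw [← h1] at h2
  exact congrArg Subtype.val h2

namespace PComplex

variable {k : Type u} [Field k] {p : ℕ} {B C D E : PComplex k p}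

theorem Hom.map_d_pow (f : Hom C D) (m : ℕ) (x : C.carrier) :
    f.toLin ((C.d ^ m) x) = (D.d ^ m) (f.toLin x) := by
  induction m generalizing x with
  | zero => rfl
  | succ m ih => rw [pow_succ, Module.End.mul_apply, ih, f.map_d, pow_succ, Module.End.mul_apply]

theorem proj_mem (C : PComplex k p) (l : ℤ) (x : C.carrier) : C.proj l x ∈ C.gr l :=
  gradedProj_mem C.gr C.internal l x

theorem d_pow_mem (C : PComplex k p) (m : ℕ) (l : ℤ) (x : C.carrier) (hx : x ∈ C.gr l) :
    (C.d ^ m) x ∈ C.gr (l + 2 * m) := by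
  induction m with
  | zero => simpa using hx
  | succ m ih =>
    rw [pow_succ', Module.End.mul_apply]
    have := C.d_mem _ _ ih
    rwa [show l + 2 * ((m + 1 : ℕ) : ℤ) = l + 2 * m + 2 by push_cast; ring]

theorem d_pow_apply_of_le (C : PComplex k p) {m : ℕ} (hm : p ≤ m) (x : C.carrier) :
    (C.d ^ m) x = 0 := by
  rw [pow_eq_zero_of_le hm C.d_pow, LinearMap.zero_apply]

/-- The identity morphism. -/
def Hom.id (C : PComplex k p) : Hom C C where
  toLin := LinearMap.id
  map_gr := fun _ _ h => h
  map_d := fun _ => rfl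

/-- The composition of morphisms. -/
def Hom.comp (g : Hom D E) (f : Hom C D) : Hom C E where
  toLin := g.toLin ∘ₗ f.toLin
  map_gr := fun l x hx => g.map_gr l _ (f.map_gr l x hx)
  map_d := fun x => by rw [LinearMap.comp_apply, f.map_d, g.map_d]; rfl

/-- The operator `h ↦ ∑_{s < p} d^{p-1-s} h d^s`. -/
def nullMap (h : C.carrier →ₗ[k] D.carrier) : C.carrier →ₗ[k] D.carrier :=
  ∑ s ∈ Finset.range p, (D.d ^ (p - 1 - s)) ∘ₗ h ∘ₗ (C.d ^ s)

theorem nullMap_apply (h : C.carrier →ₗ[k] D.carrier) (x : C.carrier) :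
    nullMap h x = ∑ s ∈ Finset.range p, (D.d ^ (p - 1 - s)) (h ((C.d ^ s) x)) := by
  simp [nullMap]

theorem nullMap_add (h h' : C.carrier →ₗ[k] D.carrier) :
    nullMap (h + h') = nullMap h + nullMap h' := by
  ext x
  simp [nullMap_apply, Finset.sum_add_distrib]

theorem nullMap_neg (h : C.carrier →ₗ[k] D.carrier) : nullMap (-h) = -nullMap h := by
  ext x
  simp [nullMap_apply]

theorem nullMap_comp (f : Hom B C) (h : C.carrier →ₗ[k] D.carrier) :
    nullMap (C := B) (h ∘ₗ f.toLin) = nullMap h ∘ₗ f.toLin := by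
  ext x
  simp [nullMap_apply, f.map_d_pow]

theorem comp_nullMap (f : Hom D E) (h : C.carrier →ₗ[k] D.carrier) :
    nullMap (D := E) (f.toLin ∘ₗ h) = f.toLin ∘ₗ nullMap h := by
  ext x
  simp [nullMap_apply, f.map_d_pow]

/-- Composing with `d` on either side shifts the sum by one index; the two end terms contain `d ^ p`
and vanish. -/
theorem nullMap_d [hp : Fact p.Prime] (h : C.carrier →ₗ[k] D.carrier) (x : C.carrier) :
    nullMap h (C.d x) = D.d (nullMap h x) := by
  have h1 : ∀ s, (C.d ^ s) (C.d x) = (C.d ^ (s + 1)) x := fun s => by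
    rw [pow_succ, Module.End.mul_apply]
  have h2 : ∀ s y, D.d ((D.d ^ s) y) = (D.d ^ (s + 1)) y := fun s y => by
    rw [pow_succ', Module.End.mul_apply]
  rw [nullMap_apply, nullMap_apply, map_sum]
  simp only [h1, h2]
  obtain ⟨q, rfl⟩ := Nat.exists_eq_succ_of_ne_zero hp.out.ne_zero
  rw [Finset.sum_range_succ, Finset.sum_range_succ' _ q, d_pow_apply_of_le C le_rfl,
    d_pow_apply_of_le D (m := q.succ - 1 - 0 + 1) (by omega), map_zero, map_zero]
  congr 1
  refine Finset.sum_congr rfl fun s hs => ?_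
  have := Finset.mem_range.1 hs
  rw [show q.succ - 1 - (s + 1) + 1 = q.succ - 1 - s by omega]

/-- Only the summand `s = 0` survives on a cycle. This is how null-homotopies are turned into
statements about the image of `d ^ (p - 1)`, and conversely. -/
theorem nullMap_apply_of_cycle [hp : Fact p.Prime] (h : C.carrier →ₗ[k] D.carrier) (x : C.carrier)
    (hx : C.d x = 0) : nullMap h x = (D.d ^ (p - 1)) (h x) := by
  rw [nullMap_apply, Finset.sum_eq_single_of_mem 0 (Finset.mem_range.2 hp.out.pos)]
  · simp
  · intro s _ hs
    obtain ⟨s, rfl⟩ := Nat.exists_eq_succ_of_ne_zero hs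
    rw [Nat.succ_eq_add_one, pow_succ, Module.End.mul_apply, hx]; simp

theorem nullMap_mem (h : C.carrier →ₗ[k] D.carrier)
    (hh : ∀ (l : ℤ) (x : C.carrier), x ∈ C.gr l → h x ∈ D.gr (l + (2 - 2 * (p : ℤ))))
    (l : ℤ) (x : C.carrier) (hx : x ∈ C.gr l) : nullMap h x ∈ D.gr l := by
  rw [nullMap_apply]
  refine Submodule.sum_mem _ fun s hs => ?_
  have hs := Finset.mem_range.1 hs
  have := D.d_pow_mem (p - 1 - s) _ _ (hh _ _ (C.d_pow_mem s l x hx))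
  have e : l + 2 * (s : ℤ) + (2 - 2 * (p : ℤ)) + 2 * ((p - 1 - s : ℕ) : ℤ) = l := by
    rw [Nat.cast_sub (by omega), Nat.cast_sub (by omega)]; push_cast; ring
  rwa [e] at this

theorem NullHomotopic.zero : NullHomotopic (C := C) (D := D) 0 :=
  ⟨0, fun _ _ _ => zero_mem _, by simp⟩

theorem NullHomotopic.add {f g : C.carrier →ₗ[k] D.carrier}
    (hf : NullHomotopic (C := C) (D := D) f) (hg : NullHomotopic (C := C) (D := D) g) :
    NullHomotopic (C := C) (D := D) (f + g) := by
  obtain ⟨h, hh, rfl⟩ := hf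
  obtain ⟨h', hh', rfl⟩ := hg
  exact ⟨h + h', fun l x hx => add_mem (hh l x hx) (hh' l x hx), (nullMap_add h h').symm⟩

theorem NullHomotopic.neg {f : C.carrier →ₗ[k] D.carrier}
    (hf : NullHomotopic (C := C) (D := D) f) : NullHomotopic (C := C) (D := D) (-f) := by
  obtain ⟨h, hh, rfl⟩ := hf
  exact ⟨-h, fun l x hx => neg_mem (hh l x hx), (nullMap_neg h).symm⟩

theorem NullHomotopic.comp_hom {f : C.carrier →ₗ[k] D.carrier}
    (hf : NullHomotopic (C := C) (D := D) f) (g : Hom B C) :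
    NullHomotopic (C := B) (D := D) (f ∘ₗ g.toLin) := by
  obtain ⟨h, hh, rfl⟩ := hf
  exact ⟨h ∘ₗ g.toLin, fun l x hx => hh l _ (g.map_gr l x hx), (nullMap_comp g h).symm⟩

theorem NullHomotopic.hom_comp {f : C.carrier →ₗ[k] D.carrier}
    (hf : NullHomotopic (C := C) (D := D) f) (g : Hom D E) :
    NullHomotopic (C := C) (D := E) (g.toLin ∘ₗ f) := by
  obtain ⟨h, hh, rfl⟩ := hf
  exact ⟨g.toLin ∘ₗ h, fun l x hx => g.map_gr _ _ (hh l x hx), (comp_nullMap g h).symm⟩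

theorem HomotopyEquivalent.symm (h : HomotopyEquivalent C D) : HomotopyEquivalent D C := by
  obtain ⟨f, g, h1, h2⟩ := h
  exact ⟨g, f, h2, h1⟩

theorem HomotopyEquivalent.trans (h : HomotopyEquivalent C D) (h' : HomotopyEquivalent D E) :
    HomotopyEquivalent C E := by
  obtain ⟨f, g, h1, h2⟩ := h
  obtain ⟨f', g', h1', h2'⟩ := h'
  refine ⟨f'.comp f, g.comp g', ?_, ?_⟩
  · convert ((h1'.comp_hom f).hom_comp g).add h1 using 1
    ext x
    simp [Hom.comp]
  · convert ((h2.comp_hom g').hom_comp f').add h2' using 1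
    ext x
    simp [Hom.comp]

/-- A morphism is a homotopy equivalence if it is surjective with acyclic kernel. -/
theorem Hom.isHomotopyEquiv_of_surjective [hp : Fact p.Prime] (f : Hom C D)
    (hf : Function.Surjective f.toLin)
    (hker : ∀ z, f.toLin z = 0 → C.d z = 0 → ∃ w, f.toLin w = 0 ∧ (C.d ^ (p - 1)) w = z) :
    f.IsHomotopyEquiv := by
  have hfproj : ∀ l x, f.toLin (C.proj l x) = D.proj l (f.toLin x) := fun l x => by
    have := gradedProj_comm C.internal D.internal f.toLin 0
      (fun l x hx => by simpa using f.map_gr l x hx) l x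
    rw [add_zero] at this
    exact this.symm
  have hdproj : ∀ (m : ℕ) l x, (C.d ^ m) (C.proj l x) = C.proj (l + 2 * m) ((C.d ^ m) x) :=
    fun m l x => (gradedProj_comm C.internal C.internal (C.d ^ m) (2 * m)
      (fun l x hx => C.d_pow_mem m l x hx) l x).symm
  let K : Submodule k C.carrier := LinearMap.ker f.toLin
  -- Acyclicity of the kernel `K`, made linear in each degree: `S l` picks a preimage under `d ^ (p
  -- - 1)` of every degree `l` cycle of `K`, and the preimage can be taken homogeneous by projecting
  -- it to degree `l + 2 - 2p`.
  have hsec : ∀ l : ℤ, ∃ S : C.carrier →ₗ[k] C.carrier,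
      (∀ v, S v ∈ K ⊓ C.gr (l + (2 - 2 * (p : ℤ)))) ∧
      ∀ z ∈ K ⊓ LinearMap.ker C.d ⊓ C.gr l, (C.d ^ (p - 1)) (S z) = z := by
    intro l
    refine exists_linear_section (C.d ^ (p - 1)) _ _ ?_
    rintro z ⟨⟨hz1, hz2⟩, hz3⟩
    obtain ⟨w, hw1, hw2⟩ := hker z hz1 hz2
    refine ⟨C.proj (l + (2 - 2 * (p : ℤ))) w, ⟨?_, C.proj_mem _ _⟩, ?_⟩
    · exact LinearMap.mem_ker.2 (by rw [hfproj, hw1, map_zero])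
    · rw [hdproj, hw2]
      have : l + (2 - 2 * (p : ℤ)) + 2 * ((p - 1 : ℕ) : ℤ) = l := by
        rw [Nat.cast_sub hp.out.one_le]; push_cast; ring
      rw [this]
      exact gradedProj_of_mem _ _ hz3
  choose S hS1 hS2 using hsec
  obtain ⟨H, hH⟩ := exists_linearMap_of_graded C.internal S
  have hHdeg : ∀ (l : ℤ) (x : C.carrier), x ∈ C.gr l → H x ∈ C.gr (l + (2 - 2 * (p : ℤ))) :=
    fun l x hx => by rw [hH l x hx]; exact (hS1 l x).2
  have hHK : ∀ x, f.toLin (H x) = 0 := fun x =>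
    graded_eq_of_forall_proj C.internal (f.toLin ∘ₗ H) 0 x fun l => by
      rw [LinearMap.comp_apply, hH l _ (gradedProj_mem _ _ _ _)]
      exact (hS1 l _).1
  -- `Φ` is null-homotopic, takes values in `K`, and is the identity on the cycles of `K`, because
  -- there it is `d ^ (p - 1) H`.
  let Φ : Hom C C := ⟨nullMap H, fun l x hx => nullMap_mem H hHdeg l x hx, nullMap_d H⟩
  have hΦnull : NullHomotopic (C := C) (D := C) Φ.toLin := ⟨H, hHdeg, rfl⟩
  have hΦK : ∀ x, f.toLin (Φ.toLin x) = 0 := fun x => by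
    change f.toLin (nullMap H x) = 0
    rw [nullMap_apply, map_sum]
    exact Finset.sum_eq_zero fun s _ => by rw [f.map_d_pow, hHK, map_zero]
  have hΦZ : ∀ x, f.toLin x = 0 → C.d x = 0 → Φ.toLin x = x := by
    intro x hx hdx
    refine graded_eq_of_forall_proj C.internal Φ.toLin LinearMap.id x fun l => ?_
    have h1 : f.toLin (C.proj l x) = 0 := by rw [hfproj, hx, map_zero]
    have h2 : C.d (C.proj l x) = 0 := by
      have := hdproj 1 l x
      rw [pow_one, hdx, map_zero] at this
      exact this
    change nullMap H (C.proj l x) = C.proj l x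
    rw [nullMap_apply_of_cycle H _ h2, hH l _ (C.proj_mem _ _)]
    exact hS2 l _ ⟨⟨h1, h2⟩, C.proj_mem _ _⟩
  -- The map `e` is `(1 - Φ)^m`. If `x` in `K` satisfies `d ^ (m + 1) x = 0`, then `d ^ m x` is a
  -- cycle of `K`, hence fixed by `Φ`, so `d ^ m` kills `x - Φ x`: each factor lowers the order of
  -- nilpotency by one. At `m = p` all of `K` is killed.
  have hpow : ∀ m : ℕ, ∃ e : Hom C C, (∀ x, f.toLin (e.toLin x) = f.toLin x) ∧
      NullHomotopic (C := C) (D := C) (e.toLin - LinearMap.id) ∧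
      ∀ x, f.toLin x = 0 → (C.d ^ m) x = 0 → e.toLin x = 0 := by
    intro m
    induction m with
    | zero =>
      refine ⟨Hom.id C, fun x => rfl, ?_, fun x _ hx => hx⟩
      convert NullHomotopic.zero using 1
      exact sub_self _
    | succ m ih =>
      obtain ⟨e, he1, he2, he3⟩ := ih
      let e' : Hom C C := ⟨LinearMap.id - Φ.toLin, fun l x hx => sub_mem hx (Φ.map_gr l x hx),
        fun x => by simp [Φ.map_d]⟩
      refine ⟨e.comp e', fun x => ?_, ?_, fun x hx hdx => ?_⟩
      · change f.toLin (e.toLin (x - Φ.toLin x)) = _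
        rw [he1, map_sub, hΦK, sub_zero]
      · convert he2.add (hΦnull.hom_comp e).neg using 1
        ext x
        simp [Hom.comp, e']
        abel
      · change e.toLin (x - Φ.toLin x) = 0
        refine he3 _ (by rw [map_sub, hΦK, hx, sub_zero]) ?_
        rw [map_sub, ← Φ.map_d_pow, hΦZ, sub_self]
        · rw [f.map_d_pow, hx, map_zero]
        · rwa [pow_succ', Module.End.mul_apply] at hdx
  obtain ⟨e, he1, he2, he3⟩ := hpow p
  obtain ⟨s, hs⟩ := f.toLin.exists_rightInverse_of_surjective (LinearMap.range_eq_top.2 hf)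
  have hs' : ∀ y, f.toLin (s y) = y := LinearMap.congr_fun hs
  -- As `e` kills the kernel of `f`, it factors through `f`. So `e ∘ s` does not depend on the
  -- linear section `s`, and is therefore graded and compatible with `d` even though `s` need not
  -- be.
  have hes : ∀ x, e.toLin (s (f.toLin x)) = e.toLin x := fun x => by
    have := he3 (s (f.toLin x) - x) (by rw [map_sub, hs', sub_self]) (d_pow_apply_of_le C le_rfl _)
    rwa [map_sub, sub_eq_zero] at this
  refine ⟨⟨e.toLin ∘ₗ s, fun l y hy => ?_, fun y => ?_⟩, ?_, ?_⟩
  · have : f.toLin (C.proj l (s y)) = y := by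
      rw [hfproj, hs']; exact gradedProj_of_mem _ _ hy
    rw [← this, LinearMap.comp_apply, hes]
    exact e.map_gr l _ (C.proj_mem _ _)
  · obtain ⟨x, rfl⟩ := hf y
    rw [← f.map_d, LinearMap.comp_apply, hes, e.map_d, LinearMap.comp_apply, hes]
  · convert he2 using 1
    ext x
    simp [hes]
  · convert NullHomotopic.zero using 1
    ext y
    simp [he1, hs']

/-- A bijective morphism is a homotopy equivalence. -/
theorem Hom.homotopyEquivalent_of_bijective [Fact p.Prime] (f : Hom C D)
    (hi : Function.Injective f.toLin) (hs : Function.Surjective f.toLin) :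
    HomotopyEquivalent C D :=
  ⟨f, f.isHomotopyEquiv_of_surjective hs fun z hz _ =>
    ⟨0, map_zero _, by rw [map_zero]; exact (hi (by rw [hz, map_zero])).symm⟩⟩

/-- The kernel of a surjective homotopy equivalence is acyclic. -/
theorem Hom.IsHomotopyEquiv.acyclic_ker [hp : Fact p.Prime] {f : Hom C D} (hf : f.IsHomotopyEquiv)
    (hs : Function.Surjective f.toLin) (z : C.carrier) (hz : f.toLin z = 0) (hdz : C.d z = 0) :
    ∃ w, f.toLin w = 0 ∧ (C.d ^ (p - 1)) w = z := by
  obtain ⟨g, ⟨h, -, h1⟩, ⟨h', -, h2⟩⟩ := hf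
  change _ = nullMap h at h1
  change _ = nullMap h' at h2
  -- The homotopy `g f - 1 = ∑ d^{p-1-s} h d^s`, evaluated at a cycle with `f z = 0`. The element
  -- `-h z` need not lie in the kernel of `f` and is corrected below.
  have hw : (C.d ^ (p - 1)) (-h z) = z := by
    have := LinearMap.congr_fun h1 z
    rw [nullMap_apply_of_cycle h z hdz] at this
    rw [map_neg, ← this]
    simp [hz]
  set w := -h z
  have hu : (D.d ^ (p - 1)) (f.toLin w) = 0 := by rw [← f.map_d_pow, hw, hz]
  -- In the homotopy for `f g - 1` evaluated at `f w`, the term `s = p - 1` contains `d ^ (p - 1) (f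
  -- w) = 0`; every other term has at least one `d` on the left.
  have ht : ∃ t, f.toLin (g.toLin (f.toLin w)) - f.toLin w = D.d t := by
    have := LinearMap.congr_fun h2 (f.toLin w)
    refine ⟨∑ s ∈ Finset.range (p - 1), (D.d ^ (p - 1 - s - 1)) (h' ((D.d ^ s) (f.toLin w))), ?_⟩
    rw [nullMap_apply, show Finset.range p = Finset.range (p - 1 + 1) by
      rw [Nat.sub_add_cancel hp.out.one_le], Finset.sum_range_succ, hu] at this
    simp only [map_zero, add_zero] at this
    refine this.trans ?_
    rw [map_sum]
    refine Finset.sum_congr rfl fun s hs => ?_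
    have := Finset.mem_range.1 hs
    rw [← Module.End.mul_apply D.d, ← pow_succ', show p - 1 - s - 1 + 1 = p - 1 - s by omega]
  obtain ⟨t, ht⟩ := ht
  obtain ⟨t, rfl⟩ := hs t
  -- The correction has the same image under `f` as `w`, and `d ^ (p - 1)` kills it: `d ^ (p - 1) (g
  -- f w) = g 0` and `d ^ p t = 0`.
  refine ⟨w - (g.toLin (f.toLin w) - C.d t), ?_, ?_⟩
  · rw [map_sub, map_sub, f.map_d, ← ht]; abel
  · rw [map_sub, map_sub, ← g.map_d_pow, hu, map_zero, hw, ← Module.End.mul_apply, ← pow_succ,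
      d_pow_apply_of_le C (by omega)]
    simp

/-- A homotopy equivalence reflects null-homotopies of cycles. -/
theorem Hom.IsHomotopyEquiv.exists_of_cycle [hp : Fact p.Prime] {f : Hom C D}
    (hf : f.IsHomotopyEquiv) (l : ℤ) (z : C.carrier) (hz : z ∈ C.gr l) (hdz : C.d z = 0)
    (w : D.carrier) (hw : w ∈ D.gr (l + (2 - 2 * (p : ℤ)))) (hwz : f.toLin z = (D.d ^ (p - 1)) w) :
    ∃ y ∈ C.gr (l + (2 - 2 * (p : ℤ))), z = (C.d ^ (p - 1)) y := by
  obtain ⟨g, ⟨h, hh, h1⟩, -⟩ := hf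
  change _ = nullMap h at h1
  have := LinearMap.congr_fun h1 z
  rw [nullMap_apply_of_cycle h z hdz] at this
  -- On the cycle `z` the homotopy reads `g f z - z = d ^ (p - 1) (h z)`, and `g f z = d ^ (p - 1)
  -- (g w)`.
  refine ⟨g.toLin w - h z, sub_mem (g.map_gr _ _ hw) (hh l z hz), ?_⟩
  rw [map_sub, ← this, ← g.map_d_pow, ← hwz]
  simp

/-- A homotopy equivalence is surjective on cycles up to null-homotopies. -/
theorem Hom.IsHomotopyEquiv.exists_lift [hp : Fact p.Prime] {f : Hom C D}
    (hf : f.IsHomotopyEquiv) (l : ℤ) (z : D.carrier) (hz : z ∈ D.gr l) (hdz : D.d z = 0) :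
    ∃ y ∈ C.gr l, C.d y = 0 ∧ ∃ w ∈ D.gr (l + (2 - 2 * (p : ℤ))),
      f.toLin y - z = (D.d ^ (p - 1)) w := by
  obtain ⟨g, -, ⟨h, hh, h1⟩⟩ := hf
  change _ = nullMap h at h1
  have := LinearMap.congr_fun h1 z
  rw [nullMap_apply_of_cycle h z hdz] at this
  exact ⟨g.toLin z, g.map_gr l z hz, by rw [← g.map_d, hdz, map_zero], h z, hh l z hz, this⟩

end PComplex

/-! ## Uniqueness of cofibrant replacements -/

/-- By Pascal's rule `binom(p-1, i) + binom(p-1, i+1) = binom(p, i+1)`, which vanishes for `i + 1 <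
p`, so the sign alternates starting from `1`. -/
theorem cast_choose_pred_prime {k : Type*} [CommRing k] {p : ℕ} [hp : Fact p.Prime] [CharP k p]
    (i : ℕ) (hi : i < p) : ((p - 1).choose i : k) = (-1) ^ i := by
  induction i with
  | zero => simp
  | succ i ih =>
    have h1 : ((p.choose (i + 1) : ℕ) : k) = 0 :=
      (CharP.cast_eq_zero_iff k p _).2 (hp.out.dvd_choose_self (Nat.succ_ne_zero i) hi)
    have h2 : p.choose (i + 1) = (p - 1).choose i + (p - 1).choose (i + 1) := by
      conv_lhs => rw [← Nat.sub_add_cancel hp.out.one_le]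
      rfl
    rw [h2, Nat.cast_add, ih (by omega)] at h1
    rw [pow_succ, mul_neg_one]
    exact (neg_eq_of_add_eq_zero_right h1).symm

/-- The binomial signs `(-1)^s` of the expansion cancel against `binom(p-1, s) = (-1)^s`. -/
theorem sub_pow_pred_prime {k E : Type*} [CommRing k] [Ring E] [Algebra k E] {p : ℕ}
    [hp : Fact p.Prime] [CharP k p] {a b : E} (h : Commute a b) :
    (a - b) ^ (p - 1) = ∑ s ∈ Finset.range p, a ^ (p - 1 - s) * b ^ s := by
  rw [sub_eq_add_neg, add_comm, (h.symm.neg_left).add_pow, Nat.sub_add_cancel hp.out.one_le]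
  refine Finset.sum_congr rfl fun s hs => ?_
  have hs := Finset.mem_range.1 hs
  have : (((p - 1).choose s : ℕ) : E) = (-1) ^ s := by
    rw [← map_natCast (algebraMap k E), cast_choose_pred_prime s hs]; simp
  rw [this, neg_pow, mul_assoc ((-1) ^ s), (h.symm.pow_pow s _).eq,
    ((Commute.neg_one_left _).pow_left s).eq, mul_assoc, ← pow_add, Even.neg_one_pow ⟨s, rfl⟩,
    mul_one]

namespace PComplex

variable {k : Type u} [Field k] {p : ℕ} {C D : PComplex k p}

/-- The graded commutator with the differentials. -/
def ad (C D : PComplex k p) : Module.End k (C.carrier →ₗ[k] D.carrier) :=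
  LinearMap.compRight k D.d - LinearMap.lcomp k D.carrier C.d

theorem ad_apply (h : C.carrier →ₗ[k] D.carrier) (x : C.carrier) :
    ad C D h x = D.d (h x) - h (C.d x) := rfl

/-- Left and right composition with the differentials commute, so `sub_pow_pred_prime` applies to
their difference. Consequently null-homotopic maps are precisely the images under the `(p-1)`-st
power of the differential of the complex of maps. -/
theorem ad_pow_pred [hp : Fact p.Prime] [CharP k p] (h : C.carrier →ₗ[k] D.carrier) :
    (ad C D ^ (p - 1)) h = nullMap h := by
  have h1 : ∀ (m : ℕ) (f : C.carrier →ₗ[k] D.carrier),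
      ((LinearMap.compRight k D.d : Module.End k (C.carrier →ₗ[k] D.carrier)) ^ m) f =
        (D.d ^ m) ∘ₗ f := by
    intro m
    induction m with
    | zero => intro f; rfl
    | succ m ih => intro f; rw [pow_succ, Module.End.mul_apply, ih, pow_succ]; rfl
  have h2 : ∀ (m : ℕ) (f : C.carrier →ₗ[k] D.carrier),
      ((LinearMap.lcomp k D.carrier C.d : Module.End k (C.carrier →ₗ[k] D.carrier)) ^ m) f =
        f ∘ₗ (C.d ^ m) := by
    intro m
    induction m with
    | zero => intro f; rfl
    | succ m ih => intro f; rw [pow_succ, Module.End.mul_apply, ih, pow_succ']; rfl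
  have hc : Commute (LinearMap.compRight k D.d : Module.End k (C.carrier →ₗ[k] D.carrier))
      (LinearMap.lcomp k D.carrier C.d) := by
    ext f x
    simp
  rw [ad, sub_pow_pred_prime (k := k) hc, LinearMap.sum_apply, nullMap]
  refine Finset.sum_congr rfl fun s _ => ?_
  rw [Module.End.mul_apply, h2, h1]

end PComplex

namespace PDGModule

variable {k : Type u} [Field k] {p : ℕ} {A : Type u} [Ring A] [Algebra k A]
  {𝔸 : PDGAlgebra k p A} {M N P Q : PDGModule 𝔸}

open PComplex (nullMap ad)

theorem comp_mem_homDeg {l m : ℤ} {f : M.carrier →ₗ[k] N.carrier} {g : N.carrier →ₗ[k] P.carrier}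
    (hg : g ∈ homDeg N P m) (hf : f ∈ homDeg M N l) : g ∘ₗ f ∈ homDeg M P (l + m) :=
  ⟨fun a x => by rw [LinearMap.comp_apply, hf.1, hg.1]; rfl, fun i x hx => by
    rw [← add_assoc]; exact hg.2 _ _ (hf.2 i x hx)⟩

theorem Hom.toLin_mem_homDeg (f : Hom M N) : f.toLin ∈ homDeg M N 0 :=
  ⟨f.map_smul, fun i x hx => by rw [add_zero]; exact f.map_gr i x hx⟩

/-- The morphism given by a cycle of degree zero in the complex of maps. -/
def Hom.ofCycle (f : M.carrier →ₗ[k] N.carrier) (hf : f ∈ homDeg M N 0)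
    (hd : ∀ x, f (M.d x) = N.d (f x)) : Hom M N where
  toLin := f
  map_gr := fun l x hx => by simpa using hf.2 l x hx
  map_d := hd
  map_smul := hf.1

/-- Null-homotopic maps of modules, with a homotopy that is a module map. -/
def ModuleNull (f : M.carrier →ₗ[k] N.carrier) : Prop :=
  ∃ h ∈ homDeg M N (2 - 2 * (p : ℤ)),
    f = nullMap (C := M.toPComplex) (D := N.toPComplex) h

theorem ModuleNull.add {f g : M.carrier →ₗ[k] N.carrier}
    (hf : ModuleNull (M := M) (N := N) f) (hg : ModuleNull (M := M) (N := N) g) :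
    ModuleNull (M := M) (N := N) (f + g) := by
  obtain ⟨h, hh, rfl⟩ := hf
  obtain ⟨h', hh', rfl⟩ := hg
  exact ⟨h + h', add_mem hh hh', (PComplex.nullMap_add h h').symm⟩

theorem ModuleNull.comp_hom {f : N.carrier →ₗ[k] P.carrier}
    (hf : ModuleNull (M := N) (N := P) f) (g : Hom M N) :
    ModuleNull (M := M) (N := P) (f ∘ₗ g.toLin) := by
  obtain ⟨h, hh, rfl⟩ := hf
  refine ⟨h ∘ₗ g.toLin, ?_, (PComplex.nullMap_comp g.toHom h).symm⟩
  have := comp_mem_homDeg hh g.toLin_mem_homDeg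
  rwa [zero_add] at this

section

variable [hp : Fact p.Prime] [CharP k p]

theorem HOM_d_pow_val (m : ℕ) (f : (HOM M N).carrier) :
    (((HOM M N).d ^ m) f).1 = (ad M.toPComplex N.toPComplex ^ m) f.1 := by
  induction m generalizing f with
  | zero => rfl
  | succ m ih =>
    rw [pow_succ, Module.End.mul_apply, ih, pow_succ, Module.End.mul_apply]
    rfl

/-- An element of the complex of maps. -/
def HOM.mk {l : ℤ} (f : M.carrier →ₗ[k] N.carrier) (hf : f ∈ homDeg M N l) : (HOM M N).carrier :=
  ⟨f, Submodule.mem_iSup_of_mem l hf⟩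

/-- A morphism is a degree zero cycle of `HOM P N`. The homotopy equivalence `HOM P M → HOM P N`
hits it up to an image of `d ^ (p - 1)`, which by `ad_pow_pred` is a homotopy that is a module map.
-/
theorem IsCofibrant.exists_lift (hP : P.IsCofibrant) {g : Hom M N}
    (hs : Function.Surjective g.toLin) (hg : g.IsQuasiIso) (f : Hom P N) :
    ∃ a : Hom P M, ModuleNull (M := P) (N := N) (g.toLin ∘ₗ a.toLin - f.toLin) := by
  obtain ⟨y, hy, hdy, w, hw, hwy⟩ := (hP M N g hs hg).exists_lift 0
    (HOM.mk f.toLin f.toLin_mem_homDeg) f.toLin_mem_homDeg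
    (Subtype.ext (LinearMap.ext fun x => by
      change N.d (f.toLin x) - f.toLin (P.d x) = 0
      rw [f.map_d, sub_self]))
  refine ⟨Hom.ofCycle y.1 hy fun x => ?_, w.1, ?_, ?_⟩
  · have := LinearMap.congr_fun (congrArg Subtype.val hdy) x
    exact (sub_eq_zero.1 this).symm
  · rw [zero_add] at hw; exact hw
  · have := congrArg Subtype.val hwy
    rw [HOM_d_pow_val, PComplex.ad_pow_pred] at this
    exact this

/-- Injectivity counterpart of `exists_lift`: the homotopy equivalence of `HOM` complexes reflects
being in the image of `d ^ (p - 1)` for cycles. -/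
theorem IsCofibrant.moduleNull_of_comp (hP : P.IsCofibrant) {g : Hom M N}
    (hs : Function.Surjective g.toLin) (hg : g.IsQuasiIso) (f : P.carrier →ₗ[k] M.carrier)
    (hf : f ∈ homDeg P M 0) (hd : ∀ x, f (P.d x) = M.d (f x))
    (h : ModuleNull (M := P) (N := N) (g.toLin ∘ₗ f)) : ModuleNull (M := P) (N := M) f := by
  obtain ⟨w, hw, hwf⟩ := h
  obtain ⟨y, hy, hyf⟩ := (hP M N g hs hg).exists_of_cycle 0 (HOM.mk f hf) hf
    (Subtype.ext (LinearMap.ext fun x => by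
      change M.d (f x) - f (P.d x) = 0
      rw [hd, sub_self])) (HOM.mk w hw) (by rw [zero_add]; exact hw)
    (Subtype.ext (by
      rw [HOM_d_pow_val, PComplex.ad_pow_pred]
      exact hwf))
  refine ⟨y.1, by rw [zero_add] at hy; exact hy, ?_⟩
  have := congrArg Subtype.val hyf
  rw [HOM_d_pow_val, PComplex.ad_pow_pred] at this
  exact this

/-- The usual uniqueness argument: lift each augmentation through the other, then compare both
composites with the identity after applying the augmentation, where they become homotopic. -/
theorem IsCofibrantReplacement.exists_inverse {f : Hom P M} {g : Hom Q M}
    (hf : IsCofibrantReplacement f) (hg : IsCofibrantReplacement g) :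
    ∃ (a : Hom P Q) (b : Hom Q P),
      ModuleNull (M := P) (N := P) (b.toLin ∘ₗ a.toLin - LinearMap.id) ∧
      ModuleNull (M := Q) (N := Q) (a.toLin ∘ₗ b.toLin - LinearMap.id) := by
  obtain ⟨a, ha⟩ := hf.cofibrant.exists_lift hg.surjective hg.quasiIso f
  obtain ⟨b, hb⟩ := hg.cofibrant.exists_lift hf.surjective hf.quasiIso g
  have key : ∀ {P Q : PDGModule 𝔸} {f : Hom P M} {g : Hom Q M} (_ : IsCofibrantReplacement f)
      (a : Hom P Q) (b : Hom Q P)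
      (_ : ModuleNull (M := P) (N := M) (g.toLin ∘ₗ a.toLin - f.toLin))
      (_ : ModuleNull (M := Q) (N := M) (f.toLin ∘ₗ b.toLin - g.toLin)),
      ModuleNull (M := P) (N := P) (b.toLin ∘ₗ a.toLin - LinearMap.id) := by
    intro P Q f g hf a b ha hb
    refine hf.cofibrant.moduleNull_of_comp hf.surjective hf.quasiIso _ ?_ ?_ ?_
    · refine sub_mem (comp_mem_homDeg (l := 0) (m := 0) b.toLin_mem_homDeg a.toLin_mem_homDeg) ?_
      exact ⟨fun _ _ => rfl, fun i x hx => by rw [add_zero]; exact hx⟩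
    · intro x
      simp [a.map_d, b.map_d]
    -- The identity `f (b a - 1) = (f b - g) a + (g a - f)`.
    · convert (hb.comp_hom a).add ha using 1
      ext x
      simp
  exact ⟨a, b, key hf a b ha hb, key hg b a hb ha⟩

/-! ### Functoriality of the complex of maps -/

/-- Precomposition of maps of modules. -/
noncomputable def HOM.precomp (N : PDGModule 𝔸) (h : (HOM P Q).carrier) :
    (HOM Q N).carrier →ₗ[k] (HOM P N).carrier :=
  (LinearMap.lcomp k N.carrier h.1).restrict (p := ⨆ l, homDeg Q N l) (q := ⨆ l, homDeg P N l)
    (fun f hf => by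
      refine Submodule.iSup_induction _
        (motive := fun f => LinearMap.lcomp k N.carrier h.1 f ∈ ⨆ l, homDeg P N l) hf ?_ ?_ ?_
      · intro l f hf
        refine Submodule.iSup_induction _
          (motive := fun h => f ∘ₗ h ∈ ⨆ l, homDeg P N l) h.2 ?_ ?_ ?_
        · intro m h hh
          exact Submodule.mem_iSup_of_mem _ (comp_mem_homDeg hf hh)
        · rw [LinearMap.comp_zero]; exact zero_mem _
        · intro x y hx hy
          rw [LinearMap.comp_add]; exact add_mem hx hy
      · rw [map_zero]; exact zero_mem _
      · intro x y hx hy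
        rw [map_add]; exact add_mem hx hy)

theorem HOM.precomp_mem {l m : ℤ} (h : (HOM P Q).carrier) (hh : h ∈ (HOM P Q).gr l)
    (f : (HOM Q N).carrier) (hf : f ∈ (HOM Q N).gr m) :
    HOM.precomp N h f ∈ (HOM P N).gr (l + m) :=
  comp_mem_homDeg (f := h.1) (g := f.1) hf hh

/-- Precomposition is itself compatible with differentials: `d(f h) - (d f) h = f (d h)`, without
signs. Its `(p-1)`-st iterate sends a module homotopy for `h` to a homotopy of the induced maps. -/
theorem HOM.ad_pow_precomp (m : ℕ) (h : (HOM P Q).carrier) :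
    (ad (HOM Q N) (HOM P N) ^ m) (HOM.precomp N h) = HOM.precomp N (((HOM P Q).d ^ m) h) := by
  induction m with
  | zero => rfl
  | succ m ih =>
    rw [pow_succ', Module.End.mul_apply, ih, pow_succ', Module.End.mul_apply]
    generalize ((HOM P Q).d ^ m) h = h
    refine LinearMap.ext fun f => Subtype.ext (LinearMap.ext fun x => ?_)
    change (N.d (f.1 (h.1 x)) - f.1 (h.1 (P.d x))) - (N.d (f.1 (h.1 x)) - f.1 (Q.d (h.1 x))) =
      f.1 (Q.d (h.1 x) - h.1 (P.d x))
    rw [map_sub]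
    abel

/-- The morphism of complexes of maps given by precomposition with a morphism. -/
noncomputable def HOM.precompHom (N : PDGModule 𝔸) (a : Hom P Q) :
    PComplex.Hom (HOM Q N) (HOM P N) where
  toLin := HOM.precomp N (HOM.mk a.toLin a.toLin_mem_homDeg)
  map_gr := fun l f hf => by
    have := HOM.precomp_mem (HOM.mk a.toLin a.toLin_mem_homDeg) a.toLin_mem_homDeg f hf
    rwa [zero_add] at this
  map_d := fun f => Subtype.ext (LinearMap.ext fun x => by
    change N.d (f.1 (a.toLin x)) - f.1 (Q.d (a.toLin x)) =
      N.d (f.1 (a.toLin x)) - f.1 (a.toLin (P.d x))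
    rw [a.map_d])

theorem HOM.nullHomotopic_precomp (N : PDGModule 𝔸) {f : P.carrier →ₗ[k] Q.carrier}
    (hf : f ∈ homDeg P Q 0) (hn : ModuleNull (M := P) (N := Q) f) :
    PComplex.NullHomotopic (C := HOM Q N) (D := HOM P N) (HOM.precomp N (HOM.mk f hf)) := by
  obtain ⟨h, hh, hfh⟩ := hn
  refine ⟨HOM.precomp N (HOM.mk h hh), fun l g hg => ?_, ?_⟩
  · rw [add_comm]
    exact HOM.precomp_mem (HOM.mk h hh) hh g hg
  · refine Eq.trans ?_ (PComplex.ad_pow_pred _)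
    rw [HOM.ad_pow_precomp]
    congr 1
    refine Subtype.ext ?_
    rw [HOM_d_pow_val, PComplex.ad_pow_pred]
    exact hfh

theorem HOM.homotopyEquivalent (N : PDGModule 𝔸) (a : Hom P Q) (b : Hom Q P)
    (h1 : ModuleNull (M := P) (N := P) (b.toLin ∘ₗ a.toLin - LinearMap.id))
    (h2 : ModuleNull (M := Q) (N := Q) (a.toLin ∘ₗ b.toLin - LinearMap.id)) :
    (HOM P N).HomotopyEquivalent (HOM Q N) := by
  have key : ∀ {P Q : PDGModule 𝔸} (a : Hom P Q) (b : Hom Q P)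
      (_ : ModuleNull (M := P) (N := P) (b.toLin ∘ₗ a.toLin - LinearMap.id)),
      PComplex.NullHomotopic (C := HOM P N) (D := HOM P N)
        ((HOM.precompHom N a).toLin ∘ₗ (HOM.precompHom N b).toLin - LinearMap.id) := by
    intro P Q a b h
    have hm : b.toLin ∘ₗ a.toLin - LinearMap.id ∈ homDeg P P 0 :=
      sub_mem (comp_mem_homDeg (l := 0) (m := 0) b.toLin_mem_homDeg a.toLin_mem_homDeg)
        ⟨fun _ _ => rfl, fun i x hx => by rw [add_zero]; exact hx⟩
    convert HOM.nullHomotopic_precomp N hm h using 1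
    refine LinearMap.ext fun f => Subtype.ext (LinearMap.ext fun x => ?_)
    exact (map_sub f.1 _ _).symm
  exact ⟨HOM.precompHom N b, HOM.precompHom N a, key a b h1, key b a h2⟩

/-! ### Functoriality of the tensor product -/

/-- The map of tensor products given by a map of modules. -/
noncomputable def tensorLin (N : PDGModule 𝔸.op) (h : P.carrier →ₗ[k] Q.carrier)
    (hh : ∀ (a : A) (x : P.carrier), h (a • x) = a • h x) :
    (tensor N P).carrier →ₗ[k] (tensor N Q).carrier :=
  (balancing N P).mapQ (balancing N Q) (h.lTensor N.carrier) (by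
    refine Submodule.span_le.2 ?_
    rintro _ ⟨n, a, m, rfl⟩
    change h.lTensor N.carrier _ ∈ balancing N Q
    rw [map_sub, LinearMap.lTensor_tmul, LinearMap.lTensor_tmul, hh]
    exact mem_balancing N Q n a (h m))

/-- The class of an elementary tensor. -/
noncomputable def tmk (N : PDGModule 𝔸.op) (P : PDGModule 𝔸) :
    N.carrier ⊗[k] P.carrier →ₗ[k] (tensor N P).carrier := (balancing N P).mkQ

theorem tmk_surjective (N : PDGModule 𝔸.op) (P : PDGModule 𝔸) : Function.Surjective (tmk N P) :=
  (balancing N P).mkQ_surjective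

theorem tmk_smul (N : PDGModule 𝔸.op) (P : PDGModule 𝔸) (n : N.carrier) (a : A) (x : P.carrier) :
    tmk N P (n ⊗ₜ (a • x)) = tmk N P ((MulOpposite.op a • n) ⊗ₜ x) :=
  ((Submodule.Quotient.eq _).2 (mem_balancing N P n a x)).symm

theorem tensor_ext (N : PDGModule 𝔸.op) (P : PDGModule 𝔸) {W : Type*} [AddCommGroup W]
    [Module k W] {f g : (tensor N P).carrier →ₗ[k] W}
    (h : ∀ n x, f (tmk N P (n ⊗ₜ x)) = g (tmk N P (n ⊗ₜ x))) : f = g := by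
  have : f ∘ₗ tmk N P = g ∘ₗ tmk N P := TensorProduct.ext' h
  ext z
  obtain ⟨z, rfl⟩ := tmk_surjective N P z
  exact LinearMap.congr_fun this z

theorem tensor_d_tmk (N : PDGModule 𝔸.op) (P : PDGModule 𝔸) (n : N.carrier) (x : P.carrier) :
    (tensor N P).d (tmk N P (n ⊗ₜ x)) = tmk N P (N.d n ⊗ₜ x) + tmk N P (n ⊗ₜ P.d x) := by
  rw [← map_add]
  rfl

theorem tensorLin_tmk (N : PDGModule 𝔸.op) (h : P.carrier →ₗ[k] Q.carrier)
    (hh : ∀ (a : A) (x : P.carrier), h (a • x) = a • h x) (n : N.carrier) (x : P.carrier) :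
    tensorLin N h hh (tmk N P (n ⊗ₜ x)) = tmk N Q (n ⊗ₜ h x) := rfl

theorem tensor_gr_le (N : PDGModule 𝔸.op) (P : PDGModule 𝔸) (l : ℤ)
    (T : Submodule k (tensor N P).carrier)
    (h : ∀ i n x, n ∈ N.gr i → x ∈ P.gr (l - i) → tmk N P (n ⊗ₜ x) ∈ T) :
    (tensor N P).gr l ≤ T := by
  rintro _ ⟨z, hz, rfl⟩
  have : (N.toPComplex.tensor P.toPComplex).gr l ≤ T.comap (tmk N P) :=
    iSup_le fun i => Submodule.map₂_le.2 fun n hn x hx => h i n x hn hx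
  exact this hz

theorem tmk_mem_gr (N : PDGModule 𝔸.op) (P : PDGModule 𝔸) {i j : ℤ} {n : N.carrier}
    {x : P.carrier} (hn : n ∈ N.gr i) (hx : x ∈ P.gr j) :
    tmk N P (n ⊗ₜ x) ∈ (tensor N P).gr (i + j) :=
  ⟨_, tmul_mem_gr N.toPComplex P.toPComplex i j n x hn hx, rfl⟩

theorem tensorLin_mem (N : PDGModule 𝔸.op) {m : ℤ} {h : P.carrier →ₗ[k] Q.carrier}
    (hh : h ∈ homDeg P Q m) (l : ℤ) (z : (tensor N P).carrier) (hz : z ∈ (tensor N P).gr l) :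
    tensorLin N h hh.1 z ∈ (tensor N Q).gr (l + m) := by
  refine tensor_gr_le N P l (((tensor N Q).gr (l + m)).comap (tensorLin N h hh.1)) ?_ hz
  intro i n x hn hx
  have := tmk_mem_gr N Q hn (hh.2 _ x hx)
  rwa [show i + (l - i + m) = l + m by ring] at this

/-- The same compatibility for `h ↦ 1 ⊗ h`: the terms with the differential of `N` cancel in the
commutator. Linearity over the algebra is carried along because `tensorLin` needs it to be defined.
-/
theorem ad_tensorLin (N : PDGModule 𝔸.op) {h : P.carrier →ₗ[k] Q.carrier}
    (hh : ∀ (a : A) (x : P.carrier), h (a • x) = a • h x) (m : ℕ) :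
    ∃ hh', (ad (tensor N P) (tensor N Q) ^ m) (tensorLin N h hh) =
      tensorLin N ((ad P.toPComplex Q.toPComplex ^ m) h) hh' := by
  induction m with
  | zero => exact ⟨hh, rfl⟩
  | succ m ih =>
    obtain ⟨hh1, ih⟩ := ih
    have e : (ad (tensor N P) (tensor N Q) ^ (m + 1)) (tensorLin N h hh) =
        ad (tensor N P) (tensor N Q)
          (tensorLin N ((ad P.toPComplex Q.toPComplex ^ m) h) hh1) := by
      rw [pow_succ', Module.End.mul_apply, ih]
    rw [e, pow_succ', Module.End.mul_apply]
    clear e ih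
    generalize (ad P.toPComplex Q.toPComplex ^ m) h = h at hh1
    refine ⟨fun a x => ?_, tensor_ext N P fun n x => ?_⟩
    · simp only [PComplex.ad_apply, hh1, P.d_smul, Q.d_smul, map_add, smul_sub]
      abel
    · rw [PComplex.ad_apply, tensorLin_tmk, tensor_d_tmk, tensor_d_tmk, map_add, tensorLin_tmk,
        tensorLin_tmk, tensorLin_tmk, PComplex.ad_apply, TensorProduct.tmul_sub, map_sub]
      abel

/-- The morphism of tensor products given by a morphism of modules. -/
noncomputable def tensorHom (N : PDGModule 𝔸.op) (a : Hom P Q) :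
    PComplex.Hom (tensor N P) (tensor N Q) where
  toLin := tensorLin N a.toLin a.map_smul
  map_gr := fun l z hz => by
    have := tensorLin_mem N a.toLin_mem_homDeg l z hz
    rwa [add_zero] at this
  map_d := fun z => by
    refine LinearMap.congr_fun (f := tensorLin N a.toLin a.map_smul ∘ₗ (tensor N P).d)
      (g := (tensor N Q).d ∘ₗ tensorLin N a.toLin a.map_smul) (tensor_ext N P fun n x => ?_) z
    rw [LinearMap.comp_apply, LinearMap.comp_apply, tensor_d_tmk, map_add, tensorLin_tmk,
      tensorLin_tmk, tensorLin_tmk, tensor_d_tmk, a.map_d]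

theorem nullHomotopic_tensorLin (N : PDGModule 𝔸.op) {f : P.carrier →ₗ[k] Q.carrier}
    (hf : ∀ (a : A) (x : P.carrier), f (a • x) = a • f x)
    (hn : ModuleNull (M := P) (N := Q) f) :
    PComplex.NullHomotopic (C := tensor N P) (D := tensor N Q) (tensorLin N f hf) := by
  obtain ⟨h, hh, rfl⟩ := hn
  refine ⟨tensorLin N h hh.1, fun l z hz => tensorLin_mem N hh l z hz, ?_⟩
  refine Eq.trans ?_ (PComplex.ad_pow_pred _)
  obtain ⟨h', e⟩ := ad_tensorLin N hh.1 (p - 1)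
  rw [e]
  congr 1
  exact (PComplex.ad_pow_pred _).symm

theorem tensor_homotopyEquivalent (N : PDGModule 𝔸.op) (a : Hom P Q) (b : Hom Q P)
    (h1 : ModuleNull (M := P) (N := P) (b.toLin ∘ₗ a.toLin - LinearMap.id))
    (h2 : ModuleNull (M := Q) (N := Q) (a.toLin ∘ₗ b.toLin - LinearMap.id)) :
    (tensor N P).HomotopyEquivalent (tensor N Q) := by
  have key : ∀ {P Q : PDGModule 𝔸} (a : Hom P Q) (b : Hom Q P)
      (_ : ModuleNull (M := P) (N := P) (b.toLin ∘ₗ a.toLin - LinearMap.id)),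
      PComplex.NullHomotopic (C := tensor N P) (D := tensor N P)
        ((tensorHom N b).toLin ∘ₗ (tensorHom N a).toLin - LinearMap.id) := by
    intro P Q a b h
    have hm : ∀ (c : A) (x : P.carrier),
        (b.toLin ∘ₗ a.toLin - LinearMap.id : P.carrier →ₗ[k] P.carrier) (c • x) =
        c • (b.toLin ∘ₗ a.toLin - LinearMap.id : P.carrier →ₗ[k] P.carrier) x := fun c x => by
      simp [a.map_smul, b.map_smul, smul_sub]
    convert nullHomotopic_tensorLin N hm h using 1
    refine tensor_ext N P fun n x => ?_
    rw [tensorLin_tmk, LinearMap.sub_apply, LinearMap.sub_apply, TensorProduct.tmul_sub, map_sub]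
    rfl
  exact ⟨tensorHom N a, tensorHom N b, key a b h1, key b a h2⟩

/-- To compute the derived complex of maps it suffices to use one cofibrant replacement. -/
theorem IsCofibrantReplacement.rhomEquiv {f : Hom P M} (hf : IsCofibrantReplacement f)
    {C : PComplex k p} (h : (HOM P N).HomotopyEquivalent C) : RHOMEquiv M N C := by
  refine ⟨⟨P, f, hf⟩, fun Q g hg => ?_⟩
  obtain ⟨a, b, h1, h2⟩ := hg.exists_inverse hf
  exact (HOM.homotopyEquivalent N a b h1 h2).trans h

/-- To compute the derived tensor product it suffices to use one cofibrant replacement. -/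
theorem IsCofibrantReplacement.ltensorEquiv {f : Hom P M} (hf : IsCofibrantReplacement f)
    {N : PDGModule 𝔸.op} {C : PComplex k p} (h : (tensor N P).HomotopyEquivalent C) :
    LTensorEquiv N M C := by
  refine ⟨⟨P, f, hf⟩, fun Q g hg => ?_⟩
  obtain ⟨a, b, h1, h2⟩ := hg.exists_inverse hf
  exact (tensor_homotopyEquivalent N a b h1 h2).trans h

end

end PDGModule

/-! ## Semifree modules -/

section Leibniz

variable {k : Type*} [Field k] {A V : Type*} [Ring A] [Algebra k A] [AddCommGroup V] [Module k V]
  [Module A V] [IsScalarTower k A V] {D : A →ₗ[k] A} {δ : V →ₗ[k] V}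

/-- On `A ⊗ V` the operators `D ⊗ 1` and `1 ⊗ δ` commute, so the binomial theorem holds for their
sum; the action map `A ⊗ V → V` intertwines that sum with `δ`. -/
theorem leibniz_pow (h : ∀ (a : A) (x : V), δ (a • x) = D a • x + a • δ x) (m : ℕ) (a : A) (x : V) :
    (δ ^ m) (a • x) =
      ∑ j ∈ Finset.range (m + 1), (m.choose j : k) • ((D ^ (m - j)) a • (δ ^ j) x) := by
  let μ : A ⊗[k] V →ₗ[k] V := TensorProduct.lift (Algebra.lsmul k k V).toLinearMap
  have hμ : ∀ (a : A) (x : V), μ (a ⊗ₜ x) = a • x := fun a x => rfl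
  let X : Module.End k (A ⊗[k] V) := δ.lTensor A
  let Y : Module.End k (A ⊗[k] V) := D.rTensor V
  have hc : Commute X Y := by
    ext x y
    simp [X, Y]
  have h0 : ∀ z, μ ((X + Y) z) = δ (μ z) := fun z => by
    induction z using TensorProduct.induction_on with
    | zero => simp
    | add x y hx hy => simp only [map_add, hx, hy]
    | tmul a x =>
      rw [hμ, h, LinearMap.add_apply, map_add, add_comm]
      rfl
  have h1 : ∀ (m : ℕ) z, μ (((X + Y) ^ m) z) = (δ ^ m) (μ z) := by
    intro m
    induction m with
    | zero => intro z; rfl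
    | succ m ih => intro z; rw [pow_succ, Module.End.mul_apply, ih, h0, pow_succ,
        Module.End.mul_apply]
  have hX : ∀ (j : ℕ) a x, (X ^ j) (a ⊗ₜ[k] x) = a ⊗ₜ[k] (δ ^ j) x := fun j a x => by
    rw [show X ^ j = (δ ^ j).lTensor A from LinearMap.lTensor_pow δ j]; rfl
  have hY : ∀ (j : ℕ) a x, (Y ^ j) (a ⊗ₜ[k] x) = (D ^ j) a ⊗ₜ[k] x := fun j a x => by
    rw [show Y ^ j = (D ^ j).rTensor V from LinearMap.rTensor_pow D j]; rfl
  have h2 := h1 m (a ⊗ₜ x)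
  rw [hμ, hc.add_pow, LinearMap.sum_apply, map_sum] at h2
  rw [← h2]
  refine Finset.sum_congr rfl fun j _ => ?_
  rw [Module.End.mul_apply, Module.End.natCast_apply, ← Nat.cast_smul_eq_nsmul k, map_smul,
    map_smul, Module.End.mul_apply, hY, hX, hμ]

/-- All the middle binomial coefficients are divisible by `p`. -/
theorem leibniz_pow_prime {p : ℕ} [hp : Fact p.Prime] [CharP k p]
    (h : ∀ (a : A) (x : V), δ (a • x) = D a • x + a • δ x) (a : A) (x : V) :
    (δ ^ p) (a • x) = (D ^ p) a • x + a • (δ ^ p) x := by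
  rw [leibniz_pow h, Finset.sum_range_succ, Finset.sum_eq_single_of_mem 0
    (Finset.mem_range.2 hp.out.pos)]
  · simp
  · intro j hj hj0
    rw [(CharP.cast_eq_zero_iff k p _).2 (hp.out.dvd_choose_self hj0 (Finset.mem_range.1 hj)),
      zero_smul]

end Leibniz

/-- The data of a semifree module with finitely many cells: the idempotents, the degrees of the
cells, and the matrix of the differential. -/
structure CellData {k : Type u} [Field k] {p : ℕ} {A : Type u} [Ring A] [Algebra k A]
    (𝔸 : PDGAlgebra k p A) (G : Type) where
  idem : G → A
  deg : G → ℤ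
  mat : G → G → A
  idem_mem : ∀ t, idem t ∈ 𝔸.gr 0
  idem_mul_self : ∀ t, idem t * idem t = idem t
  d_idem : ∀ t, 𝔸.d (idem t) = 0
  mat_mem : ∀ t t', mat t t' ∈ 𝔸.gr (deg t + 2 - deg t')
  idem_mul_mat : ∀ t t', idem t * mat t t' = mat t t'
  mat_mul_idem : ∀ t t', mat t t' * idem t' = mat t t'

namespace CellData

set_option linter.unusedSectionVars false

variable {k : Type u} [Field k] {p : ℕ} {A : Type u} [Ring A] [Algebra k A]
  {𝔸 : PDGAlgebra k p A} {G : Type} [Fintype G] [DecidableEq G] (S : CellData 𝔸 G)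

/-- The underlying module: families of coordinates. -/
def coords : Submodule A (G → A) where
  carrier := {f | ∀ t, f t * S.idem t = f t}
  zero_mem' := fun t => zero_mul _
  add_mem' := fun {f g} hf hg t => by rw [Pi.add_apply, add_mul, hf t, hg t]
  smul_mem' := fun a f hf t => by rw [Pi.smul_apply, smul_eq_mul, mul_assoc, hf t]

theorem coords_ext {x y : S.coords} (h : ∀ t, x.1 t = y.1 t) : x = y :=
  Subtype.ext (funext h)

theorem coords_mul_idem (x : S.coords) (t : G) : x.1 t * S.idem t = x.1 t := x.2 t

/-- The generator of a cell. -/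
def cell (t : G) : S.coords :=
  ⟨Pi.single t (S.idem t), fun t' => by
    by_cases h : t' = t
    · subst h; simp [S.idem_mul_self]
    · simp [h]⟩

theorem cell_apply_self (t : G) : (S.cell t).1 t = S.idem t := Pi.single_eq_same _ _

theorem cell_apply_ne {t t' : G} (h : t' ≠ t) : (S.cell t).1 t' = 0 := Pi.single_eq_of_ne h _

theorem idem_smul_cell (t : G) : S.idem t • S.cell t = S.cell t := by
  refine S.coords_ext fun t' => ?_
  change S.idem t * (S.cell t).1 t' = _
  by_cases h : t' = t
  · subst h; rw [cell_apply_self, S.idem_mul_self]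
  · rw [cell_apply_ne S h, mul_zero]

theorem sum_smul_cell (x : S.coords) : ∑ t, x.1 t • S.cell t = x := by
  refine S.coords_ext fun t' => ?_
  rw [Submodule.coe_sum, Finset.sum_apply, Finset.sum_eq_single t']
  · change x.1 t' * (S.cell t').1 t' = _
    rw [cell_apply_self, S.coords_mul_idem]
  · intro t _ h
    change x.1 t * (S.cell t).1 t' = _
    rw [cell_apply_ne S h.symm, mul_zero]
  · simp

/-- The coordinate on a cell. -/
def coord (t : G) : S.coords →ₗ[A] A := LinearMap.proj t ∘ₗ S.coords.subtype

/-- The module map with given values on the generators. -/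
noncomputable def lift {K : Type*} [AddCommGroup K] [Module A K] (κ : G → K) : S.coords →ₗ[A] K :=
  ∑ t, (LinearMap.toSpanSingleton A K (κ t)) ∘ₗ S.coord t

theorem lift_apply {K : Type*} [AddCommGroup K] [Module A K] (κ : G → K) (x : S.coords) :
    S.lift κ x = ∑ t, x.1 t • κ t := by
  rw [lift, LinearMap.sum_apply]
  rfl

theorem lift_cell {K : Type*} [AddCommGroup K] [Module A K] (κ : G → K) (t : G)
    (h : S.idem t • κ t = κ t) : S.lift κ (S.cell t) = κ t := by
  rw [lift_apply, Finset.sum_eq_single t]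
  · rw [cell_apply_self, h]
  · intro t' _ h'
    rw [cell_apply_ne S h', zero_smul]
  · simp

/-- The differential. -/
def diff : S.coords →ₗ[k] S.coords where
  toFun := fun x => ⟨fun t' => 𝔸.d (x.1 t') + ∑ t, x.1 t * S.mat t t', fun t' => by
    have := 𝔸.d_mul (x.1 t') (S.idem t')
    rw [S.coords_mul_idem, S.d_idem, mul_zero, add_zero] at this
    rw [add_mul, ← this, Finset.sum_mul]
    simp only [mul_assoc, S.mat_mul_idem]⟩
  map_add' := fun x y => S.coords_ext fun t' => by
    change 𝔸.d (x.1 t' + y.1 t') + ∑ t, (x.1 t + y.1 t) * S.mat t t' =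
      (𝔸.d (x.1 t') + ∑ t, x.1 t * S.mat t t') + (𝔸.d (y.1 t') + ∑ t, y.1 t * S.mat t t')
    simp only [map_add, add_mul, Finset.sum_add_distrib]
    abel
  map_smul' := fun c x => S.coords_ext fun t' => by
    change 𝔸.d (c • x.1 t') + ∑ t, (c • x.1 t) * S.mat t t' =
      c • (𝔸.d (x.1 t') + ∑ t, x.1 t * S.mat t t')
    simp only [map_smul, smul_mul_assoc, smul_add, Finset.smul_sum]

theorem diff_apply (x : S.coords) (t' : G) :
    (S.diff x).1 t' = 𝔸.d (x.1 t') + ∑ t, x.1 t * S.mat t t' := rfl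

theorem diff_smul (a : A) (x : S.coords) : S.diff (a • x) = 𝔸.d a • x + a • S.diff x := by
  refine S.coords_ext fun t' => ?_
  change 𝔸.d (a * x.1 t') + ∑ t, (a * x.1 t) * S.mat t t' =
    𝔸.d a * x.1 t' + a * (𝔸.d (x.1 t') + ∑ t, x.1 t * S.mat t t')
  rw [𝔸.d_mul, mul_add, Finset.mul_sum, add_assoc]
  simp only [mul_assoc]

theorem diff_cell (t : G) : S.diff (S.cell t) = ∑ t', S.mat t t' • S.cell t' := by
  rw [← S.sum_smul_cell (S.diff (S.cell t))]
  refine Finset.sum_congr rfl fun t' _ => ?_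
  rw [diff_apply, Finset.sum_eq_single t, cell_apply_self, S.idem_mul_mat]
  · by_cases h : t' = t
    · subst h; rw [cell_apply_self, S.d_idem, zero_add]
    · rw [cell_apply_ne S h, map_zero, zero_add]
  · intro t'' _ h
    rw [cell_apply_ne S h, zero_mul]
  · simp

/-- By `leibniz_pow_prime` and `𝔸.d ^ p = 0`, the `p`-th power of the differential is linear over
the algebra, so the generators suffice. -/
theorem diff_pow_eq_zero [Fact p.Prime] [CharP k p] (h : ∀ t, (S.diff ^ p) (S.cell t) = 0) :
    S.diff ^ p = 0 := by
  ext1 x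
  rw [← S.sum_smul_cell x, map_sum]
  refine Finset.sum_eq_zero fun t _ => ?_
  rw [leibniz_pow_prime S.diff_smul, h, 𝔸.d_pow]
  simp

/-- The elements of degree `l`. -/
def grade (l : ℤ) : Submodule k S.coords where
  carrier := {x | ∀ t, x.1 t ∈ 𝔸.gr (l - S.deg t)}
  zero_mem' := fun _ => zero_mem _
  add_mem' := fun {_ _} hx hy t => add_mem (hx t) (hy t)
  smul_mem' := fun c _ hx t => Submodule.smul_mem _ c (hx t)

theorem cell_mem (t : G) : S.cell t ∈ S.grade (S.deg t) := fun t' => by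
  by_cases h : t' = t
  · subst h; rw [cell_apply_self, sub_self]; exact S.idem_mem _
  · rw [cell_apply_ne S h]; exact zero_mem _

theorem smul_mem_grade {i j : ℤ} {a : A} {x : S.coords} (ha : a ∈ 𝔸.gr i) (hx : x ∈ S.grade j) :
    a • x ∈ S.grade (i + j) := fun t => by
  have := 𝔸.mul_mem i _ a _ ha (hx t)
  rwa [← add_sub_assoc] at this

theorem grade_internal : DirectSum.IsInternal S.grade := by
  rw [DirectSum.isInternal_submodule_iff_iSupIndep_and_iSup_eq_top]
  constructor
  · refine iSupIndep_of_test _ (fun l => ⨅ t : G, LinearMap.ker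
      (gradedProj 𝔸.gr 𝔸.internal (l - S.deg t) ∘ₗ (S.coord t).restrictScalars k)) ?_ ?_
    · intro l m hm x hx
      rw [Submodule.mem_iInf]
      exact fun t => gradedProj_of_mem_ne 𝔸.gr 𝔸.internal (fun h => hm (by linarith)) (hx t)
    · intro l x hx hx'
      rw [Submodule.mem_iInf] at hx'
      exact S.coords_ext fun t => (gradedProj_of_mem 𝔸.gr 𝔸.internal (hx t)).symm.trans (hx' t)
  · rw [eq_top_iff]
    intro x _
    rw [← S.sum_smul_cell x]
    refine Submodule.sum_mem _ fun t _ => ?_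
    refine graded_induction 𝔸.gr 𝔸.internal (P := fun a => a • S.cell t ∈ _) ?_ ?_ ?_ (x.1 t)
    · rw [zero_smul]; exact zero_mem _
    · intro a b ha hb
      rw [add_smul]; exact add_mem ha hb
    · intro l a ha
      exact Submodule.mem_iSup_of_mem _ (S.smul_mem_grade ha (S.cell_mem t))

theorem diff_mem (l : ℤ) (x : S.coords) (hx : x ∈ S.grade l) : S.diff x ∈ S.grade (l + 2) := by
  intro t'
  rw [diff_apply]
  refine add_mem ?_ (Submodule.sum_mem _ fun t _ => ?_)
  · have := 𝔸.d_mem _ _ (hx t')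
    rwa [show l - S.deg t' + 2 = l + 2 - S.deg t' by ring] at this
  · have := 𝔸.mul_mem _ _ _ _ (hx t) (S.mat_mem t t')
    rwa [show l - S.deg t + (S.deg t + 2 - S.deg t') = l + 2 - S.deg t' by ring] at this

/-- The semifree module. -/
abbrev toModule (hp : S.diff ^ p = 0) : PDGModule 𝔸 where
  carrier := S.coords
  gr := S.grade
  internal := S.grade_internal
  d := S.diff
  d_mem := S.diff_mem
  d_pow := hp
  smul_mem := fun _ _ _ _ ha hx => S.smul_mem_grade ha hx
  d_smul := S.diff_smul

variable {S}

theorem linear_eq {hp : S.diff ^ p = 0} {N : PDGModule 𝔸}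
    {f : (S.toModule hp).carrier →ₗ[k] N.carrier} (hf : ∀ (a : A) x, f (a • x) = a • f x)
    (x : S.coords) : f x = ∑ t, x.1 t • f (S.cell t) := by
  conv_lhs => rw [← S.sum_smul_cell x]
  exact (map_sum f _ _).trans (Finset.sum_congr rfl fun t _ => hf _ _)

theorem linear_ext {hp : S.diff ^ p = 0} {N : PDGModule 𝔸}
    {f g : (S.toModule hp).carrier →ₗ[k] N.carrier} (hf : ∀ (a : A) x, f (a • x) = a • f x)
    (hg : ∀ (a : A) x, g (a • x) = a • g x) (h : ∀ t, f (S.cell t) = g (S.cell t)) : f = g := by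
  refine LinearMap.ext fun x => ?_
  rw [linear_eq hf, linear_eq hg]
  exact Finset.sum_congr rfl fun t _ => by rw [h]

/-- The module map out of a semifree module with given values on the generators. -/
noncomputable def liftK (hp : S.diff ^ p = 0) (N : PDGModule 𝔸) (κ : G → N.carrier) :
    (S.toModule hp).carrier →ₗ[k] N.carrier :=
  (S.lift κ).restrictScalars k

theorem liftK_smul (hp : S.diff ^ p = 0) (N : PDGModule 𝔸) (κ : G → N.carrier) (a : A)
    (x : (S.toModule hp).carrier) : liftK hp N κ (a • x) = a • liftK hp N κ x :=
  (S.lift κ).map_smul a x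

theorem liftK_cell (hp : S.diff ^ p = 0) (N : PDGModule 𝔸) (κ : G → N.carrier) (t : G)
    (h : S.idem t • κ t = κ t) : liftK hp N κ (S.cell t) = κ t := S.lift_cell κ t h

/-- There are finitely many cells, and a map is determined by its values on them; splitting each
value into homogeneous components writes the map as a finite sum of homogeneous ones. Hence `HOM`
out of a semifree module contains every module map. -/
theorem mem_iSup_homDeg {hp : S.diff ^ p = 0} {N : PDGModule 𝔸}
    {f : (S.toModule hp).carrier →ₗ[k] N.carrier} (hf : ∀ (a : A) x, f (a • x) = a • f x) :
    f ∈ ⨆ l, PDGModule.homDeg (S.toModule hp) N l := by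
  let φ : G → N.carrier → ((S.toModule hp).carrier →ₗ[k] N.carrier) := fun t κ =>
    ((LinearMap.toSpanSingleton A N.carrier κ) ∘ₗ S.coord t).restrictScalars k
  have hφ : ∀ t κ (x : S.coords), φ t κ x = x.1 t • κ := fun t κ x => rfl
  have e : f = ∑ t, φ t (f (S.cell t)) := by
    refine LinearMap.ext fun x => ?_
    rw [LinearMap.sum_apply, linear_eq hf]
    rfl
  rw [e]
  refine Submodule.sum_mem _ fun t _ => ?_
  refine graded_induction N.gr N.internal (P := fun κ => φ t κ ∈ _) ?_ ?_ ?_ (f (S.cell t))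
  · have : φ t 0 = 0 := LinearMap.ext fun x => smul_zero _
    rw [this]; exact zero_mem _
  · intro κ κ' h h'
    have : φ t (κ + κ') = φ t κ + φ t κ' := LinearMap.ext fun x => smul_add _ _ _
    rw [this]; exact add_mem h h'
  · intro l κ hκ
    refine Submodule.mem_iSup_of_mem (l - S.deg t) ⟨fun a x => ?_, fun i x hx => ?_⟩
    · exact mul_smul a (S.coord t x) κ
    · have := N.smul_mem _ _ _ _ (hx t) hκ
      rwa [show i - S.deg t + l = i + (l - S.deg t) by ring] at this

end CellData

namespace PDGModule

variable {k : Type u} [Field k] {p : ℕ} {A : Type u} [Ring A] [Algebra k A]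
  {𝔸 : PDGAlgebra k p A} {M N : PDGModule 𝔸}

theorem HOM.smul_apply [Fact p.Prime] [CharP k p] (f : (HOM M N).carrier) (a : A) (x : M.carrier) :
    f.1 (a • x) = a • f.1 x := by
  refine Submodule.iSup_induction _
    (motive := fun f : M.carrier →ₗ[k] N.carrier => f (a • x) = a • f x) f.2 ?_ ?_ ?_
  · intro l f hf
    exact hf.1 a x
  · simp
  · intro f g hf hg
    rw [LinearMap.add_apply, hf, hg, LinearMap.add_apply, smul_add]

theorem d_pow_smul (M : PDGModule 𝔸) {e : A} (he : 𝔸.d e = 0) (m : ℕ) (x : M.carrier) :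
    (M.d ^ m) (e • x) = e • (M.d ^ m) x := by
  induction m generalizing x with
  | zero => rfl
  | succ m ih =>
    rw [pow_succ, Module.End.mul_apply, M.d_smul, he, zero_smul, zero_add, ih,
      Module.End.mul_apply]

end PDGModule

/-! ### Triangular semifree modules are cofibrant -/

namespace CellData

variable {k : Type u} [Field k] {p : ℕ} {A : Type u} [Ring A] [Algebra k A]
  {𝔸 : PDGAlgebra k p A} {G : Type} [Fintype G] [DecidableEq G] {S : CellData 𝔸 G}

open PComplex (ad)

/-- The differential of a cell of rank at most `r` is a combination of cells of rank below `r`. -/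
theorem ad_cell_of_kills {hp : S.diff ^ p = 0} {N : PDGModule 𝔸} {rk : G → ℕ}
    (hrk : ∀ t t', S.mat t t' ≠ 0 → rk t' < rk t) {r : ℕ}
    {H : (S.toModule hp).carrier →ₗ[k] N.carrier} (hH : ∀ (a : A) x, H (a • x) = a • H x)
    (hk : ∀ t, rk t < r → H (S.cell t) = 0) (t : G) (ht : rk t ≤ r) :
    H (S.diff (S.cell t)) = 0 := by
  rw [S.diff_cell]
  refine (map_sum H _ _).trans (Finset.sum_eq_zero fun t' _ => ?_)
  refine (hH _ _).trans ?_
  by_cases h : S.mat t t' = 0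
  · rw [h, zero_smul]
  · have := hrk t t' h
    rw [hk t' (by omega), smul_zero]

theorem ad_smul {M N : PDGModule 𝔸} {H : M.carrier →ₗ[k] N.carrier}
    (hH : ∀ (a : A) x, H (a • x) = a • H x) (a : A) (x : M.carrier) :
    ad M.toPComplex N.toPComplex H (a • x) = a • ad M.toPComplex N.toPComplex H x := by
  simp only [PComplex.ad_apply, hH, M.d_smul, N.d_smul, map_add, smul_sub]
  abel

/-- If `H` vanishes on the cells of rank below `r`, then on rank `r` the terms of the commutator
with the differential of the source drop out, leaving only the differential of the target. This
reduces an equation in `HOM` to one in `N` on the lowest rank where `H` can be nonzero. -/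
theorem ad_pow_cell {hp : S.diff ^ p = 0} {N : PDGModule 𝔸} {rk : G → ℕ}
    (hrk : ∀ t t', S.mat t t' ≠ 0 → rk t' < rk t) {r : ℕ}
    {H : (S.toModule hp).carrier →ₗ[k] N.carrier} (hH : ∀ (a : A) x, H (a • x) = a • H x)
    (hk : ∀ t, rk t < r → H (S.cell t) = 0) (m : ℕ) :
    (∀ (a : A) x, (ad (S.toModule hp).toPComplex N.toPComplex ^ m) H (a • x) =
      a • (ad (S.toModule hp).toPComplex N.toPComplex ^ m) H x) ∧
    ∀ t, rk t ≤ r → (ad (S.toModule hp).toPComplex N.toPComplex ^ m) H (S.cell t) =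
      (N.d ^ m) (H (S.cell t)) := by
  induction m with
  | zero => exact ⟨hH, fun _ _ => rfl⟩
  | succ m ih =>
    rw [pow_succ', Module.End.mul_apply]
    refine ⟨ad_smul ih.1, fun t ht => ?_⟩
    rw [PComplex.ad_apply, ih.2 t ht, pow_succ' N.d, Module.End.mul_apply]
    refine (congrArg _ (ad_cell_of_kills (hp := hp) hrk ih.1 (fun t ht => ?_) t ht)).trans
      (sub_zero _)
    rw [ih.2 t ht.le, hk t ht, map_zero]

/-- A semifree module with a triangular differential is cofibrant. -/
theorem isCofibrant [hpp : Fact p.Prime] [CharP k p] (hp : S.diff ^ p = 0) (rk : G → ℕ)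
    (hrk : ∀ t t', S.mat t t' ≠ 0 → rk t' < rk t) : (S.toModule hp).IsCofibrant := by
  intro N₁ N₂ g hs hg
  have hcell : ∀ {N : PDGModule 𝔸} {F : (S.toModule hp).carrier →ₗ[k] N.carrier}
      (_ : ∀ (a : A) x, F (a • x) = a • F x) (t : G),
      S.idem t • F (S.cell t) = F (S.cell t) := fun hF t => by
    rw [← hF]; exact congrArg _ (S.idem_smul_cell t)
  -- Acyclicity of the complex of maps into the kernel of `g`, by climbing the rank filtration: `F`
  -- already vanishes below rank `r`, and all ranks are below `r + j`.
  have key : ∀ (j r : ℕ) (F : (S.toModule hp).carrier →ₗ[k] N₁.carrier),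
      (∀ t, rk t < r + j) → (∀ (a : A) x, F (a • x) = a • F x) →
      (∀ x, F ((S.toModule hp).d x) = N₁.d (F x)) → (∀ x, g.toLin (F x) = 0) →
      (∀ t, rk t < r → F (S.cell t) = 0) →
      ∃ H : (S.toModule hp).carrier →ₗ[k] N₁.carrier, (∀ (a : A) x, H (a • x) = a • H x) ∧
        (∀ x, g.toLin (H x) = 0) ∧
        (ad (S.toModule hp).toPComplex N₁.toPComplex ^ (p - 1)) H = F := by
    intro j
    induction j with
    | zero =>
      intro r F hr hF _ _ hk
      refine ⟨0, fun a x => (smul_zero a).symm, fun x => map_zero _, ?_⟩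
      rw [map_zero]
      exact linear_ext (fun a x => (smul_zero a).symm) hF fun t => (hk t (hr t)).symm
    | succ j ih =>
      intro r F hr hF hdF hgF hk
      have hw : ∀ t, ∃ w : N₁.carrier, (rk t < r → w = 0) ∧ S.idem t • w = w ∧ g.toLin w = 0 ∧
          (rk t ≤ r → (N₁.d ^ (p - 1)) w = F (S.cell t)) := by
        intro t
        rcases lt_trichotomy (rk t) r with h | h | h
        · exact ⟨0, fun _ => rfl, smul_zero _, map_zero _, fun _ => by rw [map_zero, hk t h]⟩
        -- On a cell of rank `r` the value of `F` is a cycle in the kernel of `g`, since `F` kills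
        -- the lower cells. The kernel is acyclic, which supplies `w`.
        · have hdt : N₁.d (F (S.cell t)) = 0 := by
            rw [← hdF]; exact ad_cell_of_kills hrk hF hk t h.le
          obtain ⟨w, hw1, hw2⟩ := PComplex.Hom.IsHomotopyEquiv.acyclic_ker hg hs _ (hgF _) hdt
          -- Multiplying by the idempotent makes `w` an admissible value on the cell; it commutes
          -- with `d ^ (p - 1)` because the idempotent is a cycle.
          refine ⟨S.idem t • w, fun h' => by omega, ?_, ?_, fun _ => ?_⟩
          · rw [← mul_smul, S.idem_mul_self]
          · rw [g.map_smul, hw1, smul_zero]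
          · rw [N₁.d_pow_smul (S.d_idem t), hw2, hcell hF]
        · exact ⟨0, fun _ => rfl, smul_zero _, map_zero _, fun h' => by omega⟩
      choose w hw1 hw2 hw3 hw4 using hw
      have hH0c : ∀ t, liftK hp N₁ w (S.cell t) = w t := fun t => liftK_cell hp N₁ w t (hw2 t)
      have hH0 := liftK_smul hp N₁ w
      generalize liftK hp N₁ w = H0 at hH0c hH0
      have hH0k : ∀ t, rk t < r → H0 (S.cell t) = 0 := fun t ht => by rw [hH0c, hw1 t ht]
      obtain ⟨hA, hB⟩ := ad_pow_cell hrk hH0 hH0k (p - 1)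
      have hgH : ∀ x, g.toLin (H0 x) = 0 := fun x => by
        rw [linear_eq hH0, map_sum]
        exact Finset.sum_eq_zero fun t _ => by rw [g.map_smul, hH0c, hw3, smul_zero]
      have hgad : ∀ (m : ℕ) x, g.toLin
          ((ad (S.toModule hp).toPComplex N₁.toPComplex ^ m) H0 x) = 0 := by
        intro m
        induction m with
        | zero => exact hgH
        | succ m ih =>
          intro x
          rw [pow_succ', Module.End.mul_apply, PComplex.ad_apply, map_sub, g.map_d, ih, ih,
            map_zero, sub_zero]
      -- The `p`-th power of the commutator is zero, so what is subtracted from `F` is again a cycle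
      -- and the induction can continue one rank higher.
      have hadp : ad (S.toModule hp).toPComplex N₁.toPComplex
          ((ad (S.toModule hp).toPComplex N₁.toPComplex ^ (p - 1)) H0) = 0 := by
        have h1 := PDGModule.HOM_d_pow_val (M := S.toModule hp) (N := N₁) p
          ⟨H0, mem_iSup_homDeg hH0⟩
        rw [(PDGModule.HOM (S.toModule hp) N₁).d_pow] at h1
        rw [← Module.End.mul_apply, ← pow_succ', Nat.sub_add_cancel hpp.out.one_le]
        exact h1.symm
      obtain ⟨H, h1, h2, h3⟩ := ih (r + 1)
        (F - (ad (S.toModule hp).toPComplex N₁.toPComplex ^ (p - 1)) H0)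
        (fun t => by have := hr t; omega)
        (fun a x => by rw [LinearMap.sub_apply, hF, hA, ← smul_sub]; rfl)
        (fun x => by
          have := LinearMap.congr_fun hadp x
          rw [PComplex.ad_apply, LinearMap.zero_apply, sub_eq_zero] at this
          rw [LinearMap.sub_apply, LinearMap.sub_apply, map_sub, hdF, ← this])
        (fun x => by rw [LinearMap.sub_apply, map_sub, hgF, hgad, sub_zero])
        (fun t ht => by
          rw [LinearMap.sub_apply, hB t (by omega), hH0c, hw4 t (by omega), sub_self])
      refine ⟨H + H0, fun a x => ?_, fun x => ?_, ?_⟩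
      · rw [LinearMap.add_apply, h1, hH0, LinearMap.add_apply, smul_add]
      · rw [LinearMap.add_apply, map_add, h2, hgH, add_zero]
      · rw [map_add, h3, sub_add_cancel]
  refine PComplex.Hom.isHomotopyEquiv_of_surjective _ ?_ ?_
  · intro F
    -- Surjectivity on maps: lift the values on the generators and cut them down by the idempotents.
    choose κ hκ using fun t => hs (F.1 (S.cell t))
    refine ⟨⟨liftK hp N₁ fun t => S.idem t • κ t, mem_iSup_homDeg (liftK_smul hp N₁ _)⟩,
      Subtype.ext ?_⟩
    refine linear_ext (fun a x => ?_) (PDGModule.HOM.smul_apply F) fun t => ?_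
    · change g.toLin (liftK hp N₁ _ _) = a • g.toLin (liftK hp N₁ _ _)
      rw [liftK_smul, g.map_smul]
    · change g.toLin (liftK hp N₁ _ _) = _
      rw [liftK_cell hp N₁ _ t (by rw [← mul_smul, S.idem_mul_self]), g.map_smul, hκ,
        hcell (PDGModule.HOM.smul_apply F)]
  · intro F hgF hdF
    obtain ⟨R, hR⟩ : ∃ R, ∀ t, rk t < R :=
      ⟨Finset.univ.sup rk + 1, fun t => Nat.lt_succ_of_le (Finset.le_sup (Finset.mem_univ t))⟩
    obtain ⟨H, h1, h2, h3⟩ := key R 0 F.1 (fun t => by rw [zero_add]; exact hR t)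
      (PDGModule.HOM.smul_apply F)
      (fun x => (sub_eq_zero.1 (LinearMap.congr_fun (congrArg Subtype.val hdF) x)).symm)
      (fun x => LinearMap.congr_fun (congrArg Subtype.val hgF) x) (fun t ht => by omega)
    refine ⟨⟨H, mem_iSup_homDeg h1⟩, Subtype.ext (LinearMap.ext h2), Subtype.ext ?_⟩
    exact (PDGModule.HOM_d_pow_val (M := S.toModule hp) (N := N₁) (p - 1)
      ⟨H, mem_iSup_homDeg h1⟩).trans h3

end CellData

/-! ## A semifree resolution of length two -/

/-- Elements of a `p`-DG algebra forming a square of maps between the modules `A e`, `A ea`, `A eb`,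
whose total complex is `A e → A ea ⊕ A eb → A e`. -/
structure SquareData {k : Type u} [Field k] {p : ℕ} {A : Type u} [Ring A] [Algebra k A]
    (𝔸 : PDGAlgebra k p A) where
  (e ea eb P q r s : A)
  e_mem : e ∈ 𝔸.gr 0
  ea_mem : ea ∈ 𝔸.gr 0
  eb_mem : eb ∈ 𝔸.gr 0
  P_mem : P ∈ 𝔸.gr 1
  q_mem : q ∈ 𝔸.gr 1
  r_mem : r ∈ 𝔸.gr 1
  s_mem : s ∈ 𝔸.gr 1
  e_mul_e : e * e = e
  ea_mul_ea : ea * ea = ea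
  eb_mul_eb : eb * eb = eb
  e_mul_P : e * P = P
  P_mul_ea : P * ea = P
  ea_mul_q : ea * q = q
  q_mul_e : q * e = q
  e_mul_r : e * r = r
  r_mul_eb : r * eb = r
  eb_mul_s : eb * s = s
  s_mul_e : s * e = s
  P_mul_q : P * q = r * s
  d_e : 𝔸.d e = 0
  d_ea : 𝔸.d ea = 0
  d_eb : 𝔸.d eb = 0
  d_q : 𝔸.d q = 0
  d_r : 𝔸.d r = 0
  d_P : 𝔸.d P = P * q * P
  d_s : 𝔸.d s = s * (P * q)

namespace SquareData

set_option linter.unusedSectionVars false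

variable {k : Type u} [Field k] {p : ℕ} {A : Type u} [Ring A] [Algebra k A]
  {𝔸 : PDGAlgebra k p A} (X : SquareData 𝔸)

theorem d_one (𝔸 : PDGAlgebra k p A) : 𝔸.d 1 = 0 := by
  simpa using 𝔸.d_mul 1 1

/-- The loop. -/
def x : A := X.P * X.q

theorem x_mem : X.x ∈ 𝔸.gr 2 := 𝔸.mul_mem 1 1 _ _ X.P_mem X.q_mem

theorem d_x : 𝔸.d X.x = X.x * X.x := by
  rw [x, 𝔸.d_mul, X.d_q, X.d_P]
  noncomm_ring

theorem d_x_pow (m : ℕ) : 𝔸.d (X.x ^ m) = (m : k) • X.x ^ (m + 1) := by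
  induction m with
  | zero => simp [d_one]
  | succ m ih =>
    rw [pow_succ, 𝔸.d_mul, ih, X.d_x, smul_mul_assoc, ← pow_succ, ← mul_assoc, ← pow_succ,
      ← pow_succ]
    push_cast
    rw [add_smul, one_smul]

theorem x_pow_mem (m : ℕ) : X.x ^ m ∈ 𝔸.gr (2 * m) := by
  induction m with
  | zero => simpa using 𝔸.one_mem
  | succ m ih =>
    rw [pow_succ]
    have := 𝔸.mul_mem _ _ _ _ ih X.x_mem
    rwa [show 2 * (m : ℤ) + 2 = 2 * ((m + 1 : ℕ) : ℤ) by push_cast; ring] at this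

theorem d_x_pow_mul_P (m : ℕ) :
    𝔸.d (X.x ^ m * X.P) = ((m : k) + 1) • (X.x ^ (m + 1) * X.P) := by
  rw [𝔸.d_mul, X.d_x_pow, X.d_P, smul_mul_assoc, add_smul, one_smul, ← mul_assoc, pow_succ]
  rfl

/-- The path `s x^m P`. -/
def sxP (m : ℕ) : A := X.s * (X.x ^ m * X.P)

/-- The factor `m + 2` is the sum of `1` from `∂s = s x`, `m` from `x^m` and `1` from `∂P = x P`. -/
theorem d_sxP (m : ℕ) : 𝔸.d (X.sxP m) = ((m : k) + 2) • X.sxP (m + 1) := by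
  have : X.s * (X.P * X.q) * (X.x ^ m * X.P) = X.sxP (m + 1) := by
    rw [sxP, pow_succ', mul_assoc, mul_assoc, mul_assoc, x]
    noncomm_ring
  have h : X.s * (X.x ^ (m + 1) * X.P) = X.sxP (m + 1) := rfl
  rw [sxP, 𝔸.d_mul, X.d_s, X.d_x_pow_mul_P, mul_smul_comm, this, h]
  module

theorem sxP_mem (m : ℕ) : X.sxP m ∈ 𝔸.gr (2 * m + 2) := by
  have := 𝔸.mul_mem _ _ _ _ X.s_mem (𝔸.mul_mem _ _ _ _ (X.x_pow_mem m) X.P_mem)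
  rwa [show 1 + (2 * (m : ℤ) + 1) = 2 * m + 2 by ring] at this

/-- Each derivative of `x^m P` contributes a factor `m + 1`; the resulting factorials are the source
of `coeff`. -/
theorem d_pow_P (m : ℕ) : (𝔸.d ^ m) X.P = (m.factorial : k) • (X.x ^ m * X.P) := by
  induction m with
  | zero => simp
  | succ m ih =>
    rw [pow_succ', Module.End.mul_apply, ih, map_smul, X.d_x_pow_mul_P, smul_smul,
      Nat.factorial_succ]
    push_cast
    rw [mul_comm]

/-- The coefficients of the differential. -/
def coeff (k : Type u) [Field k] (m : ℕ) : k := (-1) ^ (m + 1) * ((m + 1).factorial : k)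

/-- The recursion required for the end of the second string to be a cycle: it cancels the factor `m
+ 2` of `d_sxP`. -/
theorem coeff_succ (m : ℕ) : coeff k (m + 1) = -(coeff k m * ((m : k) + 2)) := by
  rw [coeff, coeff, Nat.factorial_succ (m + 1), pow_succ _ (m + 1)]
  push_cast
  ring

/-- The cells: one in degree `0`, two strings of `p - 1` cells, and one in degree `2 - 2p`. -/
abbrev Cell (p : ℕ) : Type := Unit ⊕ Fin (p - 1) ⊕ Fin (p - 1) ⊕ Unit

theorem sum_cell {V : Type*} [AddCommMonoid V] (f : Cell p → V) : ∑ t, f t =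
    f (.inl ()) + ((∑ t, f (.inr (.inl t))) + ((∑ t, f (.inr (.inr (.inl t)))) +
      f (.inr (.inr (.inr ()))))) := by
  simp [Fintype.sum_sum_type]

/-- The matrix of the differential. -/
def mat : Cell p → Cell p → A
  | .inr (.inl t), .inl _ => if t.val + 1 = p - 1 then X.q else 0
  | .inr (.inl t), .inr (.inl t') => if t.val + 1 = t'.val then X.ea else 0
  | .inr (.inr (.inl t)), .inl _ => if t.val + 1 = p - 1 then X.s else 0
  | .inr (.inr (.inl t)), .inr (.inl t') =>
      if t.val + 1 = p - 1 then coeff k (p - 2 - t'.val) • X.sxP (p - 2 - t'.val) else 0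
  | .inr (.inr (.inl t)), .inr (.inr (.inl t')) => if t.val + 1 = t'.val then X.eb else 0
  | .inr (.inr (.inr _)), .inr (.inl t') => if t'.val = 0 then X.P else 0
  | .inr (.inr (.inr _)), .inr (.inr (.inl t')) => if t'.val = 0 then -X.r else 0
  | _, _ => 0

/-- The degrees of the cells. -/
def deg : Cell p → ℤ
  | .inl _ => 0
  | .inr (.inl t) => 2 * t.val + 3 - 2 * p
  | .inr (.inr (.inl t)) => 2 * t.val + 3 - 2 * p
  | .inr (.inr (.inr _)) => 2 - 2 * p

/-- The idempotents of the cells. -/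
def idem : Cell p → A
  | .inl _ => X.e
  | .inr (.inl _) => X.ea
  | .inr (.inr (.inl _)) => X.eb
  | .inr (.inr (.inr _)) => X.e

/-- The cells of the resolution. -/
def cells : CellData 𝔸 (Cell p) where
  idem := X.idem
  deg := deg
  mat := X.mat
  idem_mem := by
    rintro (_ | _ | _ | _)
    exacts [X.e_mem, X.ea_mem, X.eb_mem, X.e_mem]
  idem_mul_self := by
    rintro (_ | _ | _ | _)
    exacts [X.e_mul_e, X.ea_mul_ea, X.eb_mul_eb, X.e_mul_e]
  d_idem := by
    rintro (_ | _ | _ | _)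
    exacts [X.d_e, X.d_ea, X.d_eb, X.d_e]
  mat_mem := by
    have key : ∀ {i j : ℤ} {a : A} {c : Prop} [Decidable c], a ∈ 𝔸.gr i → (c → i = j) →
        (if c then a else 0) ∈ 𝔸.gr j := by
      intro i j a c _ ha hc
      split_ifs with h
      · rwa [← hc h]
      · exact zero_mem _
    rintro (_ | t | t | _) (_ | t' | t' | _)
    all_goals first
      | exact zero_mem _
      | skip
    · exact key X.q_mem fun h => by simp only [deg]; omega
    · exact key X.ea_mem fun h => by simp only [deg]; omega
    · exact key X.s_mem fun h => by simp only [deg]; omega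
    · refine key (Submodule.smul_mem _ _ (X.sxP_mem _)) fun h => ?_
      have := t'.isLt
      simp only [deg]; omega
    · exact key X.eb_mem fun h => by simp only [deg]; omega
    · exact key X.P_mem fun h => by simp only [deg]; omega
    · exact key (neg_mem X.r_mem) fun h => by simp only [deg]; omega
  idem_mul_mat := by
    rintro (_ | t | t | _) (_ | t' | t' | _) <;> simp only [idem, mat, mul_zero] <;>
      split_ifs <;> simp only [mul_zero, X.ea_mul_q, X.ea_mul_ea, X.eb_mul_s, X.eb_mul_eb,
        X.e_mul_P, X.e_mul_r, mul_neg, mul_smul_comm, sxP, ← mul_assoc]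
  mat_mul_idem := by
    rintro (_ | t | t | _) (_ | t' | t' | _) <;> simp only [idem, mat, zero_mul] <;>
      split_ifs <;> simp only [zero_mul, X.q_mul_e, X.ea_mul_ea, X.s_mul_e, X.eb_mul_eb,
        X.P_mul_ea, X.r_mul_eb, neg_mul, smul_mul_assoc, sxP, mul_assoc]

/-- Cells are ordered as bottom cell, first string from its end to its start, second string
likewise, top cell. The end of the second string involves the first string and the bottom cell,
which is why it ranks above them. -/
theorem mat_rank (t t' : Cell p) (h : X.mat t t' ≠ 0) :
    ((fun t : Cell p => match t with
      | .inl _ => 0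
      | .inr (.inl t) => p - t.val
      | .inr (.inr (.inl t)) => 2 * p - t.val
      | .inr (.inr (.inr _)) => 2 * p + 1) t' : ℕ) <
    (fun t : Cell p => match t with
      | .inl _ => 0
      | .inr (.inl t) => p - t.val
      | .inr (.inr (.inl t)) => 2 * p - t.val
      | .inr (.inr (.inr _)) => 2 * p + 1) t := by
  rcases t with _ | t | t | _ <;> rcases t' with _ | t' | t' | _ <;> simp only [mat] at h ⊢ <;>
    first
      | exact absurd rfl h
      | (have h := (ite_ne_right_iff.1 h).1; omega)

section Elements

variable [hp : Fact p.Prime]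

theorem two_le (p : ℕ) [hp : Fact p.Prime] : 2 ≤ p := hp.out.two_le

/-- The index of the last cell of a string. -/
def last (p : ℕ) [hp : Fact p.Prime] : Fin (p - 1) := ⟨p - 2, by have := two_le p; omega⟩

theorem diff_bot (x : X.cells.coords) : (X.cells.diff x).1 (.inl ()) =
    𝔸.d (x.1 (.inl ())) + (x.1 (.inr (.inl (last p))) * X.q +
      x.1 (.inr (.inr (.inl (last p)))) * X.s) := by
  have h2 := two_le p
  rw [X.cells.diff_apply]
  congr 1
  have e : ∀ (f : Fin (p - 1) → A) (a : A),
      ∑ t, f t * (if t.val + 1 = p - 1 then a else 0) = f (last p) * a := by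
    intro f a
    rw [Finset.sum_eq_single (last p)]
    · rw [if_pos (by simp only [last]; omega)]
    · intro t _ ht
      rw [if_neg, mul_zero]
      intro h
      exact ht (Fin.ext (by simp only [last]; omega))
    · simp
  simp only [Fintype.sum_sum_type, cells, mat, mul_zero, Finset.sum_const_zero, zero_add,
    add_zero, e]

theorem sum_shift (f : Fin (p - 1) → A) (a : A) (hf : ∀ t, f t * a = f t) (t' : Fin (p - 1)) :
    ∑ t, f t * (if t.val + 1 = t'.val then a else 0) =
      if h : t'.val = 0 then 0 else f ⟨t'.val - 1, by omega⟩ := by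
  split_ifs with h
  · exact Finset.sum_eq_zero fun t _ => by rw [if_neg (by omega), mul_zero]
  · rw [Finset.sum_eq_single ⟨t'.val - 1, by omega⟩]
    · rw [if_pos (by simp only; omega), hf]
    · intro t _ ht
      rw [if_neg, mul_zero]
      intro h'
      exact ht (Fin.ext (by simp only; omega))
    · simp

theorem diff_left (x : X.cells.coords) (t' : Fin (p - 1)) : (X.cells.diff x).1 (.inr (.inl t')) =
    𝔸.d (x.1 (.inr (.inl t'))) +
      ((if h : t'.val = 0 then 0 else x.1 (.inr (.inl ⟨t'.val - 1, by omega⟩))) +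
      (x.1 (.inr (.inr (.inl (last p)))) * (coeff k (p - 2 - t'.val) • X.sxP (p - 2 - t'.val)) +
      x.1 (.inr (.inr (.inr ()))) * if t'.val = 0 then X.P else 0)) := by
  have h2 := two_le p
  rw [X.cells.diff_apply]
  congr 1
  have e : ∀ (f : Fin (p - 1) → A) (a : A),
      ∑ t, f t * (if t.val + 1 = p - 1 then a else 0) = f (last p) * a := by
    intro f a
    rw [Finset.sum_eq_single (last p)]
    · rw [if_pos (by simp only [last]; omega)]
    · intro t _ ht
      rw [if_neg, mul_zero]
      intro h
      exact ht (Fin.ext (by simp only [last]; omega))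
    · simp
  simp only [Fintype.sum_sum_type, cells, mat, mul_zero, Finset.sum_const_zero, zero_add, e,
    Finset.univ_unique, Finset.sum_singleton]
  rw [sum_shift (fun t => x.1 (.inr (.inl t))) X.ea (fun t => x.2 _) t']

theorem diff_right (x : X.cells.coords) (t' : Fin (p - 1)) :
    (X.cells.diff x).1 (.inr (.inr (.inl t'))) =
    𝔸.d (x.1 (.inr (.inr (.inl t')))) +
      ((if h : t'.val = 0 then 0 else x.1 (.inr (.inr (.inl ⟨t'.val - 1, by omega⟩)))) +
      x.1 (.inr (.inr (.inr ()))) * if t'.val = 0 then -X.r else 0) := by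
  rw [X.cells.diff_apply]
  congr 1
  simp only [Fintype.sum_sum_type, cells, mat, mul_zero, Finset.sum_const_zero, zero_add,
    Finset.univ_unique, Finset.sum_singleton]
  rw [sum_shift (fun t => x.1 (.inr (.inr (.inl t)))) X.eb (fun t => x.2 _) t']

/-- The cell of degree `0`. -/
def g : X.cells.coords := X.cells.cell (.inl ())

/-- The cells of the first string; the next element is `q g`. -/
def v (t : ℕ) : X.cells.coords :=
  if h : t < p - 1 then X.cells.cell (.inr (.inl ⟨t, h⟩)) else if t = p - 1 then X.q • X.g else 0

/-- The cells of the second string; the next element is its boundary. -/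
def z (t : ℕ) : X.cells.coords :=
  if h : t < p - 1 then X.cells.cell (.inr (.inr (.inl ⟨t, h⟩))) else if t = p - 1 then
    X.s • X.g + ∑ m ∈ Finset.range (p - 1), (coeff k m • X.sxP m) • X.v (p - 2 - m) else 0

/-- The cell of degree `2 - 2p`. -/
def y : X.cells.coords := X.cells.cell (.inr (.inr (.inr ())))

theorem v_of_lt {t : ℕ} (h : t < p - 1) : X.v t = X.cells.cell (.inr (.inl ⟨t, h⟩)) := dif_pos h

theorem v_last : X.v (p - 1) = X.q • X.g := by
  rw [v, dif_neg (lt_irrefl _), if_pos rfl]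

theorem z_of_lt {t : ℕ} (h : t < p - 1) : X.z t = X.cells.cell (.inr (.inr (.inl ⟨t, h⟩))) :=
  dif_pos h

theorem z_last : X.z (p - 1) =
    X.s • X.g + ∑ m ∈ Finset.range (p - 1), (coeff k m • X.sxP m) • X.v (p - 2 - m) := by
  rw [z, dif_neg (lt_irrefl _), if_pos rfl]

theorem diff_g : X.cells.diff X.g = 0 := by
  rw [g, X.cells.diff_cell]
  exact Finset.sum_eq_zero fun t _ => by
    rcases t with _ | _ | _ | _ <;> exact zero_smul _ _

theorem sum_ite_smul {V : Type*} [AddCommGroup V] [Module A V] (f : Fin (p - 1) → V) (a : A)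
    (m : ℕ) : ∑ t : Fin (p - 1), (if m = t.val then a else 0) • f t =
      if h : m < p - 1 then a • f ⟨m, h⟩ else 0 := by
  split_ifs with h
  · rw [Finset.sum_eq_single ⟨m, h⟩]
    · rw [if_pos rfl]
    · intro t _ ht
      rw [if_neg, zero_smul]
      rintro rfl
      exact ht rfl
    · simp
  · exact Finset.sum_eq_zero fun t _ => by rw [if_neg (by omega), zero_smul]

theorem diff_v {t : ℕ} (h : t < p - 1) : X.cells.diff (X.v t) = X.v (t + 1) := by
  have e1 : ∑ t', X.cells.mat (.inr (.inl ⟨t, h⟩)) (.inr (.inl t')) •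
      X.cells.cell (.inr (.inl t')) = _ :=
    sum_ite_smul (fun t' => X.cells.cell (.inr (.inl t'))) X.ea (t + 1)
  have e2 : ∑ t', X.cells.mat (.inr (.inl ⟨t, h⟩)) (.inr (.inr (.inl t'))) •
      X.cells.cell (.inr (.inr (.inl t'))) = 0 := Finset.sum_eq_zero fun _ _ => zero_smul _ _
  have e3 : X.cells.mat (.inr (.inl ⟨t, h⟩)) (.inl ()) = if t + 1 = p - 1 then X.q else 0 := rfl
  have e4 : X.cells.mat (.inr (.inl ⟨t, h⟩)) (.inr (.inr (.inr ()))) = 0 := rfl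
  rw [X.v_of_lt h, X.cells.diff_cell, sum_cell, e1, e2, e3, e4, zero_smul, add_zero, add_zero]
  by_cases h' : t + 1 < p - 1
  · rw [if_neg (by omega), dif_pos h', zero_smul, zero_add, X.v_of_lt h']
    exact X.cells.idem_smul_cell (.inr (.inl ⟨t + 1, h'⟩))
  · rw [if_pos (by omega), dif_neg h', add_zero, show t + 1 = p - 1 by omega, X.v_last]
    rfl

theorem diff_v_last : X.cells.diff (X.v (p - 1)) = 0 := by
  rw [X.v_last, X.cells.diff_smul, X.d_q, X.diff_g]
  simp

theorem diff_z {t : ℕ} (h : t < p - 1) : X.cells.diff (X.z t) = X.z (t + 1) := by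
  have e1 : ∑ t', X.cells.mat (.inr (.inr (.inl ⟨t, h⟩))) (.inr (.inr (.inl t'))) •
      X.cells.cell (.inr (.inr (.inl t'))) = _ :=
    sum_ite_smul (fun t' => X.cells.cell (.inr (.inr (.inl t')))) X.eb (t + 1)
  have e2 : ∀ t', X.cells.mat (.inr (.inr (.inl ⟨t, h⟩))) (.inr (.inl t')) =
      if t + 1 = p - 1 then coeff k (p - 2 - t'.val) • X.sxP (p - 2 - t'.val) else 0 :=
    fun _ => rfl
  have e3 : X.cells.mat (.inr (.inr (.inl ⟨t, h⟩))) (.inl ()) =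
      if t + 1 = p - 1 then X.s else 0 := rfl
  have e4 : X.cells.mat (.inr (.inr (.inl ⟨t, h⟩))) (.inr (.inr (.inr ()))) = 0 := rfl
  rw [X.z_of_lt h, X.cells.diff_cell, sum_cell, e1, e3, e4, zero_smul, add_zero]
  simp only [e2]
  by_cases h' : t + 1 < p - 1
  · have h'' : ¬ t + 1 = p - 1 := by omega
    simp only [if_neg h'']
    rw [dif_pos h', zero_smul, zero_add, X.z_of_lt h', Finset.sum_eq_zero, zero_add]
    · exact X.cells.idem_smul_cell (.inr (.inr (.inl ⟨t + 1, h'⟩)))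
    · intro t' _
      rw [zero_smul]
  · have h'' : t + 1 = p - 1 := by omega
    simp only [if_pos h'']
    rw [dif_neg h', add_zero, h'', X.z_last, ← Finset.sum_range_reflect, Finset.sum_range]
    refine congrArg₂ (· + ·) rfl (Finset.sum_congr rfl fun t' _ => ?_)
    rw [show p - 1 - 1 - t'.val = p - 2 - t'.val by omega,
      show p - 2 - (p - 2 - t'.val) = t'.val by omega, X.v_of_lt t'.isLt]

/-- The correction terms telescope. What is left at `m = 0` is `-s P q g`, cancelling the
differential of `s g`, and what is left at the other end carries the coefficient `± p! = 0`. -/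
theorem diff_z_last [CharP k p] : X.cells.diff (X.z (p - 1)) = 0 := by
  have h2 := two_le p
  have hneg : ∀ (c : k) (w : X.cells.coords), (-c) • w = -(c • w) := fun c w => neg_smul c w
  -- Differentiating `v_{p-2-m}` gives the first term and differentiating `s x^m P` the second;
  -- `coeff_succ` makes the second the next first term with opposite sign.
  have hT : ∀ m ∈ Finset.range (p - 1), X.cells.diff ((coeff k m • X.sxP m) • X.v (p - 2 - m)) =
      coeff k m • (X.sxP m • X.v (p - 1 - m)) -
        coeff k (m + 1) • (X.sxP (m + 1) • X.v (p - 1 - (m + 1))) := by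
    intro m hm
    have hm := Finset.mem_range.1 hm
    rw [X.cells.diff_smul, map_smul, X.d_sxP, X.diff_v (by omega), smul_smul, smul_assoc,
      smul_assoc, coeff_succ, hneg, sub_neg_eq_add, add_comm,
      show p - 2 - m + 1 = p - 1 - m by omega, show p - 1 - (m + 1) = p - 2 - m by omega]
  rw [X.z_last, map_add, map_sum, Finset.sum_congr rfl hT, Finset.sum_range_sub',
    X.cells.diff_smul, X.diff_g, X.d_s, smul_zero, add_zero, Nat.sub_zero, X.v_last, smul_smul]
  have h0 : coeff k 0 = -1 := by simp [coeff]
  -- The only use of the characteristic here: the coefficient contains `p!`.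
  have h1 : coeff k (p - 1) = 0 := by
    rw [coeff, Nat.sub_add_cancel hp.out.one_le,
      (CharP.cast_eq_zero_iff k p _).2 (Nat.dvd_factorial hp.out.pos le_rfl), mul_zero]
  have h3 : X.sxP 0 * X.q = X.s * (X.P * X.q) := by simp [sxP, mul_assoc]
  rw [h0, h1, h3, hneg, zero_smul, sub_zero, one_smul, add_neg_cancel]

theorem diff_y : X.cells.diff X.y = X.P • X.v 0 - X.r • X.z 0 := by
  have h2 := two_le p
  have h : 0 < p - 1 := by omega
  have e1 : ∑ t', X.cells.mat (.inr (.inr (.inr ()))) (.inr (.inl t')) •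
      X.cells.cell (.inr (.inl t')) = X.P • X.v 0 := by
    rw [X.v_of_lt h, Finset.sum_eq_single_of_mem ⟨0, h⟩ (Finset.mem_univ _)]
    · rfl
    · intro t' _ ht'
      have : X.cells.mat (.inr (.inr (.inr ()))) (.inr (.inl t')) = 0 :=
        if_neg fun h' => ht' (Fin.ext h')
      rw [this, zero_smul]
  have e2 : ∑ t', X.cells.mat (.inr (.inr (.inr ()))) (.inr (.inr (.inl t'))) •
      X.cells.cell (.inr (.inr (.inl t'))) = -(X.r • X.z 0) := by
    rw [X.z_of_lt h, Finset.sum_eq_single_of_mem ⟨0, h⟩ (Finset.mem_univ _)]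
    · exact neg_smul X.r (X.cells.cell (.inr (.inr (.inl ⟨0, h⟩))))
    · intro t' _ ht'
      have : X.cells.mat (.inr (.inr (.inr ()))) (.inr (.inr (.inl t'))) = 0 :=
        if_neg fun h' => ht' (Fin.ext h')
      rw [this, zero_smul]
  have e3 : X.cells.mat (.inr (.inr (.inr ()))) (.inl ()) = 0 := rfl
  have e4 : X.cells.mat (.inr (.inr (.inr ()))) (.inr (.inr (.inr ()))) = 0 := rfl
  rw [y, X.cells.diff_cell, sum_cell, e1, e2, e3, e4, zero_smul, zero_smul, add_zero, zero_add,
    sub_eq_add_neg]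

theorem diff_pow_v {j t : ℕ} (h : t + j ≤ p - 1) : (X.cells.diff ^ j) (X.v t) = X.v (t + j) := by
  induction j with
  | zero => rfl
  | succ j ih =>
    rw [pow_succ', Module.End.mul_apply, ih (by omega), X.diff_v (by omega)]
    rfl

theorem diff_pow_z {j t : ℕ} (h : t + j ≤ p - 1) : (X.cells.diff ^ j) (X.z t) = X.z (t + j) := by
  induction j with
  | zero => rfl
  | succ j ih =>
    rw [pow_succ', Module.End.mul_apply, ih (by omega), X.diff_z (by omega)]
    rfl

/-- In the Leibniz expansion the term with `i` derivatives on `P` has coefficient `binom(p-1, i) i!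
= (-1)^i i!`. Writing `x^{m+1} P = r s x^m P` through `P q = r s` turns the terms `i = m + 1` into
the correction terms of `z (p - 1)`, and the term `i = 0` into `r s g`. -/
theorem diff_pow_P_smul_v [CharP k p] :
    (X.cells.diff ^ (p - 1)) (X.P • X.v 0) = X.r • X.z (p - 1) := by
  have h2 := two_le p
  rw [leibniz_pow X.cells.diff_smul, ← Finset.sum_range_reflect, Nat.add_sub_cancel]
  have hT : ∀ i ∈ Finset.range (p - 1 + 1), ((p - 1).choose (p - 1 - i) : k) •
      ((𝔸.d ^ (p - 1 - (p - 1 - i))) X.P • (X.cells.diff ^ (p - 1 - i)) (X.v 0)) =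
      ((-1) ^ i * (i.factorial : k)) • ((X.x ^ i * X.P) • X.v (p - 1 - i)) := by
    intro i hi
    have hi := Finset.mem_range.1 hi
    rw [Nat.choose_symm (by omega), cast_choose_pred_prime i (by omega), X.diff_pow_v (by omega),
      show p - 1 - (p - 1 - i) = i by omega, X.d_pow_P, smul_assoc, smul_smul, zero_add]
  rw [Finset.sum_congr rfl hT, Finset.sum_range_succ', X.z_last, smul_add, Finset.smul_sum,
    add_comm]
  congr 1
  · rw [Nat.sub_zero, X.v_last, smul_smul, smul_smul, ← X.P_mul_q]
    simp
  · refine Finset.sum_congr rfl fun m hm => ?_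
    have hx : X.x ^ (m + 1) * X.P = X.P * X.q * (X.x ^ m * X.P) := by
      rw [pow_succ', mul_assoc]
      rfl
    rw [smul_assoc, smul_comm X.r, smul_smul, sxP, ← mul_assoc, ← X.P_mul_q, hx,
      show p - 1 - (m + 1) = p - 2 - m by omega, coeff]

/-- As `r` is a cycle it commutes with the differential, so `r z_0` just moves along the second
string, while `P v_0` obeys the full Leibniz rule. -/
theorem diff_pow_succ_y [CharP k p] {j : ℕ} (h : j ≤ p - 1) : (X.cells.diff ^ (j + 1)) X.y =
    (X.cells.diff ^ j) (X.P • X.v 0) - X.r • X.z j := by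
  have hr : ∀ (m : ℕ) w, (X.cells.diff ^ m) (X.r • w) = X.r • (X.cells.diff ^ m) w := by
    intro m
    induction m with
    | zero => intro w; rfl
    | succ m ih =>
      intro w
      rw [pow_succ, Module.End.mul_apply, X.cells.diff_smul, X.d_r, zero_smul, zero_add, ih,
        Module.End.mul_apply]
  rw [pow_succ, Module.End.mul_apply, X.diff_y, map_sub, hr, X.diff_pow_z (by omega), zero_add]

/-- On the strings this holds because their ends are cycles. On the top cell the two contributions
`r z_{p-1}` cancel, by `diff_pow_P_smul_v`. -/
theorem diff_pow_prime [CharP k p] : X.cells.diff ^ p = 0 := by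
  have h2 := two_le p
  refine X.cells.diff_pow_eq_zero ?_
  have vanish : ∀ (m : ℕ) (w : X.cells.coords), m ≤ p → (X.cells.diff ^ m) w = 0 →
      (X.cells.diff ^ p) w = 0 := by
    intro m w hm hw
    have : X.cells.diff ^ p = X.cells.diff ^ (p - m) * X.cells.diff ^ m := by
      rw [← pow_add, Nat.sub_add_cancel hm]
    rw [this, Module.End.mul_apply, hw, map_zero]
  have aux : ∀ (w : ℕ → X.cells.coords) (_ : ∀ t j, t + j ≤ p - 1 →
      (X.cells.diff ^ j) (w t) = w (t + j)) (_ : X.cells.diff (w (p - 1)) = 0) (t : ℕ)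
      (_ : t < p - 1), (X.cells.diff ^ p) (w t) = 0 := by
    intro w hw hl t ht
    refine vanish (p - 1 - t + 1) _ (by omega) ?_
    rw [pow_succ', Module.End.mul_apply, hw _ _ (by omega),
      show t + (p - 1 - t) = p - 1 by omega, hl]
  rintro (_ | t | t | _)
  · exact vanish 1 _ (by omega) X.diff_g
  · rw [← X.v_of_lt t.isLt]
    exact aux X.v (fun t j h => X.diff_pow_v h) X.diff_v_last t t.isLt
  · rw [← X.z_of_lt t.isLt]
    exact aux X.z (fun t j h => X.diff_pow_z h) X.diff_z_last t t.isLt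
  · have := X.diff_pow_succ_y (j := p - 1) le_rfl
    rw [Nat.sub_add_cancel hp.out.one_le, X.diff_pow_P_smul_v, sub_self] at this
    exact this

end Elements

end SquareData

/-! ### The semifree module resolves the given module -/

namespace SquareData

set_option linter.unusedSectionVars false

variable {k : Type u} [Field k] {p : ℕ} [hp : Fact p.Prime] [CharP k p] {A : Type u} [Ring A]
  [Algebra k A] {𝔸 : PDGAlgebra k p A} (X : SquareData 𝔸)

/-- The `p`-DG module with the given cells. -/
abbrev resolution : PDGModule 𝔸 := X.cells.toModule X.diff_pow_prime

theorem resolution_isCofibrant : X.resolution.IsCofibrant :=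
  X.cells.isCofibrant _ _ X.mat_rank

/-- The complex `A e → A ea ⊕ A eb → A e → M → 0` attached to an element of `M` is exact, and the
element is a cycle of degree zero. -/
structure Resolves {M : PDGModule 𝔸} (ℓ : M.carrier) : Prop where
  mem : ℓ ∈ M.gr 0
  d_eq : M.d ℓ = 0
  q_smul : X.q • ℓ = 0
  s_smul : X.s • ℓ = 0
  exists_smul : ∀ m : M.carrier, ∃ a, a * X.e = a ∧ a • ℓ = m
  exact_bot : ∀ a, a * X.e = a → a • ℓ = 0 →
    ∃ u w, u * X.ea = u ∧ w * X.eb = w ∧ a = u * X.q + w * X.s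
  exact_mid : ∀ u w, u * X.ea = u → w * X.eb = w → u * X.q + w * X.s = 0 →
    ∃ b, b * X.e = b ∧ u = b * X.P ∧ w = -(b * X.r)
  exact_top : ∀ b, b * X.e = b → b * X.P = 0 → b * X.r = 0 → b = 0

/-- In the Leibniz expansion only the term with all derivatives on `w` can reach the coordinate `t`,
provided `t` is not reached by fewer than `m` derivatives. It allows single coordinates of `d ^ (p -
1)` to be computed without the derivatives of `a`. -/
theorem coord_leibniz {m : ℕ} (a : A) (w : X.cells.coords) (t : Cell p)
    (h : ∀ j < m, ((X.cells.diff ^ j) w).1 t = 0) :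
    ((X.cells.diff ^ m) (a • w)).1 t = a * ((X.cells.diff ^ m) w).1 t := by
  rw [leibniz_pow X.cells.diff_smul]
  change ((X.cells.coord t).restrictScalars k) (∑ j ∈ _, _) = _
  rw [map_sum, Finset.sum_range_succ, Finset.sum_eq_zero]
  · rw [map_smul, Nat.choose_self, Nat.cast_one, one_smul, zero_add, Nat.sub_self, pow_zero]
    rfl
  · intro j hj
    rw [map_smul]
    change _ • (_ * ((X.cells.diff ^ j) w).1 t) = 0
    rw [h j (Finset.mem_range.1 hj), mul_zero, smul_zero]

theorem coord_leibniz_eq_zero {m : ℕ} (a : A) (w : X.cells.coords) (t : Cell p)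
    (h : ∀ j ≤ m, ((X.cells.diff ^ j) w).1 t = 0) :
    ((X.cells.diff ^ m) (a • w)).1 t = 0 := by
  rw [coord_leibniz X a w t fun j hj => h j hj.le, h m le_rfl, mul_zero]

theorem v_apply_bot {j : ℕ} (h : j < p - 1) : (X.v j).1 (.inl ()) = 0 := by
  rw [X.v_of_lt h]
  exact X.cells.cell_apply_ne (by simp)

theorem v_apply_right {j : ℕ} (h : j < p - 1) (t : Fin (p - 1)) :
    (X.v j).1 (.inr (.inr (.inl t))) = 0 := by
  rw [X.v_of_lt h]
  exact X.cells.cell_apply_ne (by simp)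

theorem v_apply_left_last {j : ℕ} (h : j < p - 1) :
    (X.v j).1 (.inr (.inl (last p))) = if j = p - 2 then X.ea else 0 := by
  rw [X.v_of_lt h]
  split_ifs with h'
  · subst h'
    exact X.cells.cell_apply_self _
  · refine X.cells.cell_apply_ne fun e => h' ?_
    simp only [Sum.inr.injEq, Sum.inl.injEq, last, Fin.mk.injEq] at e
    exact e.symm

theorem z_apply_bot {j : ℕ} (h : j < p - 1) : (X.z j).1 (.inl ()) = 0 := by
  rw [X.z_of_lt h]
  exact X.cells.cell_apply_ne (by simp)

theorem z_apply_left {j : ℕ} (h : j < p - 1) (t : Fin (p - 1)) :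
    (X.z j).1 (.inr (.inl t)) = 0 := by
  rw [X.z_of_lt h]
  exact X.cells.cell_apply_ne (by simp)

theorem z_apply_right_last {j : ℕ} (h : j < p - 1) :
    (X.z j).1 (.inr (.inr (.inl (last p)))) = if j = p - 2 then X.eb else 0 := by
  rw [X.z_of_lt h]
  split_ifs with h'
  · subst h'
    exact X.cells.cell_apply_self _
  · refine X.cells.cell_apply_ne fun e => h' ?_
    simp only [Sum.inr.injEq, Sum.inl.injEq, last, Fin.mk.injEq] at e
    exact e.symm

theorem g_apply_bot : X.g.1 (.inl ()) = X.e := X.cells.cell_apply_self _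

/-- Exactly `p - 1` derivatives carry `v_0` to the bottom cell, so the `p`-complex differential
reproduces the ordinary map, right multiplication by `q`. -/
theorem diff_pow_smul_v_bot (a : A) :
    ((X.cells.diff ^ (p - 1)) (a • X.v 0)).1 (.inl ()) = a * X.q := by
  rw [coord_leibniz]
  · rw [X.diff_pow_v (by omega), zero_add, X.v_last]
    change a * (X.q * X.g.1 (.inl ())) = _
    rw [g_apply_bot, X.q_mul_e]
  · intro j hj
    rw [X.diff_pow_v (by omega), zero_add, X.v_apply_bot hj]

theorem diff_pow_smul_z_bot (a : A) :
    ((X.cells.diff ^ (p - 1)) (a • X.z 0)).1 (.inl ()) = a * X.s := by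
  have h2 := two_le p
  rw [coord_leibniz]
  · rw [X.diff_pow_z (by omega), zero_add, X.z_last]
    have hc : ∀ w : X.cells.coords, w.1 (.inl ()) = X.cells.coord (.inl ()) w := fun _ => rfl
    rw [hc, map_add, map_sum, Finset.sum_eq_zero, add_zero, map_smul]
    · change a * (X.s * X.g.1 (.inl ())) = _
      rw [g_apply_bot, X.s_mul_e]
    · intro m hm
      rw [map_smul]
      change _ * (X.v _).1 _ = 0
      rw [X.v_apply_bot (by omega), mul_zero]
  · intro j hj
    rw [X.diff_pow_z (by omega), zero_add, X.z_apply_bot hj]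

theorem diff_pow_y_apply {j : ℕ} (h : j < p) (t : Cell p) (ht : t ≠ .inr (.inr (.inr ()))) :
    ((X.cells.diff ^ j) X.y).1 t = if j = 0 then 0 else
      ((X.cells.diff ^ (j - 1)) (X.P • X.v 0)).1 t - X.r * (X.z (j - 1)).1 t := by
  split_ifs with hj
  · subst hj
    exact X.cells.cell_apply_ne ht
  · obtain ⟨i, rfl⟩ := Nat.exists_eq_succ_of_ne_zero hj
    rw [Nat.succ_eq_add_one, X.diff_pow_succ_y (by omega)]
    rfl

/-- The first derivative of `y` is the start of the two strings, and `p - 2` further ones do not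
reach the bottom cell. -/
theorem diff_pow_smul_y_bot (a : A) :
    ((X.cells.diff ^ (p - 1)) (a • X.y)).1 (.inl ()) = 0 := by
  have h2 := two_le p
  refine X.coord_leibniz_eq_zero a _ _ fun j hj => ?_
  rw [diff_pow_y_apply X (by omega) _ (by simp)]
  split_ifs with h0
  · rfl
  · rw [X.z_apply_bot (by omega), mul_zero, sub_zero]
    refine X.coord_leibniz_eq_zero _ _ _ fun i hi => ?_
    rw [X.diff_pow_v (by omega), X.v_apply_bot (by omega)]

/-- One derivative takes `y` to `P v_0` and `p - 2` more take `v_0` to the last cell of the string,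
so `P` appears exactly at step `p - 1`. Together with the value `-r` for the other string this
reproduces the ordinary map `b ↦ (b P, -b r)`. -/
theorem diff_pow_y_left_last {j : ℕ} (hj : j < p) :
    ((X.cells.diff ^ j) X.y).1 (.inr (.inl (last p))) = if j = p - 1 then X.P else 0 := by
  have h2 := two_le p
  rw [diff_pow_y_apply X (by omega) _ (by simp)]
  split_ifs with h0 h1 h1
  · omega
  · rfl
  all_goals
    rw [X.z_apply_left (by omega), mul_zero, sub_zero, coord_leibniz]
  · rw [X.diff_pow_v (by omega), X.v_apply_left_last (by omega), if_pos (by omega), X.P_mul_ea]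
  · intro i hi
    rw [X.diff_pow_v (by omega), X.v_apply_left_last (by omega), if_neg (by omega)]
  · rw [X.diff_pow_v (by omega), X.v_apply_left_last (by omega), if_neg (by omega), mul_zero]
  · intro i hi
    rw [X.diff_pow_v (by omega), X.v_apply_left_last (by omega), if_neg (by omega)]

theorem diff_pow_y_right_last {j : ℕ} (hj : j < p) :
    ((X.cells.diff ^ j) X.y).1 (.inr (.inr (.inl (last p)))) = if j = p - 1 then -X.r else 0 := by
  have h2 := two_le p
  rw [diff_pow_y_apply X (by omega) _ (by simp)]
  have h : j ≠ 0 → ((X.cells.diff ^ (j - 1)) (X.P • X.v 0)).1 (.inr (.inr (.inl (last p)))) = 0 := by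
    intro h0
    refine X.coord_leibniz_eq_zero _ _ _ fun i hi => ?_
    rw [X.diff_pow_v (by omega), X.v_apply_right (by omega)]
  split_ifs with h0 h1 h1
  · omega
  · rfl
  · rw [h h0, X.z_apply_right_last (by omega), if_pos (by omega), X.r_mul_eb, zero_sub]
  · rw [h h0, X.z_apply_right_last (by omega), if_neg (by omega), mul_zero, sub_zero]

theorem diff_pow_smul_y_left_last (a : A) :
    ((X.cells.diff ^ (p - 1)) (a • X.y)).1 (.inr (.inl (last p))) = a * X.P := by
  have h2 := two_le p
  rw [coord_leibniz, X.diff_pow_y_left_last (by omega), if_pos rfl]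
  intro j hj
  rw [X.diff_pow_y_left_last (by omega), if_neg (by omega)]

theorem diff_pow_smul_y_right_last (a : A) :
    ((X.cells.diff ^ (p - 1)) (a • X.y)).1 (.inr (.inr (.inl (last p)))) = -(a * X.r) := by
  have h2 := two_le p
  rw [coord_leibniz, X.diff_pow_y_right_last (by omega), if_pos rfl, mul_neg]
  intro j hj
  rw [X.diff_pow_y_right_last (by omega), if_neg (by omega)]

section Augmentation

variable {X} {M : PDGModule 𝔸} {ℓ : M.carrier}

/-- A string of elements vanishes if each entry is determined by the next one and the last entry
vanishes. -/
theorem string_eq_zero (f : Fin (p - 1) → A) (hl : f (last p) = 0)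
    (hf : ∀ (t : ℕ) (h : t + 1 < p - 1), f ⟨t + 1, h⟩ = 0 → f ⟨t, by omega⟩ = 0)
    (t : Fin (p - 1)) : f t = 0 := by
  have key : ∀ i t : ℕ, ∀ h : t < p - 1, t + i = p - 2 → f ⟨t, h⟩ = 0 := by
    intro i
    induction i with
    | zero =>
      intro t h e
      obtain rfl : t = p - 2 := by omega
      exact hl
    | succ i ih =>
      intro t h e
      exact hf t (by omega) (ih (t + 1) (by omega) (by omega))
  exact key (p - 2 - t.val) t.val t.isLt (by omega)

/-- For a cycle, the equation at position `t + 1` of a string expresses the entry at `t` through the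
one at `t + 1`, so each string vanishes once its last entry does. -/
theorem Resolves.eq_zero (H : X.Resolves ℓ) {x : X.cells.coords} (hx : X.cells.diff x = 0)
    (h0 : x.1 (.inl ()) = 0) (h1 : x.1 (.inr (.inl (last p))) = 0)
    (h2 : x.1 (.inr (.inr (.inl (last p)))) = 0) : x = 0 := by
  have hp2 := two_le p
  have hd : ∀ t, (X.cells.diff x).1 t = 0 := fun t => by rw [hx]; rfl
  have hl : ∀ t, x.1 (.inr (.inl t)) = 0 := by
    refine string_eq_zero _ h1 fun t h e => ?_
    have := hd (.inr (.inl ⟨t + 1, h⟩))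
    rw [diff_left, e, map_zero, h2, zero_mul, dif_neg (by simp), if_neg (by simp)] at this
    simpa using this
  have hr : ∀ t, x.1 (.inr (.inr (.inl t))) = 0 := by
    refine string_eq_zero _ h2 fun t h e => ?_
    have := hd (.inr (.inr (.inl ⟨t + 1, h⟩)))
    rw [diff_right, e, map_zero, dif_neg (by simp), if_neg (by simp)] at this
    simpa using this
  -- At the start of the two strings the cycle equation says that the top coordinate is annihilated
  -- by `P` and by `r`; the ordinary complex is injective there.
  have ht : x.1 (.inr (.inr (.inr ()))) = 0 := by
    refine H.exact_top _ (x.2 _) ?_ ?_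
    · have := hd (.inr (.inl ⟨0, by omega⟩))
      rw [diff_left, hl, map_zero, h2, zero_mul, dif_pos rfl, if_pos rfl] at this
      simpa using this
    · have := hd (.inr (.inr (.inl ⟨0, by omega⟩)))
      rw [diff_right, hr, map_zero, dif_pos rfl, if_pos rfl] at this
      simpa using this
  refine X.cells.coords_ext ?_
  rintro (_ | t | t | _)
  exacts [h0, hl t, hr t, ht]

/-- The augmentation of the resolution. -/
noncomputable def Resolves.hom (H : X.Resolves ℓ) : PDGModule.Hom X.resolution M where
  toLin := ((LinearMap.toSpanSingleton A M.carrier ℓ) ∘ₗ X.cells.coord (.inl ())).restrictScalars k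
  map_gr := fun l x hx => by
    have := M.smul_mem _ _ _ _ (hx (.inl ())) H.mem
    rwa [show l - X.cells.deg (.inl ()) + 0 = l - 0 + 0 from rfl, sub_zero, add_zero] at this
  map_d := fun x => by
    change (X.cells.diff x).1 (.inl ()) • ℓ = M.d (x.1 (.inl ()) • ℓ)
    rw [X.diff_bot, M.d_smul, H.d_eq, smul_zero, add_smul, add_smul, mul_smul, mul_smul, H.q_smul,
      H.s_smul]
    simp
  map_smul := fun a x => LinearMap.map_smul (LinearMap.toSpanSingleton A M.carrier ℓ ∘ₗ X.cells.coord (.inl ())) a x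

theorem Resolves.hom_apply (H : X.Resolves ℓ) (x : X.cells.coords) : H.hom.toLin x = x.1 (.inl ()) • ℓ := rfl

/-- A cycle `z` of the kernel is cleared coordinate by coordinate by subtracting images of `d ^ (p -
1)`, each step using exactness of the ordinary complex at one place. -/
theorem Resolves.isCofibrantReplacement (H : X.Resolves ℓ) :
    PDGModule.IsCofibrantReplacement H.hom := by
  have hp2 := two_le p
  have hs : Function.Surjective H.hom.toLin := by
    intro m
    obtain ⟨a, ha, rfl⟩ := H.exists_smul m
    refine ⟨a • X.g, ?_⟩
    rw [H.hom_apply]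
    change (a * X.g.1 (.inl ())) • ℓ = _
    rw [X.g_apply_bot, ha]
  refine ⟨X.resolution_isCofibrant, hs, ?_⟩
  refine H.hom.toHom.isHomotopyEquiv_of_surjective hs fun z hz hdz => ?_
  -- The bottom coordinate annihilates the generator of `M`, so it comes from the middle term;
  -- starting the strings with `u` and `w` gives an element whose image under `d ^ (p - 1)` has the
  -- same bottom coordinate.
  obtain ⟨u, w, hu, hw, e⟩ := H.exact_bot (z.1 (.inl ())) (z.2 _) hz
  let w₁ : X.cells.coords := u • X.v 0 + w • X.z 0
  have hw₁ : w₁.1 (.inl ()) = 0 := by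
    change u * (X.v 0).1 _ + w * (X.z 0).1 _ = 0
    rw [X.v_apply_bot (by omega), X.z_apply_bot (by omega)]
    simp
  have hd : ∀ w, X.cells.diff ((X.cells.diff ^ (p - 1)) w) = 0 := by
    intro w
    rw [← Module.End.mul_apply, ← pow_succ', Nat.sub_add_cancel hp.out.one_le, X.diff_pow_prime]
    rfl
  let z₁ : X.cells.coords := z - (X.cells.diff ^ (p - 1)) w₁
  have hz₁ : X.cells.diff z₁ = 0 := by rw [map_sub, hd, sub_zero]; exact hdz
  have b₁ : z₁.1 (.inl ()) = 0 := by
    change z.1 (.inl ()) - ((X.cells.diff ^ (p - 1)) w₁).1 (.inl ()) = 0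
    rw [map_add]
    change _ - (((X.cells.diff ^ (p - 1)) _).1 _ + ((X.cells.diff ^ (p - 1)) _).1 _) = 0
    rw [diff_pow_smul_v_bot, diff_pow_smul_z_bot, e, sub_self]
  -- The bottom coordinate of the cycle equation for `z₁`: the last entries of the two strings form
  -- a cycle of the ordinary complex.
  have m₁ : z₁.1 (.inr (.inl (last p))) * X.q + z₁.1 (.inr (.inr (.inl (last p)))) * X.s = 0 := by
    have := X.diff_bot z₁
    rw [hz₁, b₁, map_zero, zero_add] at this
    exact this.symm
  obtain ⟨b, hb, hb1, hb2⟩ := H.exact_mid _ _ (z₁.2 _) (z₁.2 _) m₁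
  -- Subtracting this leaves a cycle that vanishes at the bottom and at the ends of both strings,
  -- and such a cycle is zero.
  have : z₁ - (X.cells.diff ^ (p - 1)) (b • X.y) = 0 := by
    refine H.eq_zero ?_ ?_ ?_ ?_
    · rw [map_sub, hz₁, hd, sub_zero]
    · change z₁.1 _ - ((X.cells.diff ^ (p - 1)) _).1 _ = 0
      rw [diff_pow_smul_y_bot, b₁, sub_zero]
    · change z₁.1 _ - ((X.cells.diff ^ (p - 1)) _).1 _ = 0
      rw [diff_pow_smul_y_left_last, hb1, sub_self]
    · change z₁.1 _ - ((X.cells.diff ^ (p - 1)) _).1 _ = 0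
      rw [diff_pow_smul_y_right_last, hb2, sub_self]
  refine ⟨w₁ + b • X.y, ?_, ?_⟩
  · rw [H.hom_apply]
    change (w₁.1 _ + b * X.y.1 _) • ℓ = 0
    rw [hw₁, y, X.cells.cell_apply_ne (by simp), mul_zero, add_zero, zero_smul]
  · change (X.cells.diff ^ (p - 1)) (w₁ + b • X.y) = z
    rw [map_add, ← sub_eq_zero.1 this]
    exact add_sub_cancel _ _

end Augmentation

end SquareData

/-! ## `p`-complexes in coordinates -/

namespace PComplex

variable {k : Type u} [Field k] {p : ℕ}

theorem eq_of_mem_of_mem (C : PComplex k p) {i j : ℤ} {x : C.carrier} (hi : x ∈ C.gr i)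
    (hj : x ∈ C.gr j) (hx : x ≠ 0) : i = j := by
  by_contra h
  refine hx ?_
  rw [← gradedProj_of_mem C.gr C.internal hi, gradedProj_of_mem_ne C.gr C.internal (Ne.symm h) hj]

/-- A `p`-complex has a homogeneous basis with given degrees in which the differential has the
given matrix. -/
def HasCoords (C : PComplex k p) {ι : Type} [Fintype ι] (deg : ι → ℤ) (m : ι → ι → k) : Prop :=
  ∃ φ : C.carrier ≃ₗ[k] (ι → k), (∀ x i', φ (C.d x) i' = ∑ i, φ x i * m i i') ∧
    ∀ l x, x ∈ C.gr l ↔ ∀ i, φ x i ≠ 0 → deg i = l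

section

variable {C D : PComplex k p} {ι ι' : Type} [Fintype ι] [Fintype ι'] {deg : ι → ℤ}
  {deg' : ι' → ℤ} {m : ι → ι → k} {m' : ι' → ι' → k}

/-- The change of basis given by the bijection `e` and the scalars `c` is an isomorphism of
`p`-complexes. Relabelling and rescaling basis vectors is enough for all the complexes that occur
apart from `Ṽ_{p-2} ⊗ Ṽ_{p-2}`. -/
theorem HasCoords.homotopyEquivalent [Fact p.Prime] (hC : HasCoords C deg m) (hD : HasCoords D deg' m')
    (e : ι ≃ ι') (c : ι → k) (hc : ∀ i, c i ≠ 0) (hdeg : ∀ i, deg' (e i) = deg i)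
    (hm : ∀ i i', c i * m' (e i) (e i') = c i' * m i i') : C.HomotopyEquivalent D := by
  obtain ⟨φ, hφd, hφ⟩ := hC
  obtain ⟨ψ, hψd, hψ⟩ := hD
  let F : C.carrier →ₗ[k] D.carrier := ψ.symm.toLinearMap ∘ₗ
    (LinearEquiv.funCongrLeft k k e.symm).toLinearMap ∘ₗ
    (LinearMap.pi fun i => c i • LinearMap.proj i) ∘ₗ φ.toLinearMap
  have hF : ∀ x i, ψ (F x) (e i) = c i * φ x i := by
    intro x i
    simp [F, LinearEquiv.funCongrLeft_apply, LinearMap.funLeft_apply]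
  have hext : ∀ u v : D.carrier, (∀ i, ψ u (e i) = ψ v (e i)) → u = v := by
    intro u v h
    refine ψ.injective (funext fun i' => ?_)
    obtain ⟨i, rfl⟩ := e.surjective i'
    exact h i
  refine Hom.homotopyEquivalent_of_bijective
    { toLin := F
      map_gr := fun l x hx => (hψ _ _).2 fun i' => ?_
      map_d := fun x => hext _ _ fun i => ?_ } ?_ ?_
  · obtain ⟨i, rfl⟩ := e.surjective i'
    rw [hF, hdeg]
    exact fun h => (hφ _ _).1 hx i (right_ne_zero_of_mul h)
  · rw [hF, hφd, hψd, Finset.mul_sum, ← e.sum_comp]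
    refine Finset.sum_congr rfl fun i _ => ?_
    rw [hF, mul_right_comm, hm]
    ring
  · intro x y hxy
    refine φ.injective (funext fun i => mul_left_cancel₀ (hc i) ?_)
    rw [← hF, ← hF]
    exact congrArg (fun z => ψ z (e i)) hxy
  · intro y
    refine ⟨φ.symm fun i => (c i)⁻¹ * ψ y (e i), hext _ _ fun i => ?_⟩
    change ψ (F _) (e i) = _
    rw [hF, φ.apply_symm_apply, mul_inv_cancel_left₀ (hc i)]

theorem HasCoords.shift (hC : HasCoords C deg m) (a : ℤ) :
    HasCoords (C.shift a) (fun i => deg i + a) m := by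
  obtain ⟨φ, hφd, hφ⟩ := hC
  refine ⟨φ, hφd, fun l x => (hφ (l - a) x).trans ?_⟩
  exact forall_congr' fun i => imp_congr_right fun _ => eq_sub_iff_add_eq

theorem hasCoords_balanced (n : ℕ) (hn : n < p) :
    HasCoords (balanced k n hn) (fun s : Fin (n + 1) => 2 * (s.val : ℤ) - n)
      (fun s s' => if s.val + 1 = s'.val then 1 else 0) := by
  refine ⟨LinearEquiv.refl k _, fun x s' => ?_, fun l x => Iff.rfl⟩
  change balancedD k n x s' = ∑ s : Fin (n + 1), (show Fin (n + 1) → k from x) s *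
    (if s.val + 1 = s'.val then 1 else 0)
  by_cases h : s'.val = 0
  · rw [balancedD_apply_zero k n x s' h]
    exact (Finset.sum_eq_zero fun s _ => by rw [if_neg (by omega), mul_zero]).symm
  · rw [balancedD_apply k n x s' h, Finset.sum_eq_single ⟨s'.val - 1, by omega⟩]
    · rw [if_pos (by simp only; omega), mul_one]
    · intro s _ hs
      rw [if_neg, mul_zero]
      intro h'
      exact hs (Fin.ext (by simp only; omega))
    · simp

theorem HasCoords.directSum (hC : HasCoords C deg m) (hD : HasCoords D deg' m') :
    HasCoords (C.directSum D) (Sum.elim deg deg')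
      (Sum.elim (fun i => Sum.elim (m i) 0) (fun i => Sum.elim 0 (m' i))) := by
  obtain ⟨φ, hφd, hφ⟩ := hC
  obtain ⟨ψ, hψd, hψ⟩ := hD
  refine ⟨(φ.prodCongr ψ).trans (LinearEquiv.sumArrowLequivProdArrow ι ι' k k).symm, ?_, ?_⟩
  · rintro ⟨x, y⟩ (i | i)
    · rw [Fintype.sum_sum_type]
      change φ (C.d x) i = ∑ j, φ x j * m j i + ∑ j, ψ y j * 0
      simpa using hφd x i
    · rw [Fintype.sum_sum_type]
      change ψ (D.d y) i = ∑ j, φ x j * 0 + ∑ j, ψ y j * m' j i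
      simpa using hψd y i
  · rintro l ⟨x, y⟩
    rw [Sum.forall]
    exact and_congr (hφ l x) (hψ l y)

theorem hasCoords_zero (k : Type u) [Field k] (p : ℕ) [Fact p.Prime] :
    HasCoords (zero k p) (fun _ : Empty => 0) 0 := by
  refine ⟨{ (0 : (zero k p).carrier →ₗ[k] (Empty → k)) with
      invFun := fun _ => 0
      left_inv := fun _ => rfl
      right_inv := fun _ => Subsingleton.elim _ _ }, fun _ i => i.elim, fun l x => ?_⟩
  exact ⟨fun _ i => i.elim, fun _ => trivial⟩

end

end PComplex

/-! ## One-dimensional modules -/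

namespace PDGModule

variable {k : Type u} [Field k] {p : ℕ} {A : Type u} [Ring A] [Algebra k A]
  {𝔸 : PDGAlgebra k p A}

/-- The module is one-dimensional, concentrated in degree zero, and the algebra acts through
the given function. -/
structure ActsBy (N : PDGModule 𝔸) (ε : A → k) where
  equiv : N.carrier ≃ₗ[k] k
  equiv_smul : ∀ a x, equiv (a • x) = ε a * equiv x
  d_eq : ∀ x, N.d x = 0
  mem : ∀ x, x ∈ N.gr 0

namespace ActsBy

variable {N : PDGModule 𝔸} {ε : A → k}

/-- The module has zero differential, so the Leibniz rule makes every boundary of the algebra act by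
zero. -/
theorem map_d (c : N.ActsBy ε) (a : A) : ε (𝔸.d a) = 0 := by
  have := N.d_smul a (c.equiv.symm 1)
  rw [c.d_eq, c.d_eq, smul_zero, add_zero] at this
  have := congrArg c.equiv this
  rw [c.equiv_smul] at this
  simpa using this.symm

/-- A homogeneous element acting nontrivially preserves degree zero, where the whole module lives,
so its degree is zero. -/
theorem eq_zero_of_mem (c : N.ActsBy ε) {l : ℤ} {a : A} (ha : a ∈ 𝔸.gr l) (h : ε a ≠ 0) : l = 0 := by
  have h1 := N.smul_mem _ _ a _ ha (c.mem (c.equiv.symm 1))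
  rw [add_zero] at h1
  refine N.toPComplex.eq_of_mem_of_mem h1 (c.mem _) fun h0 => h ?_
  have := congrArg c.equiv h0
  rw [c.equiv_smul] at this
  simpa using this

end ActsBy

end PDGModule

namespace CellData

variable {k : Type u} [Field k] {p : ℕ} [Fact p.Prime] [CharP k p] {A : Type u} [Ring A]
  [Algebra k A] {𝔸 : PDGAlgebra k p A} {G : Type} [Fintype G] [DecidableEq G] (S : CellData 𝔸 G)

open PDGModule

/-- The homomorphisms from a cell module to a one-dimensional module. -/
theorem hasCoords_HOM (hp : S.diff ^ p = 0) {N : PDGModule 𝔸} {ε : A → k} (c : N.ActsBy ε)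
    {ι : Type} [Fintype ι] {σ : ι → G} (hσ : Function.Injective σ)
    (hσ1 : ∀ i, ε (S.idem (σ i)) = 1) (hσ0 : ∀ t, t ∉ Set.range σ → ε (S.idem t) = 0) :
    PComplex.HasCoords (HOM (S.toModule hp) N) (fun i => -S.deg (σ i))
      (fun i i' => -ε (S.mat (σ i') (σ i))) := by
  let φ : (HOM (S.toModule hp) N).carrier →ₗ[k] (ι → k) :=
    { toFun := fun f i => c.equiv (f.1 (S.cell (σ i)))
      map_add' := fun f g => funext fun i => map_add c.equiv _ _
      map_smul' := fun a f => funext fun i => map_smul c.equiv a _ }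
  have hφ : ∀ f i, φ f i = c.equiv (f.1 (S.cell (σ i))) := fun f i => rfl
  -- A cell equals its idempotent times itself, and that idempotent acts by zero on `N` outside the
  -- range of `σ`.
  have h0 : ∀ (f : (HOM (S.toModule hp) N).carrier) t, t ∉ Set.range σ → f.1 (S.cell t) = 0 := by
    intro f t ht
    refine c.equiv.injective ?_
    have := HOM.smul_apply f (S.idem t) (S.cell t)
    rw [S.idem_smul_cell] at this
    rw [this, c.equiv_smul, hσ0 t ht, zero_mul, map_zero]
  have hi : Function.Injective φ := by
    intro f g h
    refine Subtype.ext (S.linear_ext (fun a x => HOM.smul_apply f a x)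
      (fun a x => HOM.smul_apply g a x) fun t => ?_)
    by_cases ht : t ∈ Set.range σ
    · obtain ⟨i, rfl⟩ := ht
      exact c.equiv.injective (congrFun h i)
    · rw [h0 f t ht, h0 g t ht]
  have hs : Function.Surjective φ := by
    intro x
    let κ : G → N.carrier := fun t => c.equiv.symm (∑ i, if σ i = t then x i else 0)
    have hκ : ∀ i, c.equiv (κ (σ i)) = x i := by
      intro i
      simp only [κ, LinearEquiv.apply_symm_apply]
      rw [Finset.sum_eq_single i]
      · rw [if_pos rfl]
      · intro j _ hj
        rw [if_neg fun e => hj (hσ e)]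
      · simp
    refine ⟨⟨S.liftK hp N κ, S.mem_iSup_homDeg (S.liftK_smul hp N κ)⟩, funext fun i => ?_⟩
    refine (hφ _ _).trans ?_
    refine (congrArg c.equiv (S.liftK_cell hp N κ (σ i) ?_)).trans (hκ i)
    refine c.equiv.injective ?_
    rw [c.equiv_smul, hσ1, one_mul]
  refine ⟨LinearEquiv.ofBijective φ ⟨hi, hs⟩, fun f i' => ?_, fun l f => ⟨fun hf i h => ?_, fun h => ?_⟩⟩
  · change c.equiv (N.d (f.1 (S.cell (σ i'))) - f.1 (S.diff (S.cell (σ i')))) =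
      ∑ i, c.equiv (f.1 (S.cell (σ i))) * _
    -- Since `N` has zero differential, the differential of `f` is `-f ∘ d`: this is the source of
    -- the sign and of the transposed matrix.
    rw [c.d_eq, zero_sub, S.diff_cell]
    have : f.1 (∑ t', S.mat (σ i') t' • S.cell t') = ∑ t', S.mat (σ i') t' • f.1 (S.cell t') :=
      (map_sum f.1 _ _).trans (Finset.sum_congr rfl fun t' _ => HOM.smul_apply f _ _)
    rw [this, map_neg, map_sum, ← Finset.sum_neg_distrib]
    refine (Finset.sum_of_injOn σ hσ.injOn (by simp) ?_ ?_).symm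
    · intro t _ ht
      rw [h0 f t (by simpa using ht), smul_zero, map_zero, neg_zero]
    · intro i _
      rw [c.equiv_smul]
      ring
  · have h1 : f.1 (S.cell (σ i)) ∈ N.gr (S.deg (σ i) + l) := hf.2 _ _ (S.cell_mem (σ i))
    have := N.toPComplex.eq_of_mem_of_mem h1 (c.mem _) fun h0 => h
        ((congrArg c.equiv h0).trans (map_zero _))
    change -S.deg (σ i) = l
    omega
  · refine ⟨fun a x => HOM.smul_apply f a x, fun j x hx => ?_⟩
    change f.1 x ∈ _
    rw [S.linear_eq (fun a x => HOM.smul_apply f a x)]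
    refine Submodule.sum_mem _ fun t _ => ?_
    by_cases ht : t ∈ Set.range σ
    · obtain ⟨i, rfl⟩ := ht
      by_cases h' : f.1 (S.cell (σ i)) = 0
      · rw [h', smul_zero]
        exact zero_mem _
      · have hd : -S.deg (σ i) = l := h i fun e => h' (c.equiv.injective (e.trans (map_zero _).symm))
        have := N.smul_mem _ _ _ _ (hx (σ i)) (c.mem (f.1 (S.cell (σ i))))
        rwa [show j - S.deg (σ i) + 0 = j + l by omega] at this
    · rw [h0 f t ht, smul_zero]
      exact zero_mem _

/-- The tensor product of a one-dimensional module and a cell module. -/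
theorem hasCoords_tensor (hp : S.diff ^ p = 0) {N : PDGModule 𝔸.op} {ε : A →ₐ[k] k}
    (c : N.ActsBy fun a => ε a.unop) {ι : Type} [Fintype ι] {σ : ι → G}
    (hσ : Function.Injective σ) (hσ1 : ∀ i, ε (S.idem (σ i)) = 1)
    (hσ0 : ∀ t, t ∉ Set.range σ → ε (S.idem t) = 0) :
    PComplex.HasCoords (PDGModule.tensor N (S.toModule hp)) (fun i => S.deg (σ i))
      (fun i i' => ε (S.mat (σ i) (σ i'))) := by
  let B : N.carrier ⊗[k] S.coords →ₗ[k] (ι → k) := LinearMap.pi fun i =>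
    TensorProduct.lift (((LinearMap.mul k k).compl₂
      (ε.toLinearMap ∘ₗ (S.coord (σ i)).restrictScalars k)) ∘ₗ c.equiv.toLinearMap)
  have hB : ∀ n x i, B (n ⊗ₜ x) i = c.equiv n * ε (x.1 (σ i)) := fun n x i => rfl
  let φ : (PDGModule.tensor N (S.toModule hp)).carrier →ₗ[k] (ι → k) :=
    (balancing N (S.toModule hp)).liftQ B (by
      refine Submodule.span_le.2 ?_
      rintro _ ⟨n, a, x, rfl⟩
      change B _ = 0
      rw [map_sub, sub_eq_zero]
      refine funext fun i => ?_
      refine (hB _ _ _).trans ((hB _ _ _).trans ?_).symm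
      change _ * ε (a * x.1 (σ i)) = _
      rw [c.equiv_smul, map_mul]
      change _ = ε a * _ * _
      ring)
  have hφ : ∀ n x i, φ (tmk N (S.toModule hp) (n ⊗ₜ x)) i = c.equiv n * ε (x.1 (σ i)) :=
    fun n x i => rfl
  let n₀ : N.carrier := c.equiv.symm 1
  have hn₀ : c.equiv n₀ = 1 := c.equiv.apply_symm_apply 1
  let ω : G → (PDGModule.tensor N (S.toModule hp)).carrier := fun t =>
    tmk N (S.toModule hp) (n₀ ⊗ₜ S.cell t)
  have h0 : ∀ (x : S.coords) t, t ∉ Set.range σ → ε (x.1 t) = 0 := by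
    intro x t ht
    rw [← S.coords_mul_idem, map_mul, hσ0 t ht, mul_zero]
  -- Moving the algebra coefficients of the cells across the tensor sign shows that the classes of
  -- `n₀ ⊗ cell` span; independence then follows by evaluating `φ` on them.
  have hexp : ∀ z, z = ∑ i, φ z i • ω (σ i) := by
    let Ψ : (PDGModule.tensor N (S.toModule hp)).carrier →ₗ[k]
        (PDGModule.tensor N (S.toModule hp)).carrier :=
      ∑ i, (LinearMap.toSpanSingleton k _ (ω (σ i))) ∘ₗ LinearMap.proj i ∘ₗ φ
    have hΨ : ∀ z, Ψ z = ∑ i, φ z i • ω (σ i) := fun z => LinearMap.sum_apply _ _ _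
    have : LinearMap.id = Ψ := by
      refine tensor_ext N (S.toModule hp) fun n x => ?_
      rw [hΨ, LinearMap.id_apply]
      have e : x = ∑ t, x.1 t • S.cell t := (S.sum_smul_cell x).symm
      conv_lhs => rw [e]
      refine (congrArg (tmk N (S.toModule hp)) (TensorProduct.tmul_sum n _ _)).trans ?_
      rw [map_sum]
      have ht : ∀ t, tmk N (S.toModule hp) (n ⊗ₜ (x.1 t • S.cell t)) =
          (c.equiv n * ε (x.1 t)) • ω t := by
        intro t
        refine (tmk_smul N (S.toModule hp) n (x.1 t) (S.cell t)).trans ?_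
        have : MulOpposite.op (x.1 t) • n = (c.equiv n * ε (x.1 t)) • n₀ := by
          refine c.equiv.injective ?_
          rw [c.equiv_smul, map_smul, hn₀, smul_eq_mul, mul_one, mul_comm]
          rfl
        rw [this]
        exact map_smul (tmk N (S.toModule hp)) _ (n₀ ⊗ₜ[k] S.cell t)
      rw [Finset.sum_congr rfl fun t _ => ht t]
      refine (Finset.sum_of_injOn σ hσ.injOn (by simp) ?_ ?_).symm
      · intro t _ ht
        rw [h0 x t (by simpa using ht), mul_zero, zero_smul]
      · intro i _
        rw [hφ]
    intro z
    rw [← hΨ, ← this, LinearMap.id_apply]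
  have hω1 : ∀ i, φ (ω (σ i)) i = 1 := by
    intro i
    rw [hφ, hn₀, one_mul, S.cell_apply_self, hσ1]
  have hω0 : ∀ i i', i' ≠ i → φ (ω (σ i)) i' = 0 := by
    intro i i' h
    rw [hφ, hn₀, one_mul, S.cell_apply_ne (fun e => h (hσ e)), map_zero]
  have hi : Function.Injective φ := by
    intro y z h
    rw [hexp y, hexp z, h]
  have hs : Function.Surjective φ := by
    intro x
    refine ⟨∑ i, x i • ω (σ i), funext fun i' => ?_⟩
    rw [map_sum, Finset.sum_apply]
    simp only [map_smul, Pi.smul_apply, smul_eq_mul]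
    rw [Finset.sum_eq_single i', hω1, mul_one]
    · intro i _ hi
      rw [hω0 _ _ hi.symm, mul_zero]
    · simp
  refine ⟨LinearEquiv.ofBijective φ ⟨hi, hs⟩, fun z i' => ?_, fun l z => ⟨fun hz i h => ?_, fun h => ?_⟩⟩
  · change φ ((PDGModule.tensor N (S.toModule hp)).d z) i' = ∑ i, φ z i * _
    let L₁ : (PDGModule.tensor N (S.toModule hp)).carrier →ₗ[k] k :=
      LinearMap.proj i' ∘ₗ φ ∘ₗ (PDGModule.tensor N (S.toModule hp)).d
    let L₂ : (PDGModule.tensor N (S.toModule hp)).carrier →ₗ[k] k :=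
      ∑ i, ε (S.mat (σ i) (σ i')) • (LinearMap.proj i ∘ₗ φ)
    have hL₂ : ∀ z, L₂ z = ∑ i, φ z i * ε (S.mat (σ i) (σ i')) := by
      intro z
      refine (LinearMap.sum_apply _ _ _).trans (Finset.sum_congr rfl fun i _ => ?_)
      exact mul_comm _ _
    -- In the differential of the cell module the term coming from the algebra differential is
    -- killed by `ε`, so only the matrix contributes.
    have : L₁ = L₂ := by
      refine tensor_ext N (S.toModule hp) fun n x => ?_
      rw [hL₂]
      change φ ((PDGModule.tensor N (S.toModule hp)).d (tmk N (S.toModule hp) (n ⊗ₜ x))) i' = _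
      rw [tensor_d_tmk, c.d_eq, TensorProduct.zero_tmul, map_zero, zero_add, hφ]
      change _ * ε ((S.diff x).1 (σ i')) = _
      rw [S.diff_apply, map_add, show ε (𝔸.d (x.1 (σ i'))) = 0 from c.map_d (MulOpposite.op (x.1 (σ i'))), zero_add, map_sum,
        Finset.mul_sum]
      refine (Finset.sum_of_injOn σ hσ.injOn (by simp) ?_ ?_).symm
      · intro t _ ht
        rw [map_mul, h0 x t (by simpa using ht), zero_mul, mul_zero]
      · intro i _
        rw [hφ, map_mul]
        ring
    rw [← hL₂, ← this]
    rfl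
  · change S.deg (σ i) = l
    by_contra hne
    have : (PDGModule.tensor N (S.toModule hp)).gr l ≤ LinearMap.ker ((LinearMap.proj i : (ι → k) →ₗ[k] k) ∘ₗ φ) := by
      refine tensor_gr_le N (S.toModule hp) l _ fun j n x hn hx => ?_
      change φ (tmk N (S.toModule hp) (n ⊗ₜ x)) i = 0
      rw [hφ]
      by_contra h'
      have hn0 : n ≠ 0 := by
        rintro rfl
        simp at h'
      have hj := N.toPComplex.eq_of_mem_of_mem hn (c.mem n) hn0
      have := c.eq_zero_of_mem (a := MulOpposite.op (x.1 (σ i))) (hx (σ i)) (right_ne_zero_of_mul h')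
      exact hne (by omega)
    exact h (this hz)
  · rw [hexp z]
    refine Submodule.sum_mem _ fun i _ => ?_
    by_cases h' : φ z i = 0
    · rw [h', zero_smul]
      exact zero_mem _
    · have hd : S.deg (σ i) = l := h i h'
      have := tmk_mem_gr N (S.toModule hp) (c.mem n₀) (S.cell_mem (σ i))
      rw [zero_add, hd] at this
      exact Submodule.smul_mem _ _ this

end CellData

/-! ## Shifts of the one-dimensional `p`-complex -/

namespace PComplex

set_option linter.unusedSectionVars false

variable {k : Type u} [Field k] {p : ℕ} [hp : Fact p.Prime] {C D C' D' : PComplex k p}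

theorem directSum_d_pow (C D : PComplex k p) (m : ℕ) :
    (C.directSum D).d ^ m = (C.d ^ m).prodMap (D.d ^ m) := by
  induction m with
  | zero => exact LinearMap.ext fun _ => rfl
  | succ m ih =>
    rw [pow_succ, ih, pow_succ, pow_succ]
    exact LinearMap.ext fun _ => rfl

/-- The direct sum of two morphisms. -/
noncomputable def Hom.directSum (f : Hom C C') (g : Hom D D') :
    Hom (C.directSum D) (C'.directSum D') where
  toLin := f.toLin.prodMap g.toLin
  map_gr := fun l _ hx => ⟨f.map_gr l _ hx.1, g.map_gr l _ hx.2⟩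
  map_d := fun x => Prod.ext (f.map_d x.1) (g.map_d x.2)

theorem NullHomotopic.directSum {f : C.carrier →ₗ[k] C'.carrier} {g : D.carrier →ₗ[k] D'.carrier}
    (hf : NullHomotopic (C := C) (D := C') f) (hg : NullHomotopic (C := D) (D := D') g) :
    NullHomotopic (C := C.directSum D) (D := C'.directSum D') (f.prodMap g) := by
  obtain ⟨h, hh, rfl⟩ := hf
  obtain ⟨h', hh', rfl⟩ := hg
  refine ⟨h.prodMap h', fun l x hx => ⟨hh l _ hx.1, hh' l _ hx.2⟩, ?_⟩
  have : ∀ s, ((C'.directSum D').d ^ (p - 1 - s)) ∘ₗ (h.prodMap h') ∘ₗ ((C.directSum D).d ^ s) =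
      ((C'.d ^ (p - 1 - s)) ∘ₗ h ∘ₗ (C.d ^ s)).prodMap ((D'.d ^ (p - 1 - s)) ∘ₗ h' ∘ₗ (D.d ^ s)) := by
    intro s
    rw [directSum_d_pow, directSum_d_pow]
    exact LinearMap.ext fun _ => rfl
  refine Eq.trans ?_ (Finset.sum_congr rfl fun s _ => this s).symm
  refine LinearMap.ext fun x => ?_
  rw [LinearMap.prodMap_apply, LinearMap.sum_apply, LinearMap.sum_apply]
  refine Eq.trans ?_ (LinearMap.sum_apply _ _ _).symm
  let F : ℕ → C'.carrier × D'.carrier := fun s =>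
    (((C'.d ^ (p - 1 - s)) ∘ₗ h ∘ₗ (C.d ^ s)) x.1, ((D'.d ^ (p - 1 - s)) ∘ₗ h' ∘ₗ (D.d ^ s)) x.2)
  refine Prod.ext ?_ ?_
  · exact (map_sum (LinearMap.fst k C'.carrier D'.carrier) F (Finset.range p)).symm
  · exact (map_sum (LinearMap.snd k C'.carrier D'.carrier) F (Finset.range p)).symm

theorem HomotopyEquivalent.directSum (h : HomotopyEquivalent C C') (h' : HomotopyEquivalent D D') :
    HomotopyEquivalent (C.directSum D) (C'.directSum D') := by
  obtain ⟨f, g, h1, h2⟩ := h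
  obtain ⟨f', g', h1', h2'⟩ := h'
  exact ⟨f.directSum f', g.directSum g', h1.directSum h1', h2.directSum h2'⟩

theorem homotopyEquivalent_refl (C : PComplex k p) : HomotopyEquivalent C C :=
  Hom.homotopyEquivalent_of_bijective (Hom.id C) Function.injective_id Function.surjective_id

section Tensor

variable [CharP k p] {ι ι' : Type} [Fintype ι] [Fintype ι'] [DecidableEq ι] [DecidableEq ι']
  {deg : ι → ℤ} {deg' : ι' → ℤ} {m : ι → ι → k} {m' : ι' → ι' → k}

theorem HasCoords.tensor (hC : HasCoords C deg m) (hD : HasCoords D deg' m') :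
    HasCoords (C.tensor D) (fun i : ι × ι' => deg i.1 + deg' i.2)
      (fun i i' => (m i.1 i'.1 * if i.2 = i'.2 then 1 else 0) +
        (if i.1 = i'.1 then 1 else 0) * m' i.2 i'.2) := by
  obtain ⟨φ, hφd, hφ⟩ := hC
  obtain ⟨ψ, hψd, hψ⟩ := hD
  let b := Module.Basis.ofEquivFun φ
  let b' := Module.Basis.ofEquivFun ψ
  let Φ : C.carrier ⊗[k] D.carrier ≃ₗ[k] (ι × ι' → k) := (b.tensorProduct b').equivFun
  have hΦ : ∀ x y i, Φ (x ⊗ₜ y) i = φ x i.1 * ψ y i.2 := by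
    intro x y i
    obtain ⟨i, j⟩ := i
    change (b.tensorProduct b').repr (x ⊗ₜ y) (i, j) = _
    rw [Module.Basis.tensorProduct_repr_tmul_apply, smul_eq_mul, mul_comm]
    rfl
  refine ⟨Φ, fun z i' => ?_, fun l z => ⟨fun hz i h => ?_, fun h => ?_⟩⟩
  · change Φ ((C.d.rTensor D.carrier + D.d.lTensor C.carrier) z) i' = _
    induction z using TensorProduct.induction_on with
    | zero =>
      rw [map_zero, map_zero]
      have : ∀ i, Φ 0 i = 0 := fun i => congrFun (map_zero Φ) i
      exact (Finset.sum_eq_zero fun i _ => by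
        refine (congrArg (· * _) (this i)).trans (zero_mul _)).symm
    | add x y hx hy =>
      rw [map_add, map_add, Pi.add_apply, hx, hy, ← Finset.sum_add_distrib]
      refine Finset.sum_congr rfl fun i _ => ?_
      rw [← add_mul]
      exact congrArg (· * _) (congrFun (map_add Φ x y).symm i)
    | tmul x y =>
      rw [LinearMap.add_apply, LinearMap.rTensor_tmul, LinearMap.lTensor_tmul, map_add, Pi.add_apply,
        hΦ, hΦ, hφd, hψd, Fintype.sum_prod_type]
      have hΦ' : ∀ i j, Φ (x ⊗ₜ y) (i, j) = φ x i * ψ y j := fun i j => hΦ x y (i, j)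
      refine Eq.trans ?_ (Finset.sum_congr rfl fun i _ => Finset.sum_congr rfl fun j _ =>
        congrArg (· * _) (hΦ' i j)).symm
      simp only [mul_add, Finset.sum_add_distrib]
      congr 1
      · rw [Finset.sum_mul]
        refine Finset.sum_congr rfl fun i _ => ?_
        rw [Finset.sum_eq_single i'.2]
        · rw [if_pos rfl]; ring
        · intro j _ hj
          rw [if_neg hj]; ring
        · simp
      · rw [Finset.sum_eq_single i'.1]
        · rw [Finset.mul_sum]
          refine Finset.sum_congr rfl fun j _ => ?_
          rw [if_pos rfl]; ring
        · intro i _ hi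
          exact Finset.sum_eq_zero fun j _ => by rw [if_neg hi]; ring
        · simp
  · change deg i.1 + deg' i.2 = l
    by_contra hne
    have : (C.tensor D).gr l ≤ LinearMap.ker
        ((LinearMap.proj i : (ι × ι' → k) →ₗ[k] k) ∘ₗ Φ.toLinearMap) := by
      refine iSup_le fun j => Submodule.map₂_le.2 fun x hx y hy => ?_
      change Φ (x ⊗ₜ y) i = 0
      rw [hΦ]
      by_contra h'
      have h1 := (hφ _ _).1 hx i.1 (left_ne_zero_of_mul h')
      have h2 := (hψ _ _).1 hy i.2 (right_ne_zero_of_mul h')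
      exact hne (by omega)
    exact h (this hz)
  · have e : z = ∑ i, Φ z i • (b.tensorProduct b') i := ((b.tensorProduct b').sum_equivFun z).symm
    rw [e]
    refine Submodule.sum_mem _ fun i _ => ?_
    by_cases h' : Φ z i = 0
    · rw [h', zero_smul]
      exact zero_mem _
    · refine Submodule.smul_mem _ _ ?_
      rw [← h i h', Module.Basis.tensorProduct_apply]
      refine PDGModule.tmul_mem_gr C D _ _ _ _ ((hφ _ _).2 fun j hj => ?_)
        ((hψ _ _).2 fun j hj => ?_)
      · have : j = i.1 := by
          by_contra hne
          simp [b, hne] at hj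
        rw [this]
      · have : j = i.2 := by
          by_contra hne
          simp [b', hne] at hj
        rw [this]

end Tensor

section Evaluation

variable [CharP k p]

/-- A `p`-complex with the coordinates of a shift of `Ṽ_{p-2} ⊗ Ṽ_{p-2}` is homotopy equivalent to
a shift of `Ṽ_0`. -/
theorem homotopyEquivalent_V0_of_square (c : ℤ) (Z : ℕ → ℕ → C.carrier →ₗ[k] k)
    (hZd : ∀ z s t, s ≤ p - 2 → t ≤ p - 2 → Z s t (C.d z) =
      (if s = 0 then 0 else Z (s - 1) t z) + (if t = 0 then 0 else Z s (t - 1) z))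
    (hZ0 : ∀ z, (∀ s t, s ≤ p - 2 → t ≤ p - 2 → Z s t z = 0) → z = 0)
    (hZs : ∀ f : ℕ → ℕ → k, ∃ z, ∀ s t, s ≤ p - 2 → t ≤ p - 2 → Z s t z = f s t)
    (hZg : ∀ l z, z ∈ C.gr l → ∀ s t, s ≤ p - 2 → t ≤ p - 2 → Z s t z ≠ 0 →
      2 * (s : ℤ) + 2 * t - 2 * (p - 2) + c = l) :
    HomotopyEquivalent C ((V0 k p).shift c) := by
  have hp2 : 2 ≤ p := hp.out.two_le
  -- The pairing on the antidiagonal `s + t = p - 2`, which lies in degree `c`. The alternating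
  -- signs make it vanish on boundaries: neighbouring contributions cancel.
  let ev : C.carrier →ₗ[k] k := ∑ s ∈ Finset.range (p - 1), (-1 : k) ^ s • Z s (p - 2 - s)
  have hev : ∀ z, ev z = ∑ s ∈ Finset.range (p - 1), (-1 : k) ^ s * Z s (p - 2 - s) z := by
    intro z
    simp [ev]
  let F : Hom C ((V0 k p).shift c) :=
    { toLin := LinearMap.pi fun _ => ev
      map_gr := fun l z hz i hi => by
        change ev z ≠ 0 at hi
        rw [hev] at hi
        obtain ⟨s, hs, h⟩ := Finset.exists_ne_zero_of_sum_ne_zero hi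
        have hs := Finset.mem_range.1 hs
        have := hZg l z hz s (p - 2 - s) (by omega) (by omega) (right_ne_zero_of_mul h)
        have hi : i.val = 0 := by omega
        push_cast [hi]
        omega
      map_d := fun z => by
        refine funext fun i => ?_
        refine Eq.trans ?_ (balancedD_apply_zero k 0 _ i (by omega)).symm
        change ev (C.d z) = 0
        rw [hev]
        have hT : ∀ s ∈ Finset.range (p - 2 + 1), (-1 : k) ^ s * Z s (p - 2 - s) (C.d z) =
            (-1 : k) ^ s * (if s = 0 then 0 else Z (s - 1) (p - 2 - s) z) +
            (-1 : k) ^ s * (if p - 2 - s = 0 then 0 else Z s (p - 2 - s - 1) z) := by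
          intro s hs
          have hs := Finset.mem_range.1 hs
          rw [hZd _ _ _ (by omega) (by omega), mul_add]
        rw [show p - 1 = p - 2 + 1 by omega, Finset.sum_congr rfl hT, Finset.sum_add_distrib,
          Finset.sum_range_succ', Finset.sum_range_succ, if_pos rfl, if_pos (by omega), mul_zero,
          mul_zero, add_zero, add_zero, ← Finset.sum_add_distrib]
        refine Finset.sum_eq_zero fun s hs => ?_
        have hs := Finset.mem_range.1 hs
        rw [if_neg (by omega), if_neg (by omega), Nat.add_sub_cancel, pow_succ,
          show p - 2 - s - 1 = p - 2 - (s + 1) by omega]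
        ring }
  have hFz : ∀ z, F.toLin z = 0 → ev z = 0 := fun z h => congrFun h 0
  have hF : ∀ z, ev z = 0 → F.toLin z = 0 := fun z h => funext fun _ => h
  -- For a cycle, the coefficient at `(s, t + 1)` of its zero differential expresses the entry at
  -- `(s, t)` through the column `t + 1`, so the last column determines everything.
  have col : ∀ z, C.d z = 0 → (∀ s, s ≤ p - 2 → Z s (p - 2) z = 0) → z = 0 := by
    intro z hz h
    have key : ∀ i t, t + i = p - 2 → ∀ s, s ≤ p - 2 → Z s t z = 0 := by
      intro i
      induction i with
      | zero =>
        intro t ht s hs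
        obtain rfl : t = p - 2 := by omega
        exact h s hs
      | succ i ih =>
        intro t ht s hs
        have := hZd z s (t + 1) hs (by omega)
        rw [hz, map_zero, if_neg t.succ_ne_zero, Nat.add_sub_cancel] at this
        split_ifs at this with h0
        · simpa using this.symm
        · rw [ih (t + 1) (by omega) (s - 1) (by omega), zero_add] at this
          exact this.symm
    exact hZ0 z fun s t hs ht => key (p - 2 - t) t (by omega) s hs
  refine ⟨F, F.isHomotopyEquiv_of_surjective ?_ fun z hz hdz => ?_⟩
  · intro y
    obtain ⟨z, hz⟩ := hZs fun s t => if s = 0 ∧ t = p - 2 then (show Fin 1 → k from y) 0 else 0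
    refine ⟨z, funext fun i => ?_⟩
    change ev z = (show Fin 1 → k from y) i
    rw [hev, Finset.sum_eq_single_of_mem 0 (Finset.mem_range.2 (by omega)),
      hz _ _ (by omega) (by omega), if_pos ⟨rfl, by omega⟩, pow_zero, one_mul,
      show i = 0 from Fin.ext (by have := i.isLt; simp only [Fin.val_zero]; omega)]
    intro s hs h0
    have hs := Finset.mem_range.1 hs
    rw [hz _ _ (by omega) (by omega), if_neg (by omega), mul_zero]
  -- The cycle condition just below the antidiagonal links consecutive antidiagonal entries with
  -- alternating signs.
  · have hdiag : ∀ s, s ≤ p - 2 → Z s (p - 2 - s) z = (-1) ^ s * Z 0 (p - 2) z := by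
      intro s
      induction s with
      | zero => intro _; simp
      | succ s ih =>
        intro hs
        have := hZd z (s + 1) (p - 2 - s) hs (by omega)
        rw [hdz, map_zero, if_neg s.succ_ne_zero, if_neg (by omega), Nat.add_sub_cancel,
          ih (by omega), show p - 2 - s - 1 = p - 2 - (s + 1) by omega] at this
        rw [pow_succ]
        linear_combination -this
    -- The signs of `ev` and of `hdiag` cancel, so `ev z` is `p - 1 = -1` times this entry.
    have hc : Z 0 (p - 2) z = 0 := by
      have h := hFz z hz
      rw [hev, Finset.sum_congr rfl fun s hs => by
        rw [hdiag s (by have := Finset.mem_range.1 hs; omega), ← mul_assoc, ← pow_add,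
          ← two_mul, pow_mul, neg_one_sq, one_pow, one_mul], Finset.sum_const, Finset.card_range,
        nsmul_eq_mul, Nat.cast_sub (by omega), CharP.cast_eq_zero] at h
      simpa using h
    -- The preimage `w` is sought in the column `t = 0`. Its entries are the last column of `z`,
    -- shifted down by one, with the sign that compensates `binom(p-1, p-2) = -1`.
    let μ : ℕ → k := fun s => if s + 1 ≤ p - 2 then -Z (s + 1) (p - 2) z else 0
    obtain ⟨w, hw⟩ := hZs fun s t => if t = 0 then μ s else 0
    -- The binomial expansion of `(d ⊗ 1 + 1 ⊗ d)^j` on the column `t = 0`. When `t > j` the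
    -- truncated difference `j - t` is harmless because the binomial coefficient is zero.
    have hpow : ∀ j s t, s ≤ p - 2 → t ≤ p - 2 → Z s t ((C.d ^ j) w) =
        (j.choose t : k) * if j - t ≤ s then μ (s - (j - t)) else 0 := by
      intro j
      induction j with
      | zero =>
        intro s t hs ht
        rw [pow_zero, Module.End.one_apply, hw s t hs ht]
        rcases t with _ | t <;> simp
      | succ j ih =>
        intro s t hs ht
        rw [pow_succ', Module.End.mul_apply, hZd _ _ _ hs ht]
        have h1 : (if s = 0 then 0 else Z (s - 1) t ((C.d ^ j) w)) =
            (j.choose t : k) * if j + 1 - t ≤ s then μ (s - (j + 1 - t)) else 0 := by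
          rcases lt_or_ge j t with hjt | hjt
          · have hz : (j.choose t : k) = 0 := by rw [Nat.choose_eq_zero_of_lt hjt, Nat.cast_zero]
            rw [ih _ _ (by omega) ht, hz, zero_mul, zero_mul, ite_self]
          · rcases s with _ | s
            · rw [if_pos rfl, if_neg (by omega), mul_zero]
            · rw [if_neg s.succ_ne_zero, Nat.add_sub_cancel, ih _ _ (by omega) ht,
                Nat.succ_sub hjt]
              simp only [Nat.succ_eq_add_one, Nat.add_le_add_iff_right, Nat.add_sub_add_right]
        rw [h1]
        rcases t with _ | t
        · rw [if_pos rfl, add_zero]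
          simp
        · rw [if_neg t.succ_ne_zero, Nat.add_sub_cancel, ih _ _ hs (by omega),
            Nat.add_sub_add_right, ← add_mul, Nat.choose_succ_succ j t]
          push_cast
          ring
    -- The column `t = 0` meets the antidiagonal only at `s = p - 2`, and there `μ` is zero by
    -- definition; hence `w` lies in the kernel. The second goal is reduced by `col` to the last
    -- column.
    refine ⟨w, hF w ?_, ?_⟩
    · rw [hev]
      refine Finset.sum_eq_zero fun s hs => ?_
      have hs := Finset.mem_range.1 hs
      rw [hw _ _ (by omega) (by omega)]
      split_ifs with h0
      · simp only [μ]
        rw [if_neg (by omega), mul_zero]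
      · rw [mul_zero]
    · rw [← sub_eq_zero]
      refine col _ ?_ fun s hs => ?_
      · rw [map_sub, hdz, sub_zero, ← Module.End.mul_apply, ← pow_succ',
          Nat.sub_add_cancel hp.out.one_le, C.d_pow]
        rfl
      · rw [map_sub, hpow _ _ _ hs le_rfl, Nat.choose_symm_of_eq_add (show p - 1 = p - 2 + 1 by omega),
          Nat.choose_one_right, show p - 1 - (p - 2) = 1 by omega, Nat.cast_sub (by omega),
          CharP.cast_eq_zero, Nat.cast_one, zero_sub]
        rcases s with _ | s
        -- Row `0` of the last column of `d ^ (p - 1) w` is always zero; this is the one entry that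
        -- needs `z` to be in the kernel of the evaluation.
        · rw [if_neg (by omega), hc]
          ring
        · rw [if_pos (by omega), Nat.add_sub_cancel]
          simp only [μ]
          rw [if_pos hs]
          ring

theorem HasCoords.homotopyEquivalent_V0 {c : ℤ}
    {deg : (Unit × Fin (p - 2 + 1)) × Fin (p - 2 + 1) → ℤ}
    {m : (Unit × Fin (p - 2 + 1)) × Fin (p - 2 + 1) →
      (Unit × Fin (p - 2 + 1)) × Fin (p - 2 + 1) → k} (hC : HasCoords C deg m)
    (hdeg : ∀ i, deg i = 2 * (i.1.2.val : ℤ) + 2 * i.2.val - 2 * (p - 2) + c)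
    (hm : ∀ i i', m i i' = ((if i.1.2.val + 1 = i'.1.2.val then 1 else 0) *
      if i.2 = i'.2 then 1 else 0) +
      (if i.1 = i'.1 then 1 else 0) * if i.2.val + 1 = i'.2.val then 1 else 0) :
    HomotopyEquivalent C ((V0 k p).shift c) := by
  obtain ⟨φ, hφd, hφ⟩ := hC
  let ix : ∀ s t : ℕ, s ≤ p - 2 → t ≤ p - 2 → (Unit × Fin (p - 2 + 1)) × Fin (p - 2 + 1) :=
    fun s t hs ht => (((), ⟨s, by omega⟩), ⟨t, by omega⟩)
  let Z : ℕ → ℕ → C.carrier →ₗ[k] k := fun s t => if h : s ≤ p - 2 ∧ t ≤ p - 2 then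
    LinearMap.proj (ix s t h.1 h.2) ∘ₗ φ.toLinearMap else 0
  have hZ : ∀ s t (hs : s ≤ p - 2) (ht : t ≤ p - 2) z, Z s t z = φ z (ix s t hs ht) := by
    intro s t hs ht z
    simp only [Z]
    rw [dif_pos ⟨hs, ht⟩]
    rfl
  have hix : ∀ i, ∃ s t, ∃ hs ht, i = ix s t hs ht := by
    rintro ⟨⟨⟨⟩, s⟩, t⟩
    exact ⟨s.val, t.val, by omega, by omega, rfl⟩
  refine homotopyEquivalent_V0_of_square c Z ?_ ?_ ?_ ?_
  · intro z s t hs ht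
    rw [hZ _ _ hs ht, hφd]
    simp only [hm, mul_add, Finset.sum_add_distrib]
    congr 1
    · split_ifs with h0
      · refine Finset.sum_eq_zero fun i _ => ?_
        rw [if_neg (by simp only [ix]; omega), zero_mul, mul_zero]
      · rw [hZ _ _ (by omega) ht, Finset.sum_eq_single (ix (s - 1) t (by omega) ht)]
        · rw [if_pos (by simp only [ix]; omega), if_pos rfl, mul_one, mul_one]
        · rintro ⟨⟨⟨⟩, s'⟩, t'⟩ _ hne
          by_cases h1 : s'.val + 1 = s
          · rw [if_neg (c := t' = _) (fun e => hne ?_), mul_zero, mul_zero]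
            subst h1
            exact Prod.ext rfl e
          · rw [if_neg h1, zero_mul, mul_zero]
        · simp
    · split_ifs with h0
      · refine Finset.sum_eq_zero fun i _ => ?_
        rw [if_neg (c := i.2.val + 1 = _) (by simp only [ix]; omega), mul_zero, mul_zero]
      · rw [hZ _ _ hs (by omega), Finset.sum_eq_single (ix s (t - 1) hs (by omega))]
        · rw [if_pos rfl, if_pos (by simp only [ix]; omega), mul_one, mul_one]
        · rintro ⟨⟨⟨⟩, s'⟩, t'⟩ _ hne
          by_cases h1 : t'.val + 1 = t
          · rw [if_neg (c := ((), s') = _) (fun e => hne ?_), zero_mul, mul_zero]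
            subst h1
            exact Prod.ext e rfl
          · rw [if_neg (c := t'.val + 1 = _) h1, mul_zero, mul_zero]
        · simp
  · intro z h
    refine φ.injective (funext fun i => ?_)
    obtain ⟨s, t, hs, ht, rfl⟩ := hix i
    rw [← hZ s t hs ht, h s t hs ht, map_zero]
    rfl
  · intro f
    refine ⟨φ.symm fun i => f i.1.2 i.2, fun s t hs ht => ?_⟩
    rw [hZ _ _ hs ht, φ.apply_symm_apply]
  · intro l z hz s t hs ht h
    rw [hZ _ _ hs ht] at h
    rw [← (hφ l z).1 hz _ h, hdeg]

theorem HasCoords.reindex {ι ι' : Type} [Fintype ι] [Fintype ι'] {deg : ι → ℤ} {m : ι → ι → k}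
    (hC : HasCoords C deg m) (e : ι' ≃ ι) :
    HasCoords C (fun i => deg (e i)) (fun i i' => m (e i) (e i')) := by
  obtain ⟨φ, hφd, hφ⟩ := hC
  refine ⟨φ.trans (LinearEquiv.funCongrLeft k k e), fun x i' => ?_, fun l x => ?_⟩
  · refine (hφd x (e i')).trans (e.sum_comp fun i => φ x i * m i (e i')).symm
  · exact (hφ l x).trans (e.forall_congr_right (q := fun i => φ x i ≠ 0 → deg i = l)).symm

theorem hasCoords_V0 : HasCoords (V0 k p) (fun _ : Unit => 0) 0 := by
  have := (hasCoords_balanced (k := k) 0 hp.out.pos).reindex (Equiv.ofUnique Unit (Fin 1))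
  convert this using 1
  · funext i
    have := ((Equiv.ofUnique Unit (Fin 1)) i).isLt
    push_cast
    omega
  · funext i i'
    have := ((Equiv.ofUnique Unit (Fin 1)) i').isLt
    rw [if_neg (by omega)]
    rfl

theorem hasCoords_V0_shift (a : ℤ) : HasCoords ((V0 k p).shift a) (fun _ : Unit => a) 0 := by
  have := (hasCoords_V0 (k := k) (p := p)).shift a
  simpa only [zero_add] using this

/-- A one-dimensional `p`-complex tensored with a shift of `Ṽ_{p-2}`. -/
theorem HasCoords.tensor_Vp2 {a : ℤ} (hC : HasCoords C (fun _ : Unit => a) 0) (b : ℤ) :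
    HomotopyEquivalent (C.tensor ((Vp2 k p).shift b)) ((Vp2 k p).shift (a + b)) := by
  refine (hC.tensor ((hasCoords_balanced _ _).shift b)).homotopyEquivalent
    ((hasCoords_balanced _ _).shift (a + b)) (Equiv.punitProd _) (fun _ => 1)
    (fun _ => one_ne_zero) ?_ ?_
  · rintro ⟨⟨⟩, s⟩
    simp only [Equiv.punitProd_apply]
    ring
  · rintro ⟨⟨⟩, s⟩ ⟨⟨⟩, s'⟩
    simp

/-- Two homological shifts of a one-dimensional complex amount to a grading shift; `b, b' = ±p`
gives `[±2]`. -/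
theorem HasCoords.tensor_Vp2_tensor_Vp2 {a : ℤ} (hC : HasCoords C (fun _ : Unit => a) 0)
    (b b' : ℤ) :
    HomotopyEquivalent ((C.tensor ((Vp2 k p).shift b)).tensor ((Vp2 k p).shift b'))
      ((V0 k p).shift (a + b + b')) := by
  have hp2 := hp.out.two_le
  refine ((hC.tensor ((hasCoords_balanced _ _).shift b)).tensor
    ((hasCoords_balanced _ _).shift b')).homotopyEquivalent_V0 (fun i => ?_) fun i i' => ?_
  · rw [Nat.cast_sub hp2]
    push_cast
    ring
  · simp

theorem HasCoords.shift_tensor_Vp2_tensor_Vp2 {a : ℤ} (hC : HasCoords C (fun _ : Unit => a) 0)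
    (b b' c : ℤ) :
    HomotopyEquivalent (((C.tensor ((Vp2 k p).shift b)).tensor ((Vp2 k p).shift b')).shift c)
      ((V0 k p).shift (a + b + b' + c)) := by
  have hp2 := hp.out.two_le
  refine (((hC.tensor ((hasCoords_balanced _ _).shift b)).tensor
    ((hasCoords_balanced _ _).shift b')).shift c).homotopyEquivalent_V0 (fun i => ?_) fun i i' => ?_
  · rw [Nat.cast_sub hp2]
    push_cast
    ring
  · simp

theorem homotopyEquivalent_V0_hunshift_hunshift :
    HomotopyEquivalent ((V0 k p).shift (2 * (p : ℤ) - 2))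
      ((V0 k p).shift (-2)).hunshift.hunshift := by
  have := (hasCoords_V0_shift (k := k) (p := p) (-2)).tensor_Vp2_tensor_Vp2 p p
  rw [show -2 + (p : ℤ) + p = 2 * p - 2 by ring] at this
  exact this.symm

theorem homotopyEquivalent_V0_hshift_hshift :
    HomotopyEquivalent ((V0 k p).shift (2 - 2 * (p : ℤ)))
      ((V0 k p).hshift.hshift.shift 2) := by
  have := (hasCoords_V0 (k := k) (p := p)).shift_tensor_Vp2_tensor_Vp2 (-p) (-p) 2
  rw [show 0 + -(p : ℤ) + -p + 2 = 2 - 2 * p by ring] at this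
  exact this.symm

theorem homotopyEquivalent_V0_hunshift :
    HomotopyEquivalent ((Vp2 k p).shift ((p : ℤ) - 1)) ((V0 k p).shift (-1)).hunshift := by
  have := (hasCoords_V0_shift (k := k) (p := p) (-1)).tensor_Vp2 p
  rw [show -1 + (p : ℤ) = p - 1 by ring] at this
  exact this.symm

theorem homotopyEquivalent_V0_hshift_shift :
    HomotopyEquivalent ((Vp2 k p).shift (1 - (p : ℤ))) ((V0 k p).hshift.shift 1) := by
  refine ((hasCoords_balanced _ _).shift _).homotopyEquivalent
    (((hasCoords_V0 (k := k) (p := p)).tensor ((hasCoords_balanced _ _).shift _)).shift 1)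
    (Equiv.punitProd _).symm (fun _ => 1) (fun _ => one_ne_zero) ?_ ?_
  · intro s
    simp only [Equiv.punitProd_symm_apply]
    ring
  · intro s s'
    simp

end Evaluation

end PComplex

/-! ### Maps and tensor products against one-dimensional modules -/

namespace SquareData

set_option linter.unusedSectionVars false

variable {k : Type u} [Field k] {p : ℕ} [hp : Fact p.Prime] [CharP k p] {A : Type u} [Ring A]
  [Algebra k A] {𝔸 : PDGAlgebra k p A} (X : SquareData 𝔸) {ε : A →ₐ[k] k}

/-- The bottom and top cells. -/
def ends (p : ℕ) : Unit ⊕ Unit → Cell p := Sum.elim .inl fun u => .inr (.inr (.inr u))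

/-- The cells of the first string. -/
def leftCell (p : ℕ) [hp : Fact p.Prime] (s : Fin (p - 2 + 1)) : Cell p :=
  .inr (.inl ⟨s.val, by have := two_le p; omega⟩)

/-- The cells of the second string. -/
def rightCell (p : ℕ) [hp : Fact p.Prime] (s : Fin (p - 2 + 1)) : Cell p :=
  .inr (.inr (.inl ⟨s.val, by have := two_le p; omega⟩))

theorem ends_injective (p : ℕ) : Function.Injective (ends p) := by
  rintro (_ | _) (_ | _) h
  all_goals first | rfl | (simp [ends] at h)

theorem leftCell_injective (p : ℕ) [hp : Fact p.Prime] : Function.Injective (leftCell p) := by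
  intro s s' h
  simp only [leftCell, Sum.inr.injEq, Sum.inl.injEq, Fin.mk.injEq] at h
  exact Fin.ext h

theorem rightCell_injective (p : ℕ) [hp : Fact p.Prime] : Function.Injective (rightCell p) := by
  intro s s' h
  simp only [rightCell, Sum.inr.injEq, Sum.inl.injEq, Fin.mk.injEq] at h
  exact Fin.ext h

theorem map_idem_ends (h0 : ε X.e = 1) (ha : ε X.ea = 0) (hb : ε X.eb = 0) :
    (∀ i, ε (X.cells.idem (ends p i)) = 1) ∧
      ∀ t, t ∉ Set.range (ends p) → ε (X.cells.idem t) = 0 := by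
  constructor
  · rintro (_ | _) <;> exact h0
  · rintro (_ | t | t | _) ht
    · exact absurd ⟨.inl (), rfl⟩ ht
    · exact ha
    · exact hb
    · exact absurd ⟨.inr (), rfl⟩ ht

theorem map_idem_leftCell (h0 : ε X.e = 0) (ha : ε X.ea = 1) (hb : ε X.eb = 0) :
    (∀ i, ε (X.cells.idem (leftCell p i)) = 1) ∧
      ∀ t, t ∉ Set.range (leftCell p) → ε (X.cells.idem t) = 0 := by
  have h2 := two_le p
  constructor
  · intro i
    exact ha
  · rintro (_ | t | t | _) ht
    · exact h0
    · exact absurd ⟨⟨t.val, by omega⟩, rfl⟩ ht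
    · exact hb
    · exact h0

theorem map_idem_rightCell (h0 : ε X.e = 0) (ha : ε X.ea = 0) (hb : ε X.eb = 1) :
    (∀ i, ε (X.cells.idem (rightCell p i)) = 1) ∧
      ∀ t, t ∉ Set.range (rightCell p) → ε (X.cells.idem t) = 0 := by
  have h2 := two_le p
  constructor
  · intro i
    exact hb
  · rintro (_ | t | t | _) ht
    · exact h0
    · exact ha
    · exact absurd ⟨⟨t.val, by omega⟩, rfl⟩ ht
    · exact h0

theorem map_idem_empty (h0 : ε X.e = 0) (ha : ε X.ea = 0) (hb : ε X.eb = 0) (t : Cell p) :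
    ε (X.cells.idem t) = 0 := by
  rcases t with _ | t | t | _
  exacts [h0, ha, hb, h0]

/-- No matrix entry joins the bottom and top cells directly, so the two surviving classes for `j =
i` have zero differential. -/
theorem map_mat_ends (i i' : Unit ⊕ Unit) : ε (X.cells.mat (ends p i) (ends p i')) = 0 := by
  rcases i with _ | _ <;> rcases i' with _ | _ <;> exact map_zero ε

theorem map_mat_leftCell (ha : ε X.ea = 1) (s s' : Fin (p - 2 + 1)) :
    ε (X.cells.mat (leftCell p s) (leftCell p s')) = if s.val + 1 = s'.val then 1 else 0 := by
  change ε (if s.val + 1 = s'.val then X.ea else 0) = _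
  split_ifs
  · exact ha
  · exact map_zero ε

theorem map_mat_rightCell (hb : ε X.eb = 1) (s s' : Fin (p - 2 + 1)) :
    ε (X.cells.mat (rightCell p s) (rightCell p s')) = if s.val + 1 = s'.val then 1 else 0 := by
  change ε (if s.val + 1 = s'.val then X.eb else 0) = _
  split_ifs
  · exact hb
  · exact map_zero ε

open PDGModule PComplex

theorem elim_zero (i : Unit ⊕ Unit) :
    (Sum.elim (fun i => Sum.elim ((0 : Unit → Unit → k) i) 0)
      (fun i => Sum.elim 0 ((0 : Unit → Unit → k) i)) : Unit ⊕ Unit → Unit ⊕ Unit → k) i = 0 := by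
  funext i'
  rcases i with _ | _ <;> rcases i' with _ | _ <;> rfl

section HOM

variable {N : PDGModule 𝔸}

/-- The dual of a string runs backwards with sign `-1` at each step; reversing the order and
rescaling by `(-1)^s` brings it to standard form. -/
theorem _root_.PComplex.HasCoords.homotopyEquivalent_dual_string {C : PComplex k p}
    {deg : Fin (p - 2 + 1) → ℤ} {m : Fin (p - 2 + 1) → Fin (p - 2 + 1) → k} (hC : HasCoords C deg m)
    (hdeg : ∀ s, deg s = -(2 * (s.val : ℤ) + 3 - 2 * p))
    (hm : ∀ s s', m s s' = -if s'.val + 1 = s.val then 1 else 0) :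
    C.HomotopyEquivalent ((Vp2 k p).shift ((p : ℤ) - 1)) := by
  have h2 := two_le p
  refine hC.homotopyEquivalent
    ((hasCoords_balanced _ _).shift _) Fin.revPerm (fun s => (-1) ^ s.val)
    (fun s => pow_ne_zero _ (neg_ne_zero.2 one_ne_zero)) ?_ ?_
  · intro s
    rw [hdeg, Fin.revPerm_apply, Fin.val_rev]
    omega
  · intro s s'
    rw [hm, Fin.revPerm_apply, Fin.revPerm_apply, Fin.val_rev, Fin.val_rev]
    by_cases h : s'.val + 1 = s.val
    · rw [if_pos (by omega), if_pos h, ← h, pow_succ]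
      ring
    · rw [if_neg (by omega), if_neg h]
      ring

/-- The dual classes of the bottom and top cells sit in degrees `0` and `2p - 2`. -/
theorem HOM_of_map_e (c : N.ActsBy fun a => ε a)
    (h0 : ε X.e = 1) (ha : ε X.ea = 0) (hb : ε X.eb = 0) :
    (HOM X.resolution N).HomotopyEquivalent
      ((V0 k p).directSum ((V0 k p).shift (2 * (p : ℤ) - 2))) := by
  obtain ⟨h1, h2⟩ := X.map_idem_ends h0 ha hb
  refine (X.cells.hasCoords_HOM _ c (ends_injective p) h1 h2).homotopyEquivalent
    (hasCoords_V0.directSum (hasCoords_V0_shift _)) (Equiv.refl _) (fun _ => 1)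
    (fun _ => one_ne_zero) ?_ ?_
  · rintro (_ | _)
    · rfl
    · change 2 * (p : ℤ) - 2 = -(2 - 2 * (p : ℤ))
      ring
  · intro i i'
    rw [map_mat_ends, elim_zero]
    simp

theorem HOM_of_map_ea (c : N.ActsBy fun a => ε a)
    (h0 : ε X.e = 0) (ha : ε X.ea = 1) (hb : ε X.eb = 0) :
    (HOM X.resolution N).HomotopyEquivalent ((Vp2 k p).shift ((p : ℤ) - 1)) := by
  obtain ⟨h1, h2⟩ := X.map_idem_leftCell h0 ha hb
  exact (X.cells.hasCoords_HOM _ c (leftCell_injective p) h1 h2).homotopyEquivalent_dual_string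
    (fun _ => rfl) fun s s' => by rw [map_mat_leftCell X ha]

theorem HOM_of_map_eb (c : N.ActsBy fun a => ε a)
    (h0 : ε X.e = 0) (ha : ε X.ea = 0) (hb : ε X.eb = 1) :
    (HOM X.resolution N).HomotopyEquivalent ((Vp2 k p).shift ((p : ℤ) - 1)) := by
  obtain ⟨h1, h2⟩ := X.map_idem_rightCell h0 ha hb
  exact (X.cells.hasCoords_HOM _ c (rightCell_injective p) h1 h2).homotopyEquivalent_dual_string
    (fun _ => rfl) fun s s' => by rw [map_mat_rightCell X hb]

theorem HOM_of_map_eq_zero (c : N.ActsBy fun a => ε a)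
    (h0 : ε X.e = 0) (ha : ε X.ea = 0) (hb : ε X.eb = 0) :
    (HOM X.resolution N).HomotopyEquivalent (zero k p) := by
  -- No cell survives, so the complex has an empty basis.
  refine (X.cells.hasCoords_HOM _ c (σ := Empty.elim) (fun i => i.elim) (fun i => i.elim)
    fun t _ => X.map_idem_empty h0 ha hb t).homotopyEquivalent (hasCoords_zero k p) (Equiv.refl _)
    (fun _ => 1) (fun _ => one_ne_zero) (fun i => i.elim) (fun i => i.elim)

end HOM

section Tensor

variable {N : PDGModule 𝔸.op}

theorem _root_.PComplex.HasCoords.homotopyEquivalent_string {C : PComplex k p}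
    {deg : Fin (p - 2 + 1) → ℤ} {m : Fin (p - 2 + 1) → Fin (p - 2 + 1) → k} (hC : HasCoords C deg m)
    (hdeg : ∀ s, deg s = 2 * (s.val : ℤ) + 3 - 2 * p)
    (hm : ∀ s s', m s s' = if s.val + 1 = s'.val then 1 else 0) :
    C.HomotopyEquivalent ((Vp2 k p).shift (1 - (p : ℤ))) := by
  have h2 := two_le p
  refine hC.homotopyEquivalent ((hasCoords_balanced _ _).shift _) (Equiv.refl _) (fun _ => 1)
    (fun _ => one_ne_zero) ?_ ?_
  · intro s
    rw [hdeg, Equiv.refl_apply]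
    omega
  · intro s s'
    rw [hm, Equiv.refl_apply, Equiv.refl_apply]

theorem tensor_of_map_e (c : N.ActsBy fun a => ε a.unop)
    (h0 : ε X.e = 1) (ha : ε X.ea = 0) (hb : ε X.eb = 0) :
    (PDGModule.tensor N X.resolution).HomotopyEquivalent
      (((V0 k p).shift (2 - 2 * (p : ℤ))).directSum (V0 k p)) := by
  obtain ⟨h1, h2⟩ := X.map_idem_ends h0 ha hb
  refine (X.cells.hasCoords_tensor _ c (ends_injective p) h1 h2).homotopyEquivalent
    ((hasCoords_V0_shift _).directSum hasCoords_V0) (Equiv.sumComm _ _) (fun _ => 1)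
    (fun _ => one_ne_zero) ?_ ?_
  · rintro (_ | _) <;> rfl
  · intro i i'
    rw [map_mat_ends, elim_zero]
    simp

theorem tensor_of_map_ea (c : N.ActsBy fun a => ε a.unop)
    (h0 : ε X.e = 0) (ha : ε X.ea = 1) (hb : ε X.eb = 0) :
    (PDGModule.tensor N X.resolution).HomotopyEquivalent ((Vp2 k p).shift (1 - (p : ℤ))) := by
  obtain ⟨h1, h2⟩ := X.map_idem_leftCell h0 ha hb
  exact (X.cells.hasCoords_tensor _ c (leftCell_injective p) h1 h2).homotopyEquivalent_string
    (fun _ => rfl) fun s s' => by rw [map_mat_leftCell X ha]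

theorem tensor_of_map_eb (c : N.ActsBy fun a => ε a.unop)
    (h0 : ε X.e = 0) (ha : ε X.ea = 0) (hb : ε X.eb = 1) :
    (PDGModule.tensor N X.resolution).HomotopyEquivalent ((Vp2 k p).shift (1 - (p : ℤ))) := by
  obtain ⟨h1, h2⟩ := X.map_idem_rightCell h0 ha hb
  exact (X.cells.hasCoords_tensor _ c (rightCell_injective p) h1 h2).homotopyEquivalent_string
    (fun _ => rfl) fun s s' => by rw [map_mat_rightCell X hb]

theorem tensor_of_map_eq_zero (c : N.ActsBy fun a => ε a.unop)
    (h0 : ε X.e = 0) (ha : ε X.ea = 0) (hb : ε X.eb = 0) :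
    (PDGModule.tensor N X.resolution).HomotopyEquivalent (zero k p) := by
  refine (X.cells.hasCoords_tensor _ c (σ := Empty.elim) (fun i => i.elim) (fun i => i.elim)
    fun t _ => X.map_idem_empty h0 ha hb t).homotopyEquivalent (hasCoords_zero k p) (Equiv.refl _)
    (fun _ => 1) (fun _ => one_ne_zero) (fun i => i.elim) (fun i => i.elim)

end Tensor

end SquareData

/-! ## A basis of the zigzag algebra -/

namespace Zigzag

variable (k : Type u) [Field k] (n : ℕ)

/-- The idempotent of the vertex `m`, with the vertices numbered from `1` to `n`. -/
noncomputable def E : ℕ → Alg k n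
  | 0 => 0
  | m + 1 => if h : m < n then e k ⟨m, h⟩ else 0

/-- The arrow `(m|m+1)`, with the vertices numbered from `1` to `n`. -/
noncomputable def up : ℕ → Alg k n
  | 0 => 0
  | m + 1 => if h : m + 1 < n then arr k ⟨m, by omega⟩ ⟨m + 1, h⟩ (.inl rfl) else 0

/-- The arrow `(m+1|m)`, with the vertices numbered from `1` to `n`. -/
noncomputable def dn : ℕ → Alg k n
  | 0 => 0
  | m + 1 => if h : m + 1 < n then arr k ⟨m + 1, h⟩ ⟨m, by omega⟩ (.inr rfl) else 0

variable {k n}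

theorem E_succ (i : Fin n) : E k n (i.val + 1) = e k i := dif_pos i.isLt

theorem up_succ {i j : Fin n} (h : i.val + 1 = j.val) : up k n (i.val + 1) = arr k i j (.inl h) := by
  obtain ⟨j, hj⟩ := j
  simp only at h
  subst h
  exact dif_pos hj

theorem dn_succ {i j : Fin n} (h : j.val + 1 = i.val) : dn k n (j.val + 1) = arr k i j (.inr h) := by
  obtain ⟨i, hi⟩ := i
  simp only at h
  subst h
  exact dif_pos hi

variable (k n)

theorem E_mul_E (m : ℕ) : E k n m * E k n m = E k n m := by
  rcases m with _ | m
  · exact mul_zero _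
  · simp only [E]
    split_ifs
    · exact e_mul_self k _
    · exact mul_zero _

theorem E_mul_E_of_ne {m m' : ℕ} (h : m ≠ m') : E k n m * E k n m' = 0 := by
  rcases m with _ | m
  · exact zero_mul _
  rcases m' with _ | m'
  · exact mul_zero _
  simp only [E]
  split_ifs
  · exact e_mul_ne k _ _ fun e => h (congrArg (· + 1) (Fin.mk.inj e))
  all_goals simp

theorem E_mul_up (m : ℕ) : E k n m * up k n m = up k n m := by
  rcases m with _ | m
  · exact mul_zero _
  · simp only [E, up]
    split_ifs with h1 h2 h2
    · exact e_mul_arr k _ _ _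
    · exact mul_zero _
    · omega
    · exact mul_zero _

theorem up_mul_E (m : ℕ) : up k n m * E k n (m + 1) = up k n m := by
  rcases m with _ | m
  · exact zero_mul _
  · simp only [E, up]
    split_ifs with h1
    · exact arr_mul_e k _ _ _
    · exact zero_mul _

theorem E_mul_dn (m : ℕ) : E k n (m + 1) * dn k n m = dn k n m := by
  rcases m with _ | m
  · exact mul_zero _
  · simp only [E, dn]
    split_ifs with h1
    · exact e_mul_arr k _ _ _
    · exact mul_zero _

theorem dn_mul_E (m : ℕ) : dn k n m * E k n m = dn k n m := by
  rcases m with _ | m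
  · exact mul_zero _
  · simp only [E, dn]
    split_ifs with h1 h2 h2
    · exact arr_mul_e k _ _ _
    · omega
    · exact zero_mul _
    · exact zero_mul _

/-- Both families of relations at once: with the convention that arrows at the nonexistent vertex
`0` are zero, `(1|2|1) = 0` is the case `m = 0` of the loop relation. -/
theorem up_mul_dn {m : ℕ} (h : m + 2 ≤ n) :
    up k n (m + 1) * dn k n (m + 1) = dn k n m * up k n m := by
  rcases m with _ | m
  · simp only [up, dn]
    rw [dif_pos (by omega), dif_pos (by omega), mul_zero]
    exact arr_first k _ _ rfl rfl
  · simp only [up, dn]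
    rw [dif_pos (by omega), dif_pos (by omega), dif_pos (by omega), dif_pos (by omega)]
    exact (arr_loop k ⟨m, by omega⟩ ⟨m + 1, by omega⟩ ⟨m + 2, by omega⟩ rfl rfl).symm

/-- The path from `l` up to `l + t`. -/
noncomputable def upPath (l : ℕ) : ℕ → Alg k n
  | 0 => E k n l
  | t + 1 => upPath l t * up k n (l + t)

/-- The path from `l + t` down to `l`. -/
noncomputable def dnPath (l : ℕ) : ℕ → Alg k n
  | 0 => E k n l
  | t + 1 => dn k n (l + t) * dnPath l t

/-- The path from `j` down to `l` and then up to `m`. -/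
noncomputable def path (j l m : ℕ) : Alg k n :=
  if l ≤ m then dnPath k n l (j - l) * upPath k n l (m - l) else 0

theorem upPath_mul_E (l t : ℕ) : upPath k n l t * E k n (l + t) = upPath k n l t := by
  rcases t with _ | t
  · exact E_mul_E k n l
  · rw [upPath, mul_assoc, ← add_assoc, up_mul_E]

/-- A down arrow is moved to the left through an ascending path, one loop relation at a time,
lowering the whole path by one. This is the rewriting step that brings every path to the form
descend-then-ascend. -/
theorem upPath_mul_dn (l t : ℕ) (h : l + t + 1 ≤ n) :
    upPath k n (l + 1) t * dn k n (l + t) = dn k n l * upPath k n l t := by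
  induction t with
  | zero => exact (E_mul_dn k n l).trans (dn_mul_E k n l).symm
  | succ t ih =>
    rw [upPath, upPath, ← mul_assoc, ← ih (by omega), mul_assoc, mul_assoc,
      ← up_mul_dn k n (m := l + t) (by omega), show l + 1 + t = l + t + 1 by omega,
      show l + (t + 1) = l + t + 1 by omega]

/-- Descending paths are built by multiplication on the left; this appends an arrow on the right. -/
theorem dnPath_mul_dn (l t : ℕ) : dnPath k n (l + 1) t * dn k n l = dnPath k n l (t + 1) := by
  induction t with
  | zero => exact (E_mul_dn k n l).trans (dn_mul_E k n l).symm
  | succ t ih =>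
    rw [dnPath, mul_assoc, ih, dnPath, dnPath, dnPath, show l + 1 + t = l + (t + 1) by omega]

theorem path_self (j : ℕ) : path k n j j j = E k n j := by
  rw [path, if_pos le_rfl, Nat.sub_self]
  exact E_mul_E k n j

/-- A path through the nonexistent vertex `0` vanishes, which encodes `(1|2|1) = 0` in the
multiplication rule `path_mul_dn`. -/
theorem path_zero (j m : ℕ) : path k n j 0 m = 0 := by
  have : ∀ t, upPath k n 0 t = 0 := by
    intro t
    induction t with
    | zero => rfl
    | succ t ih => rw [upPath, ih, zero_mul]
  rw [path, this, mul_zero, ite_self]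

theorem path_mul_E (j l m : ℕ) : path k n j l m * E k n m = path k n j l m := by
  rw [path]
  split_ifs with h
  · have := upPath_mul_E k n l (m - l)
    rw [Nat.add_sub_cancel' h] at this
    rw [mul_assoc, this]
  · exact zero_mul _

theorem path_mul_E_of_ne (j l : ℕ) {m m' : ℕ} (h : m ≠ m') : path k n j l m * E k n m' = 0 := by
  rw [← path_mul_E, mul_assoc, E_mul_E_of_ne k n h, mul_zero]

theorem path_mul_up (j : ℕ) {l m : ℕ} (h : l ≤ m) :
    path k n j l m * up k n m = path k n j l (m + 1) := by
  rw [path, path, if_pos h, if_pos (by omega), Nat.succ_sub h, upPath, Nat.add_sub_cancel' h,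
    mul_assoc]

theorem path_mul_dn {j l m : ℕ} (h : l + 1 ≤ j) (hm : m + 1 ≤ n) :
    path k n j (l + 1) (m + 1) * dn k n m = path k n j l m := by
  rw [path, path]
  by_cases hl : l ≤ m
  · rw [if_pos (by omega), if_pos hl, Nat.add_sub_add_right, mul_assoc]
    have := upPath_mul_dn k n l (m - l) (by omega)
    rw [Nat.add_sub_cancel' hl] at this
    rw [this, ← mul_assoc, dnPath_mul_dn, show j - (l + 1) + 1 = j - l by omega]
  · rw [if_neg (by omega), if_neg hl, zero_mul]

variable {k n} in
/-- The right action of a generator on the vector space with basis the pairs `(i, l)`; the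
subspace of vectors supported on `l ≤ min i j` is `(j) A_n^!`, where `(i, l)` corresponds to the
path from `j` to `i` via `l`. -/
def genAct : Gen n → Module.End k (Fin n → ℕ → k)
  | .vertex m =>
    { toFun := fun c i l => if i = m then c i l else 0
      map_add' := fun c c' => by
        funext i l
        simp only [Pi.add_apply]
        split_ifs <;> simp
      map_smul' := fun a c => by
        funext i l
        simp only [Pi.smul_apply, RingHom.id_apply]
        split_ifs <;> simp }
  | .arrow i j _ =>
    -- An up arrow keeps the lowest vertex, and entries with `l > i`, which correspond to no path,
    -- are discarded. A down arrow lowers the turning point by one. The truncation makes both loop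
    -- relations hold on the whole space.
    { toFun := fun c i' l => if i' = j then
        (if i.val + 1 = j.val then (if l ≤ i.val then c i l else 0) else c i (l + 1)) else 0
      map_add' := fun c c' => by
        funext i l
        simp only [Pi.add_apply]
        split_ifs <;> simp
      map_smul' := fun a c => by
        funext i l
        simp only [Pi.smul_apply, RingHom.id_apply]
        split_ifs <;> simp }

/-- The right action of `A_n^!`. -/
noncomputable def rep : Alg k n →ₐ[k] (Module.End k (Fin n → ℕ → k))ᵐᵒᵖ :=
  lift (fun g => MulOpposite.op (genAct g)) (by
    intro x y h
    induction h with
    | vertex_sq i =>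
      simp only [map_mul, FreeAlgebra.lift_ι_apply, ← MulOpposite.op_mul]
      refine congrArg MulOpposite.op (LinearMap.ext fun c => funext fun i' => funext fun l => ?_)
      simp only [genAct, Module.End.mul_apply, LinearMap.coe_mk, AddHom.coe_mk]
      split_ifs <;> rfl
    | vertex_ne i j h =>
      simp only [map_mul, FreeAlgebra.lift_ι_apply, ← MulOpposite.op_mul, map_zero]
      refine congrArg MulOpposite.op (LinearMap.ext fun c => funext fun i' => funext fun l => ?_)
      simp only [genAct, Module.End.mul_apply, LinearMap.coe_mk, AddHom.coe_mk]
      split_ifs with h1 h2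
      · exact absurd (h2.symm.trans h1) h
      all_goals rfl
    | vertex_sum =>
      simp only [map_sum, FreeAlgebra.lift_ι_apply, map_one]
      rw [← Finset.op_sum, ← MulOpposite.op_one]
      refine congrArg MulOpposite.op (LinearMap.ext fun c => funext fun i' => funext fun l => ?_)
      rw [LinearMap.sum_apply, Finset.sum_apply, Finset.sum_apply]
      simp [genAct]
    | source i j h =>
      simp only [map_mul, FreeAlgebra.lift_ι_apply, ← MulOpposite.op_mul]
      refine congrArg MulOpposite.op (LinearMap.ext fun c => funext fun i' => funext fun l => ?_)
      simp [genAct]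
    | target i j h =>
      simp only [map_mul, FreeAlgebra.lift_ι_apply, ← MulOpposite.op_mul]
      refine congrArg MulOpposite.op (LinearMap.ext fun c => funext fun i' => funext fun l => ?_)
      simp only [genAct, Module.End.mul_apply, LinearMap.coe_mk, AddHom.coe_mk]
      split_ifs <;> rfl
    | loop h i j hi hj =>
      simp only [map_mul, FreeAlgebra.lift_ι_apply, ← MulOpposite.op_mul]
      refine congrArg MulOpposite.op (LinearMap.ext fun c => funext fun i' => funext fun l => ?_)
      simp only [genAct, Module.End.mul_apply, LinearMap.coe_mk, AddHom.coe_mk, if_true]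
      rw [if_pos hi, if_neg (show ¬ i.val + 1 = h.val by omega), if_pos hj,
        if_neg (show ¬ j.val + 1 = i.val by omega)]
      split_ifs <;> first | rfl | omega
    | first i j hi hj =>
      simp only [map_mul, FreeAlgebra.lift_ι_apply, ← MulOpposite.op_mul, map_zero]
      refine congrArg MulOpposite.op (LinearMap.ext fun c => funext fun i' => funext fun l => ?_)
      simp only [genAct, Module.End.mul_apply, LinearMap.coe_mk, AddHom.coe_mk, if_true]
      split_ifs <;> first | rfl | omega)

variable {k n}

/-- The right action of `A_n^!`. -/
noncomputable def act (c : Fin n → ℕ → k) (a : Alg k n) : Fin n → ℕ → k := (rep k n a).unop c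

theorem act_mul (c : Fin n → ℕ → k) (a b : Alg k n) : act c (a * b) = act (act c a) b := by
  rw [act, map_mul]
  rfl

theorem act_add (c : Fin n → ℕ → k) (a b : Alg k n) : act c (a + b) = act c a + act c b := by
  rw [act, map_add]
  rfl

theorem act_zero (c : Fin n → ℕ → k) : act c (0 : Alg k n) = 0 := by
  rw [act, map_zero]
  rfl

theorem act_gen (c : Fin n → ℕ → k) (g : Gen n) : act c (gen k g) = genAct g c := by
  rw [act, rep, lift_gen]
  rfl

theorem act_e (c : Fin n → ℕ → k) (m i : Fin n) (l : ℕ) :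
    act c (e k m) i l = if i = m then c i l else 0 := by
  rw [e, act_gen]
  rfl

theorem act_arr_up (c : Fin n → ℕ → k) {i j : Fin n} (h : i.val + 1 = j.val) (i' : Fin n) (l : ℕ) :
    act c (arr k i j (.inl h)) i' l = if i' = j then if l ≤ i.val then c i l else 0 else 0 := by
  rw [arr, act_gen]
  simp [genAct, h]

theorem act_arr_dn (c : Fin n → ℕ → k) {i j : Fin n} (h : j.val + 1 = i.val) (i' : Fin n) (l : ℕ) :
    act c (arr k i j (.inr h)) i' l = if i' = j then c i (l + 1) else 0 := by
  rw [arr, act_gen]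
  have : ¬ i.val + 1 = j.val := by omega
  simp [genAct, this]

/-- The linear combination of paths starting at `j`. -/
noncomputable def combo (j : Fin n) (c : Fin n → ℕ → k) : Alg k n :=
  ∑ i : Fin n, ∑ l ∈ Finset.range n, c i l • path k n (j.val + 1) (l + 1) (i.val + 1)

/-- Sending a vector to the corresponding combination of paths intertwines the formal action with
right multiplication. It is enough to check generators, where the rules `path_mul_E`, `path_mul_up`
and `path_mul_dn` match `genAct`; the support condition `l ≤ j` travels along because `path_mul_dn`
requires it. -/
theorem combo_act (j : Fin n) (a : Alg k n) : ∀ c : Fin n → ℕ → k, (∀ i l, j.val < l → c i l = 0) →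
    (∀ i l, j.val < l → act c a i l = 0) ∧ combo j (act c a) = combo j c * a := by
  refine alg_induction (P := fun a => ∀ c : Fin n → ℕ → k, (∀ i l, j.val < l → c i l = 0) →
    (∀ i l, j.val < l → act c a i l = 0) ∧ combo j (act c a) = combo j c * a) ?_ ?_ ?_ ?_ a
  · intro r c hc
    have : act c (algebraMap k (Alg k n) r) = r • c := by
      rw [act, AlgHom.commutes]
      rfl
    rw [this]
    refine ⟨fun i l h => ?_, ?_⟩
    · rw [Pi.smul_apply, Pi.smul_apply, hc i l h, smul_zero]
    · rw [Algebra.algebraMap_eq_smul_one, mul_smul_comm, mul_one, combo, combo]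
      simp only [Finset.smul_sum, smul_smul]
      rfl
  · rintro (m | ⟨i, i', h⟩) c hc
    · refine ⟨fun i l h => ?_, ?_⟩
      · refine (act_e c m i l).trans ?_
        rw [hc i l h, ite_self]
      · rw [combo, combo, Finset.sum_mul]
        refine Finset.sum_congr rfl fun i _ => ?_
        rw [Finset.sum_mul]
        refine Finset.sum_congr rfl fun l _ => ?_
        refine (congrArg (· • _) (act_e c m i l)).trans ?_
        change _ = c i l • _ * e k m
        rw [smul_mul_assoc, ← E_succ]
        split_ifs with him
        · rw [him, path_mul_E]
        · rw [path_mul_E_of_ne k n _ _ fun e => him (Fin.ext (Nat.succ.inj e)), zero_smul, smul_zero]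
    · rcases h with h | h
      · refine ⟨fun t l hl => ?_, ?_⟩
        · refine (act_arr_up c h t l).trans ?_
          rw [hc i l hl, ite_self, ite_self]
        · rw [combo, combo, Finset.sum_mul, Finset.sum_eq_single i', Finset.sum_eq_single i]
          · rw [Finset.sum_mul]
            refine Finset.sum_congr rfl fun l _ => ?_
            refine (congrArg (· • _) (act_arr_up c h i' l)).trans ?_
            change _ = c i l • _ * arr k i i' _
            rw [if_pos rfl, smul_mul_assoc, ← up_succ h]
            split_ifs with hl
            · rw [path_mul_up k n _ (by omega), h]
            · have hz : path k n (j.val + 1) (l + 1) (i.val + 1) = 0 :=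
                if_neg fun hle => hl (Nat.le_of_succ_le_succ hle)
              rw [hz, zero_mul, zero_smul, smul_zero]
          · intro t _ ht
            change _ * arr k i i' _ = 0
            rw [Finset.sum_mul]
            refine Finset.sum_eq_zero fun l _ => ?_
            rw [smul_mul_assoc, ← up_succ h, ← E_mul_up, ← mul_assoc, path_mul_E_of_ne k n _ _
              fun e => ht (Fin.ext (Nat.succ.inj e)), zero_mul, smul_zero]
          · simp
          · intro t _ ht
            refine Finset.sum_eq_zero fun l _ => ?_
            refine (congrArg (· • _) (act_arr_up c h t l)).trans ?_
            rw [if_neg ht, zero_smul]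
          · simp
      · refine ⟨fun t l hl => ?_, ?_⟩
        · refine (act_arr_dn c h t l).trans ?_
          rw [hc i (l + 1) (by omega), ite_self]
        · rw [combo, combo, Finset.sum_mul, Finset.sum_eq_single i', Finset.sum_eq_single i]
          · rw [Finset.sum_mul]
            -- A down arrow shifts the index `l`, so the last term is split off on one side and the
            -- first on the other. The former vanishes by the support condition, the latter because
            -- it is a path through vertex `0`.
            have hn : n - 1 + 1 = n := by omega
            have key : ∀ f : ℕ → Alg k n, ∑ l ∈ Finset.range n, f l =
                ∑ l ∈ Finset.range (n - 1), f l + f (n - 1) := fun f => by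
              rw [← Finset.sum_range_succ, hn]
            have key' : ∀ f : ℕ → Alg k n, ∑ l ∈ Finset.range n, f l =
                ∑ l ∈ Finset.range (n - 1), f (l + 1) + f 0 := fun f => by
              rw [← Finset.sum_range_succ' f, hn]
            rw [key, key']
            refine congrArg₂ (· + ·) (Finset.sum_congr rfl fun l hl => ?_) ?_
            · refine (congrArg (· • _) (act_arr_dn c h i' l)).trans ?_
              change _ = c i (l + 1) • _ * arr k i i' _
              rw [if_pos rfl, smul_mul_assoc, ← dn_succ h, ← h]
              by_cases hj : l + 1 ≤ j.val
              · rw [path_mul_dn k n (by omega) (by omega)]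
              · rw [hc i (l + 1) (by omega), zero_smul, zero_smul]
            · refine (congrArg (· • _) (act_arr_dn c h i' _)).trans ?_
              change _ = c i 0 • _ * arr k i i' _
              rw [hc i _ (by omega), ite_self, zero_smul, smul_mul_assoc, ← dn_succ h, ← h,
                path_mul_dn k n (by omega) (by omega), path_zero, smul_zero]
          · intro t _ ht
            change _ * arr k i i' _ = 0
            rw [Finset.sum_mul]
            refine Finset.sum_eq_zero fun l _ => ?_
            rw [smul_mul_assoc, ← dn_succ h, ← E_mul_dn, ← mul_assoc, path_mul_E_of_ne k n _ _
              fun e => ht (Fin.ext (by omega)), zero_mul, smul_zero]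
          · simp
          · intro t _ ht
            refine Finset.sum_eq_zero fun l _ => ?_
            refine (congrArg (· • _) (act_arr_dn c h t l)).trans ?_
            rw [if_neg ht, zero_smul]
          · simp
  · intro a b ha hb c hc
    refine ⟨fun i l h => ?_, ?_⟩
    · rw [act_add, Pi.add_apply, Pi.add_apply, (ha c hc).1 i l h, (hb c hc).1 i l h, add_zero]
    · rw [act_add, mul_add, ← (ha c hc).2, ← (hb c hc).2, combo, combo, combo,
        ← Finset.sum_add_distrib]
      refine Finset.sum_congr rfl fun i _ => ?_
      rw [← Finset.sum_add_distrib]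
      exact Finset.sum_congr rfl fun l _ => add_smul _ _ _
  · intro a b ha hb c hc
    obtain ⟨h1, h2⟩ := ha c hc
    obtain ⟨h3, h4⟩ := hb _ h1
    rw [act_mul]
    exact ⟨h3, by rw [h4, h2, mul_assoc]⟩

/-- The vector corresponding to the trivial path at `j`. -/
def vac (k : Type u) [Field k] {n : ℕ} (j : Fin n) : Fin n → ℕ → k :=
  fun i l => if i = j ∧ l = j.val then 1 else 0

theorem combo_vac (j : Fin n) : combo j (vac k j) = e k j := by
  rw [combo, Finset.sum_eq_single j, Finset.sum_eq_single j.val]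
  · rw [vac, if_pos ⟨rfl, rfl⟩, one_smul, path_self, E_succ]
  · intro l _ hl
    rw [vac, if_neg fun h => hl h.2, zero_smul]
  · intro h
    exact absurd (Finset.mem_range.2 j.isLt) h
  · intro i _ hi
    refine Finset.sum_eq_zero fun l _ => ?_
    rw [vac, if_neg fun h => hi h.1, zero_smul]
  · simp

theorem combo_act_vac (j : Fin n) (a : Alg k n) : combo j (act (vac k j) a) = e k j * a := by
  rw [(combo_act j a (vac k j) ?_).2, combo_vac]
  intro i l h
  rw [vac, if_neg]
  rintro ⟨-, rfl⟩
  exact lt_irrefl _ h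

/-- An element is recovered from the coordinates `act (vac k j) a`. Those coordinates are computed
by the formal action, so identities in the algebra can be tested on them: this is the form in which
the basis of paths is used. -/
theorem eq_sum_combo (a : Alg k n) : a = ∑ j, combo j (act (vac k j) a) := by
  simp only [combo_act_vac]
  rw [← Finset.sum_mul, sum_e, one_mul]

end Zigzag

set_option linter.unusedSectionVars false

/-! ## One-dimensional simple modules -/

namespace PDGModule

variable {k : Type u} [Field k] {p : ℕ} {A : Type u} [Ring A] [Algebra k A]
  (𝔸 : PDGAlgebra k p A) (e : A) (he : e ∈ 𝔸.gr 0) (hde : 𝔸.d e = 0)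

/-- The generator of `A e`. -/
def principalGen : (principal 𝔸 e he hde).carrier :=
  (⟨e, Submodule.subset_span rfl⟩ : Submodule.span A ({e} : Set (regular 𝔸).carrier))

/-- The generator of `A e / A' A e`. -/
noncomputable def simpleGen : (simple 𝔸 e he hde).carrier :=
  (augSubmodule (principal 𝔸 e he hde)).mkQ (principalGen 𝔸 e he hde)

theorem simpleGen_mem : simpleGen 𝔸 e he hde ∈ (simple 𝔸 e he hde).gr 0 :=
  ⟨principalGen 𝔸 e he hde, he, rfl⟩

theorem d_simpleGen : (simple 𝔸 e he hde).d (simpleGen 𝔸 e he hde) = 0 := by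
  have h : (principal 𝔸 e he hde).d (principalGen 𝔸 e he hde) = 0 := Subtype.ext hde
  refine (congrArg (augSubmodule (principal 𝔸 e he hde)).mkQ h).trans ?_
  exact map_zero _

theorem exists_smul_simpleGen (x : (simple 𝔸 e he hde).carrier) :
    ∃ a : A, a • simpleGen 𝔸 e he hde = x := by
  obtain ⟨⟨x, hx⟩, rfl⟩ := Submodule.mkQ_surjective (augSubmodule (principal 𝔸 e he hde)) x
  obtain ⟨a, rfl⟩ := Submodule.mem_span_singleton.1 hx
  exact ⟨a, rfl⟩

variable {𝔸 e} {ε : A →ₐ[k] k}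

variable {he hde} in
/-- An element of `A e`, regarded as an element of `A`. -/
def principalVal (x : (principal 𝔸 e he hde).carrier) : A :=
  (x : Submodule.span A ({e} : Set (regular 𝔸).carrier)).1

variable {he hde} in
theorem principalVal_smul (a : A) (x : (principal 𝔸 e he hde).carrier) :
    principalVal (a • x) = a * principalVal x := rfl

/-- The element `(a - ε a) e` is represented as `(a e - ε a e)` acting on `e`, hence it lies in `A'
A e`. -/
theorem smul_simpleGen (hee : e * e = e) (hm : ∀ a, a * e - ε a • e ∈ 𝔸.augmentation) (a : A) :
    a • simpleGen 𝔸 e he hde = ε a • simpleGen 𝔸 e he hde := by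
  have h : (a - algebraMap k A (ε a)) • principalGen 𝔸 e he hde ∈
      augSubmodule (principal 𝔸 e he hde) := by
    refine Submodule.subset_span ⟨_, hm a, principalGen 𝔸 e he hde, Subtype.ext ?_⟩
    change (a - algebraMap k A (ε a)) * e = (a * e - ε a • e) * e
    rw [Algebra.smul_def, ← sub_mul, mul_assoc, hee]
  have h2 : (a - algebraMap k A (ε a)) • simpleGen 𝔸 e he hde = 0 :=
    (Submodule.Quotient.mk_eq_zero _).2 h
  rw [sub_smul, sub_eq_zero] at h2
  rw [h2, algebraMap_smul]

/-- The character `ε` vanishes on `A' A e` but not on `e`, so the class of `e` is nonzero. -/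
theorem smul_simpleGen_eq_zero (h1 : ε e = 1) (hε : ∀ a ∈ 𝔸.augmentation, ε a = 0) {c : k}
    (h : c • simpleGen 𝔸 e he hde = 0) : c = 0 := by
  have h2 : algebraMap k A c • principalGen 𝔸 e he hde ∈ augSubmodule (principal 𝔸 e he hde) := by
    exact (Submodule.Quotient.mk_eq_zero _).1
      ((algebraMap_smul (M := (simple 𝔸 e he hde).carrier) A c _).trans h)
  have key : ∀ x ∈ augSubmodule (principal 𝔸 e he hde), ε (principalVal x) = 0 := by
    intro x hx
    refine Submodule.span_induction (p := fun x _ => ε (principalVal x) = 0) ?_ ?_ ?_ ?_ hx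
    · rintro _ ⟨a, ha, x, rfl⟩
      rw [principalVal_smul, map_mul, hε a ha, zero_mul]
    · exact map_zero ε
    · intro x y _ _ hx hy
      exact (map_add ε (principalVal x) (principalVal y)).trans (by rw [hx, hy, add_zero])
    · intro a x _ hx
      rw [principalVal_smul, map_mul, hx, mul_zero]
  have := key _ h2
  rw [principalVal_smul] at this
  change ε (algebraMap k A c * e) = 0 at this
  rwa [map_mul, h1, mul_one, AlgHom.commutes] at this

/-- The module `A e / A' A e` is spanned by the class of `e`. -/
noncomputable def simpleEquiv (hee : e * e = e) (h1 : ε e = 1)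
    (hε : ∀ a ∈ 𝔸.augmentation, ε a = 0) (hm : ∀ a, a * e - ε a • e ∈ 𝔸.augmentation) :
    k ≃ₗ[k] (simple 𝔸 e he hde).carrier :=
  LinearEquiv.ofBijective
    (LinearMap.toSpanSingleton k (simple 𝔸 e he hde).carrier (simpleGen 𝔸 e he hde)) (by
      constructor
      · rw [injective_iff_map_eq_zero]
        intro c hc
        exact smul_simpleGen_eq_zero he hde h1 hε hc
      · intro x
        obtain ⟨a, rfl⟩ := exists_smul_simpleGen 𝔸 e he hde x
        exact ⟨ε a, (smul_simpleGen he hde hee hm a).symm⟩)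

/-- The module `A e / A' A e` is one-dimensional if `e` is a primitive idempotent. -/
noncomputable def simpleActsBy (hee : e * e = e) (h1 : ε e = 1)
    (hε : ∀ a ∈ 𝔸.augmentation, ε a = 0) (hm : ∀ a, a * e - ε a • e ∈ 𝔸.augmentation) :
    (simple 𝔸 e he hde).ActsBy fun a => ε a where
  equiv := (simpleEquiv he hde hee h1 hε hm).symm
  equiv_smul := fun a x => by
    obtain ⟨b, rfl⟩ := exists_smul_simpleGen 𝔸 e he hde x
    have hb : ∀ b, b • simpleGen 𝔸 e he hde = simpleEquiv he hde hee h1 hε hm (ε b) :=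
      smul_simpleGen he hde hee hm
    rw [← mul_smul, hb, hb, LinearEquiv.symm_apply_apply, LinearEquiv.symm_apply_apply, map_mul]
  d_eq := fun x => by
    obtain ⟨a, rfl⟩ := exists_smul_simpleGen 𝔸 e he hde x
    rw [smul_simpleGen he hde hee hm, map_smul, d_simpleGen, smul_zero]
  mem := fun x => by
    obtain ⟨a, rfl⟩ := exists_smul_simpleGen 𝔸 e he hde x
    rw [smul_simpleGen he hde hee hm]
    exact Submodule.smul_mem _ _ (simpleGen_mem 𝔸 e he hde)

end PDGModule

/-! ## Exactness -/

namespace Zigzag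

variable {k : Type u} [Field k] {n : ℕ}

/-- The coordinate of `b` at `(i, l)` with `l ≤ i` reappears unchanged at `(i', l)` after an up
arrow, and for `l > i` there is no path. This gives injectivity of the first map of the resolution.
-/
theorem eq_zero_of_mul_arr_up {i i' : Fin n} (h : i.val + 1 = i'.val) {b : Alg k n}
    (hb : b * e k i = b) (h0 : b * arr k i i' (.inl h) = 0) : b = 0 := by
  rw [eq_sum_combo b]
  refine Finset.sum_eq_zero fun j _ => Finset.sum_eq_zero fun t _ => Finset.sum_eq_zero fun l _ => ?_
  by_cases ht : t = i
  · subst ht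
    by_cases hl : l ≤ t.val
    · have h1 := act_arr_up (act (vac k j) b) h i' l
      rw [← act_mul, h0, act_zero, if_pos rfl, if_pos hl] at h1
      rw [← h1]
      exact zero_smul k _
    · rw [path, if_neg fun hle => hl (Nat.le_of_succ_le_succ hle), smul_zero]
  · rw [← hb, act_mul, act_e, if_neg ht, zero_smul]

theorem eq_zero_of_mul_up {m : ℕ} (hm : m + 1 ≤ n) {b : Alg k n} (hb : b * E k n m = b)
    (h0 : b * up k n m = 0) : b = 0 := by
  rcases m with _ | m
  -- There is no vertex `0`: its idempotent is zero, and so is `b`.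
  · rw [← hb]
    exact mul_zero b
  · have h : (⟨m, by omega⟩ : Fin n).val + 1 = (⟨m + 1, by omega⟩ : Fin n).val := rfl
    exact eq_zero_of_mul_arr_up h (by rwa [← E_succ]) (by rwa [← up_succ h])

/-- A normal-form path ending at `i'` factors through the last up arrow unless its turning point is
`i'` itself; the hypothesis says that such paths do not occur in `w`. -/
theorem exists_mul_arr_up {i i' : Fin n} (h : i.val + 1 = i'.val) {w : Alg k n}
    (hw : w * e k i' = w) (h0 : ∀ j, act (vac k j) w i' i'.val = 0) :
    ∃ b, b * e k i = b ∧ w = b * arr k i i' (.inl h) := by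
  have hmem : w ∈ LinearMap.range (LinearMap.mulRight k (arr k i i' (.inl h))) := by
    rw [eq_sum_combo w]
    refine Submodule.sum_mem _ fun j _ => Submodule.sum_mem _ fun t _ => Submodule.sum_mem _ fun l _ => ?_
    by_cases ht : t = i'
    · subst ht
      rcases lt_trichotomy l t.val with hl | hl | hl
      · refine Submodule.smul_mem _ _ ⟨path k n (j.val + 1) (l + 1) (i.val + 1), ?_⟩
        rw [LinearMap.mulRight_apply, ← up_succ h, path_mul_up k n _ (by omega), h]
      · rw [hl, h0, zero_smul]
        exact zero_mem _
      · rw [path, if_neg (by omega), smul_zero]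
        exact zero_mem _
    · rw [← hw, act_mul, act_e, if_neg ht, zero_smul]
      exact zero_mem _
  obtain ⟨b, hb⟩ := hmem
  refine ⟨b * e k i, by rw [mul_assoc, e_mul_self], ?_⟩
  rw [mul_assoc, e_mul_arr]
  exact hb.symm

/-- A path that ends with an up arrow does not turn at its end point. -/
theorem act_up_self (c : Fin n → ℕ → k) (i : Fin n) : act c (up k n i.val) i i.val = 0 := by
  obtain ⟨i, hi⟩ := i
  rcases i with _ | m
  · exact congrFun (congrFun (act_zero c) _) _
  · have h : (⟨m, by omega⟩ : Fin n).val + 1 = (⟨m + 1, hi⟩ : Fin n).val := rfl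
    change act c (up k n (m + 1)) _ _ = 0
    rw [show up k n (m + 1) = _ from up_succ h, act_arr_up _ h, if_pos rfl, if_neg (by simp)]

/-- Exactness in the middle. The relation first forces `w` to be a multiple of the up arrow, and
injectivity of the other up arrow then determines `u`. -/
theorem exists_eq_mul_of_add_eq_zero {m : ℕ} (hm : m + 2 ≤ n) {u w : Alg k n}
    (hu : u * E k n m = u) (hw : w * E k n (m + 2) = w)
    (h : u * up k n m + w * dn k n (m + 1) = 0) :
    ∃ b, b * E k n (m + 1) = b ∧ u = b * dn k n m ∧ w = -(b * up k n (m + 1)) := by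
  have hi : (⟨m, by omega⟩ : Fin n).val + 1 = (⟨m + 1, by omega⟩ : Fin n).val := rfl
  -- The coordinate at `(m, m)` of the relation: the up term contributes nothing, and the down arrow
  -- carries there the coordinate of `w` at `(m + 1, m + 1)`, which is the one that obstructs
  -- divisibility.
  obtain ⟨b, hb, rfl⟩ := exists_mul_arr_up (w := w) hi (by rwa [← E_succ]) (fun j => by
    have h1 := congrFun (congrFun (congrArg (act (vac k j)) h) ⟨m, by omega⟩) m
    rw [act_zero, act_add, act_mul, act_mul] at h1
    change act _ (up k n m) ⟨m, _⟩ m + act _ (dn k n (m + 1)) ⟨m, _⟩ m = 0 at h1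
    rw [act_up_self _ (⟨m, by omega⟩ : Fin n), zero_add, show dn k n (m + 1) = _ from dn_succ hi,
      act_arr_dn _ hi, if_pos rfl] at h1
    exact h1)
  rw [← up_succ hi] at h ⊢
  change u * up k n m + b * up k n (m + 1) * dn k n (m + 1) = 0 at h
  -- The loop relation at vertex `m + 1` rewrites the hypothesis as `(u + b dn) up = 0`.
  have hu' : u + b * dn k n m = 0 := by
    refine eq_zero_of_mul_up (m := m) (by omega) ?_ ?_
    · rw [add_mul, hu, mul_assoc, dn_mul_E]
    · rw [add_mul, mul_assoc b, ← up_mul_dn k n hm, ← mul_assoc]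
      exact h
  refine ⟨-b, ?_, ?_, ?_⟩
  · rw [neg_mul, neg_inj, show E k n (m + 1) = _ from E_succ ⟨m, by omega⟩]
    exact hb
  · rw [neg_mul]
    exact eq_neg_of_add_eq_zero_left hu'
  · rw [neg_mul, neg_neg]

/-- The algebra map sending the idempotent of the vertex `i` to `1` and the other generators
to `0`. -/
noncomputable def vertexMap (k : Type u) [Field k] {n : ℕ} (i : Fin n) : Alg k n →ₐ[k] k :=
  lift (fun g => match g with
    | .vertex j => if j = i then 1 else 0
    | .arrow _ _ _ => 0) (by
    intro x y h
    induction h with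
    | vertex_sq j => simp
    | vertex_ne j j' h =>
      simp only [map_mul, FreeAlgebra.lift_ι_apply, map_zero]
      split_ifs with h1 h2
      · exact absurd (h1.trans h2.symm) h
      all_goals simp
    | vertex_sum => simp
    | source i j h => simp
    | target i j h => simp
    | loop h i j hi hj => simp
    | first i j hi hj => simp)

theorem vertexMap_e (i j : Fin n) : vertexMap k i (e k j) = if j = i then 1 else 0 :=
  lift_gen _ _ _

theorem vertexMap_arr (i j j' : Fin n) (h : Adj j j') : vertexMap k i (arr k j j' h) = 0 :=
  lift_gen _ _ _

theorem vertexMap_E (i : Fin n) (m : ℕ) : vertexMap k i (E k n m) = if m = i.val + 1 then 1 else 0 := by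
  rcases m with _ | m
  · rw [if_neg (by omega)]
    exact map_zero _
  · simp only [E]
    split_ifs with h1 h2 h2
    · rw [vertexMap_e, if_pos (Fin.ext (Nat.succ.inj h2))]
    · rw [vertexMap_e, if_neg fun h => h2 (by rw [← h])]
    · omega
    · exact map_zero _

/-- The ideal `A'` spanned by the elements of positive degree. -/
noncomputable def positivePart (k : Type u) [Field k] (n : ℕ) : Submodule k (Alg k n) :=
  ⨆ l : {l : ℤ // 0 < l}, gr k n l

theorem gen_mul_mem_positivePart (g : Gen n) {a : Alg k n} (ha : a ∈ positivePart k n) :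
    gen k g * a ∈ positivePart k n ∧ a * gen k g ∈ positivePart k n := by
  have hg : 0 ≤ g.deg := by cases g <;> simp [Gen.deg]
  refine Submodule.iSup_induction _
    (motive := fun a => gen k g * a ∈ positivePart k n ∧ a * gen k g ∈ positivePart k n) ha ?_ ?_ ?_
  · rintro ⟨l, hl⟩ a ha
    exact ⟨Submodule.mem_iSup_of_mem (⟨g.deg + l, by omega⟩ : {l : ℤ // 0 < l})
      (gr_mul (gen_mem_gr g) ha),
      Submodule.mem_iSup_of_mem (⟨l + g.deg, by omega⟩ : {l : ℤ // 0 < l})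
      (gr_mul ha (gen_mem_gr g))⟩
  · rw [mul_zero, zero_mul]
    exact ⟨zero_mem _, zero_mem _⟩
  · intro x y hx hy
    rw [mul_add, add_mul]
    exact ⟨add_mem hx.1 hy.1, add_mem hx.2 hy.2⟩

theorem mul_mem_positivePart (b : Alg k n) : ∀ a ∈ positivePart k n,
    b * a ∈ positivePart k n ∧ a * b ∈ positivePart k n := by
  refine alg_induction (P := fun b => ∀ a ∈ positivePart k n,
    b * a ∈ positivePart k n ∧ a * b ∈ positivePart k n) ?_ ?_ ?_ ?_ b
  · intro c a ha
    rw [← Algebra.commutes, ← Algebra.smul_def]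
    exact ⟨Submodule.smul_mem _ _ ha, Submodule.smul_mem _ _ ha⟩
  · intro g a ha
    exact gen_mul_mem_positivePart g ha
  · intro x y hx hy a ha
    rw [add_mul, mul_add]
    exact ⟨add_mem (hx a ha).1 (hy a ha).1, add_mem (hx a ha).2 (hy a ha).2⟩
  · intro x y hx hy a ha
    have := (hx _ (hy a ha).1).1
    rw [← mul_assoc] at this ⊢
    exact ⟨this, (hy _ (hx a ha).2).2⟩

theorem arr_mem_positivePart (i j : Fin n) (h : Adj i j) : arr k i j h ∈ positivePart k n :=
  Submodule.mem_iSup_of_mem (⟨1, one_pos⟩ : {l : ℤ // 0 < l}) (arr_mem_gr i j h)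

theorem vertexMap_eq_zero_of_mem (i : Fin n) {a : Alg k n} (ha : a ∈ positivePart k n) :
    vertexMap k i a = 0 := by
  refine (iSup_le ?_ : positivePart k n ≤ LinearMap.ker (vertexMap k i).toLinearMap) ha
  rintro ⟨l, hl⟩
  refine Submodule.span_le.2 ?_
  rintro _ ⟨w, rfl, rfl⟩
  change vertexMap k i _ = 0
  induction w with
  | nil => exact absurd hl (lt_irrefl 0)
  | cons g w ih =>
    rw [List.map_cons, List.prod_cons, map_mul]
    rcases g with j | ⟨j, j', h⟩
    · rw [ih (by simpa [Gen.deg] using hl), mul_zero]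
    · exact (congrArg (· * _) (vertexMap_arr i j j' h)).trans (zero_mul _)

theorem mul_e_sub_mem (i : Fin n) (a : Alg k n) :
    a * e k i - vertexMap k i a • e k i ∈ positivePart k n := by
  refine alg_induction (P := fun a => a * e k i - vertexMap k i a • e k i ∈ positivePart k n)
    ?_ ?_ ?_ ?_ a
  · intro c
    rw [AlgHom.commutes, ← Algebra.smul_def]
    change c • _ - c • _ ∈ _
    rw [sub_self]
    exact zero_mem _
  · rintro (j | ⟨j, j', h⟩)
    · change e k j * e k i - vertexMap k i (e k j) • e k i ∈ _
      rw [vertexMap_e]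
      split_ifs with hj
      · rw [hj, e_mul_self, one_smul, sub_self]
        exact zero_mem _
      · rw [e_mul_ne k _ _ hj, zero_smul, sub_self]
        exact zero_mem _
    · change arr k j j' h * e k i - vertexMap k i (arr k j j' h) • e k i ∈ _
      rw [vertexMap_arr, zero_smul, sub_zero]
      exact (mul_mem_positivePart _ _ (arr_mem_positivePart j j' h)).2
  · intro x y hx hy
    rw [map_add, add_smul, add_mul, add_sub_add_comm]
    exact add_mem hx hy
  · intro x y hx hy
    have := add_mem (mul_mem_positivePart x _ hy).1 (Submodule.smul_mem _ (vertexMap k i y) hx)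
    rw [map_mul, mul_comm (vertexMap k i x), mul_smul, mul_assoc]
    rw [mul_sub, smul_sub, mul_smul_comm, sub_add_sub_cancel] at this
    exact this

theorem e_mul_sub_mem (i : Fin n) (a : Alg k n) :
    e k i * a - vertexMap k i a • e k i ∈ positivePart k n := by
  refine alg_induction (P := fun a => e k i * a - vertexMap k i a • e k i ∈ positivePart k n)
    ?_ ?_ ?_ ?_ a
  · intro c
    rw [AlgHom.commutes, ← Algebra.commutes, ← Algebra.smul_def]
    change c • _ - c • _ ∈ _
    rw [sub_self]
    exact zero_mem _
  · rintro (j | ⟨j, j', h⟩)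
    · change e k i * e k j - vertexMap k i (e k j) • e k i ∈ _
      rw [vertexMap_e]
      split_ifs with hj
      · rw [hj, e_mul_self, one_smul, sub_self]
        exact zero_mem _
      · rw [e_mul_ne k _ _ (Ne.symm hj), zero_smul, sub_self]
        exact zero_mem _
    · change e k i * arr k j j' h - vertexMap k i (arr k j j' h) • e k i ∈ _
      rw [vertexMap_arr, zero_smul, sub_zero]
      exact (mul_mem_positivePart _ _ (arr_mem_positivePart j j' h)).1
  · intro x y hx hy
    rw [map_add, add_smul, mul_add, add_sub_add_comm]
    exact add_mem hx hy
  · intro x y hx hy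
    have := add_mem (mul_mem_positivePart y _ hx).2 (Submodule.smul_mem _ (vertexMap k i x) hy)
    rw [map_mul, mul_smul, ← mul_assoc]
    rw [sub_mul, smul_sub, smul_mul_assoc, sub_add_sub_cancel] at this
    exact this

/-- Exactness at the bottom: modulo the two arrows ending at `i`, every element of `P_i` is a
multiple of the idempotent. The property passes to products by expanding the right factor first. -/
theorem exists_mul_e_eq (i : Fin n) (a : Alg k n) : ∃ u w : Alg k n,
    a * e k i = vertexMap k i a • e k i + (u * up k n i.val + w * dn k n (i.val + 1)) := by
  refine alg_induction (P := fun a => ∃ u w : Alg k n,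
    a * e k i = vertexMap k i a • e k i + (u * up k n i.val + w * dn k n (i.val + 1))) ?_ ?_ ?_ ?_ a
  · intro c
    refine ⟨0, 0, ?_⟩
    rw [AlgHom.commutes, ← Algebra.smul_def, zero_mul, zero_mul, add_zero, add_zero]
    rfl
  · rintro (j | ⟨j, j', h⟩)
    · refine ⟨0, 0, ?_⟩
      change e k j * e k i = vertexMap k i (e k j) • _ + _
      rw [vertexMap_e, zero_mul, zero_mul, add_zero, add_zero]
      split_ifs with hj
      · rw [hj, e_mul_self, one_smul]
      · rw [e_mul_ne k _ _ hj, zero_smul]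
    · change ∃ u w, arr k j j' h * e k i = vertexMap k i (arr k j j' h) • _ + _
      rw [vertexMap_arr, zero_smul]
      by_cases hj : j' = i
      · subst hj
        rcases h with h | h
        · refine ⟨1, 0, ?_⟩
          rw [arr_mul_e, ← up_succ h, h, zero_add, zero_mul, add_zero, one_mul]
        · refine ⟨0, 1, ?_⟩
          rw [arr_mul_e, ← dn_succ h, zero_add, zero_mul, zero_add, one_mul]
      · refine ⟨0, 0, ?_⟩
        rw [← arr_mul_e, mul_assoc, e_mul_ne k _ _ hj, mul_zero, zero_mul, zero_mul, add_zero,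
          add_zero]
  · rintro x y ⟨u, w, h⟩ ⟨u', w', h'⟩
    refine ⟨u + u', w + w', ?_⟩
    rw [add_mul, h, h', map_add, add_smul, add_mul, add_mul]
    abel
  · rintro x y ⟨u, w, h⟩ ⟨u', w', h'⟩
    refine ⟨vertexMap k i y • u + x * u', vertexMap k i y • w + x * w', ?_⟩
    rw [mul_assoc, h', mul_add, mul_smul_comm, h, map_mul, mul_add, mul_comm, mul_smul, smul_add,
      smul_add, add_mul, add_mul, smul_mul_assoc, smul_mul_assoc, mul_assoc, mul_assoc]
    abel

end Zigzag

/-! ### The squares for `λ = 0` and `λ = 1`, and the simple modules -/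

namespace Zigzag

variable {k : Type u} [Field k] {n : ℕ}

theorem E_mem_gr (m : ℕ) : E k n m ∈ gr k n 0 := by
  rcases m with _ | m
  · exact zero_mem _
  · simp only [E]
    split_ifs
    · exact e_mem_gr _
    · exact zero_mem _

theorem up_mem_gr (m : ℕ) : up k n m ∈ gr k n 1 := by
  rcases m with _ | m
  · exact zero_mem _
  · simp only [up]
    split_ifs
    · exact arr_mem_gr _ _ _
    · exact zero_mem _

theorem dn_mem_gr (m : ℕ) : dn k n m ∈ gr k n 1 := by
  rcases m with _ | m
  · exact zero_mem _
  · simp only [dn]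
    split_ifs
    · exact arr_mem_gr _ _ _
    · exact zero_mem _

theorem dLin_E (c : k) (m : ℕ) : dLin c (E k n m) = 0 := by
  rcases m with _ | m
  · exact map_zero _
  · simp only [E]
    split_ifs
    · exact dLin_e _ _
    · exact map_zero _

theorem dLin_up (c : k) (m : ℕ) :
    dLin c (up k n m) = c • (up k n m * dn k n m * up k n m) := by
  rcases m with _ | m
  · change dLin c 0 = c • (0 * 0 * 0)
    simp
  · by_cases h : m + 1 < n
    · simp only [up, dn, dif_pos h]
      exact dLin_arr_up _ _ _ rfl
    · simp [up, dif_neg h]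

theorem dLin_dn (c : k) (m : ℕ) :
    dLin c (dn k n m) = (1 - c) • (dn k n m * up k n m * dn k n m) := by
  rcases m with _ | m
  · change dLin c 0 = (1 - c) • (0 * 0 * 0)
    simp
  · by_cases h : m + 1 < n
    · simp only [up, dn, dif_pos h]
      exact dLin_arr_down _ _ _ rfl
    · simp [dn, dif_neg h]

variable {p : ℕ} [Fact p.Prime] [CharP k p]

theorem d_up (lam : ZMod p) (m : ℕ) : (pdg k n lam).d (up k n m) =
    ZMod.castHom (dvd_refl p) k lam • (up k n m * dn k n m * up k n m) := dLin_up _ m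

theorem d_dn (lam : ZMod p) (m : ℕ) : (pdg k n lam).d (dn k n m) =
    (1 - ZMod.castHom (dvd_refl p) k lam) • (dn k n m * up k n m * dn k n m) := dLin_dn _ m

variable (k n p) in
/-- The commutative square at the vertex `m + 1`, for `λ = 0`. -/
noncomputable def squareZero {m : ℕ} (hm : m + 2 ≤ n) : SquareData (pdg k n (0 : ZMod p)) where
  e := E k n (m + 1)
  ea := E k n m
  eb := E k n (m + 2)
  P := dn k n m
  q := up k n m
  r := up k n (m + 1)
  s := dn k n (m + 1)
  e_mem := E_mem_gr _
  ea_mem := E_mem_gr _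
  eb_mem := E_mem_gr _
  P_mem := dn_mem_gr _
  q_mem := up_mem_gr _
  r_mem := up_mem_gr _
  s_mem := dn_mem_gr _
  e_mul_e := E_mul_E k n _
  ea_mul_ea := E_mul_E k n _
  eb_mul_eb := E_mul_E k n _
  e_mul_P := E_mul_dn k n _
  P_mul_ea := dn_mul_E k n _
  ea_mul_q := E_mul_up k n _
  q_mul_e := up_mul_E k n _
  e_mul_r := E_mul_up k n _
  r_mul_eb := up_mul_E k n _
  eb_mul_s := E_mul_dn k n _
  s_mul_e := dn_mul_E k n _
  P_mul_q := (up_mul_dn k n hm).symm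
  d_e := dLin_E _ _
  d_ea := dLin_E _ _
  d_eb := dLin_E _ _
  d_q := by rw [d_up, map_zero, zero_smul]
  d_r := by rw [d_up, map_zero, zero_smul]
  d_P := by rw [d_dn, map_zero, sub_zero, one_smul]
  -- The loop inside `∂s` is `r s`, which is rewritten as `P q`.
  d_s := by rw [d_dn, map_zero, sub_zero, one_smul, ← up_mul_dn k n hm, mul_assoc]

variable (k n p) in
/-- The commutative square at the vertex `m + 1`, for `λ = 1`. -/
noncomputable def squareOne {m : ℕ} (hm : m + 2 ≤ n) : SquareData (pdg k n (1 : ZMod p)) where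
  e := E k n (m + 1)
  ea := E k n (m + 2)
  eb := E k n m
  P := up k n (m + 1)
  q := dn k n (m + 1)
  r := dn k n m
  s := up k n m
  e_mem := E_mem_gr _
  ea_mem := E_mem_gr _
  eb_mem := E_mem_gr _
  P_mem := up_mem_gr _
  q_mem := dn_mem_gr _
  r_mem := dn_mem_gr _
  s_mem := up_mem_gr _
  e_mul_e := E_mul_E k n _
  ea_mul_ea := E_mul_E k n _
  eb_mul_eb := E_mul_E k n _
  e_mul_P := E_mul_up k n _
  P_mul_ea := up_mul_E k n _
  ea_mul_q := E_mul_dn k n _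
  q_mul_e := dn_mul_E k n _
  e_mul_r := E_mul_dn k n _
  r_mul_eb := dn_mul_E k n _
  eb_mul_s := E_mul_up k n _
  s_mul_e := up_mul_E k n _
  P_mul_q := up_mul_dn k n hm
  d_e := dLin_E _ _
  d_ea := dLin_E _ _
  d_eb := dLin_E _ _
  d_q := by rw [d_dn, map_one, sub_self, zero_smul]
  d_r := by rw [d_dn, map_one, sub_self, zero_smul]
  d_P := by rw [d_up, map_one, one_smul]
  d_s := by rw [d_up, map_one, one_smul, up_mul_dn k n hm, mul_assoc]

variable (k) in
/-- The generator of the simple module at the vertex `i`. -/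
noncomputable def Lgen (lam : ZMod p) (i : Fin n) : (L k lam i).carrier :=
  PDGModule.simpleGen (pdg k n lam) (e k i) (e_mem_gr i) (dLin_e _ i)

theorem smul_Lgen (lam : ZMod p) (i : Fin n) (a : Alg k n) :
    a • Lgen k lam i = vertexMap k i a • Lgen k lam i :=
  PDGModule.smul_simpleGen (𝔸 := pdg k n lam) (e_mem_gr i) (dLin_e _ i) (e_mul_self k i)
    (mul_e_sub_mem i) a

theorem smul_Lgen_eq_zero (lam : ZMod p) (i : Fin n) {a : Alg k n} (h : a • Lgen k lam i = 0) :
    vertexMap k i a = 0 := by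
  rw [smul_Lgen] at h
  exact PDGModule.smul_simpleGen_eq_zero (𝔸 := pdg k n lam) (e_mem_gr i) (dLin_e _ i)
    (ε := vertexMap k i) (by rw [vertexMap_e, if_pos rfl]) (fun _ => vertexMap_eq_zero_of_mem i) h

theorem exists_smul_Lgen (lam : ZMod p) (i : Fin n) (x : (L k lam i).carrier) :
    ∃ a, a * E k n (i.val + 1) = a ∧ a • Lgen k lam i = x := by
  obtain ⟨a, rfl⟩ := PDGModule.exists_smul_simpleGen (pdg k n lam) (e k i) (e_mem_gr i) (dLin_e _ i) x
  refine ⟨a * e k i, by rw [E_succ, mul_assoc, e_mul_self], ?_⟩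
  rw [mul_smul, smul_Lgen _ _ (e k i), vertexMap_e, if_pos rfl, one_smul]
  rfl

theorem up_smul_Lgen (lam : ZMod p) (i : Fin n) (m : ℕ) : up k n m • Lgen k lam i = 0 := by
  rw [smul_Lgen, vertexMap_eq_zero_of_mem, zero_smul]
  exact Submodule.mem_iSup_of_mem (⟨1, one_pos⟩ : {l : ℤ // 0 < l}) (up_mem_gr m)

theorem dn_smul_Lgen (lam : ZMod p) (i : Fin n) (m : ℕ) : dn k n m • Lgen k lam i = 0 := by
  rw [smul_Lgen, vertexMap_eq_zero_of_mem, zero_smul]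
  exact Submodule.mem_iSup_of_mem (⟨1, one_pos⟩ : {l : ℤ // 0 < l}) (dn_mem_gr m)

theorem exists_eq_add_of_smul_Lgen (lam : ZMod p) (i : Fin n) {a : Alg k n}
    (ha : a * E k n (i.val + 1) = a) (h : a • Lgen k lam i = 0) :
    ∃ u w, u * E k n i.val = u ∧ w * E k n (i.val + 2) = w ∧
      a = u * up k n i.val + w * dn k n (i.val + 1) := by
  obtain ⟨u, w, huw⟩ := exists_mul_e_eq i a
  refine ⟨u * E k n i.val, w * E k n (i.val + 2), ?_, ?_, ?_⟩
  · rw [mul_assoc, E_mul_E]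
  · rw [mul_assoc, E_mul_E]
  · rw [mul_assoc, E_mul_up, mul_assoc, E_mul_dn, ← ha, E_succ, huw, smul_Lgen_eq_zero lam i h,
      zero_smul, zero_add]

theorem squareZero_resolves (i : Fin n) (hi : i.val + 2 ≤ n) :
    (squareZero k n p hi).Resolves (Lgen k (0 : ZMod p) i) where
  mem := PDGModule.simpleGen_mem _ _ _ _
  d_eq := PDGModule.d_simpleGen _ _ _ _
  q_smul := up_smul_Lgen _ _ _
  s_smul := dn_smul_Lgen _ i (i.val + 1)
  exists_smul := exists_smul_Lgen _ _
  exact_bot := fun _ => exists_eq_add_of_smul_Lgen _ _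
  exact_mid := fun _ _ => exists_eq_mul_of_add_eq_zero hi
  exact_top := fun _ hb _ h => eq_zero_of_mul_up hi hb h

theorem squareOne_resolves (i : Fin n) (hi : i.val + 2 ≤ n) :
    (squareOne k n p hi).Resolves (Lgen k (1 : ZMod p) i) where
  mem := PDGModule.simpleGen_mem _ _ _ _
  d_eq := PDGModule.d_simpleGen _ _ _ _
  q_smul := dn_smul_Lgen _ i (i.val + 1)
  s_smul := up_smul_Lgen _ _ _
  exists_smul := exists_smul_Lgen _ _
  exact_bot := fun _ ha h => by
    obtain ⟨u, w, hu, hw, h⟩ := exists_eq_add_of_smul_Lgen _ _ ha h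
    exact ⟨w, u, hw, hu, h.trans (add_comm _ _)⟩
  exact_mid := fun _ _ hu hw h => by
    obtain ⟨b, hb, h1, h2⟩ := exists_eq_mul_of_add_eq_zero hi hw hu ((add_comm _ _).trans h)
    -- The two strings trade places compared with `λ = 0`, so the sign moves to the other component.
    refine ⟨-b, ?_, ?_, ?_⟩
    · exact (neg_mul b _).trans (congrArg _ hb)
    · exact h2.trans (neg_mul b _).symm
    · rw [neg_mul, neg_neg]
      exact h1
  exact_top := fun _ hb h _ => eq_zero_of_mul_up hi hb h

/-- The simple left module is one-dimensional. -/
noncomputable def L_actsBy (lam : ZMod p) (i : Fin n) :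
    (L k lam i).ActsBy fun a => vertexMap k i a :=
  PDGModule.simpleActsBy (𝔸 := pdg k n lam) (e_mem_gr i) (dLin_e _ i) (e_mul_self k i)
    (by rw [vertexMap_e, if_pos rfl]) (fun _ => vertexMap_eq_zero_of_mem i) (mul_e_sub_mem i)

theorem unop_mem_positivePart (lam : ZMod p) {a : (Alg k n)ᵐᵒᵖ}
    (ha : a ∈ (pdg k n lam).op.augmentation) : a.unop ∈ positivePart k n := by
  refine Submodule.iSup_induction _ (motive := fun a : (Alg k n)ᵐᵒᵖ => a.unop ∈ positivePart k n)
    ha ?_ (zero_mem _) fun _ _ => add_mem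
  intro l a ha
  exact Submodule.mem_iSup_of_mem l ha

theorem op_mem_augmentation (lam : ZMod p) {a : Alg k n} (ha : a ∈ positivePart k n) :
    MulOpposite.op a ∈ (pdg k n lam).op.augmentation := by
  refine Submodule.iSup_induction _
    (motive := fun a => MulOpposite.op a ∈ (pdg k n lam).op.augmentation)
    ha ?_ (zero_mem _) fun _ _ => add_mem
  intro l a ha
  exact Submodule.mem_iSup_of_mem l ha

/-- The simple right module is one-dimensional. -/
noncomputable def R_actsBy (lam : ZMod p) (i : Fin n) :
    (R k lam i).ActsBy fun a => vertexMap k i a.unop :=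
  PDGModule.simpleActsBy (𝔸 := (pdg k n lam).op)
    (ε := (vertexMap k i).fromOpposite fun _ _ => Commute.all _ _) (e_mem_gr i)
    (congrArg MulOpposite.op (dLin_e _ i)) (congrArg MulOpposite.op (e_mul_self k i))
    ((vertexMap_e i i).trans (if_pos rfl))
    (fun _ ha => vertexMap_eq_zero_of_mem i (unop_mem_positivePart lam ha))
    (fun a => op_mem_augmentation lam (e_mul_sub_mem i a.unop))

/-- The value of `λ` only decides which neighbour carries the first string and which the second; the
rest of the argument needs no more than this. -/
theorem exists_resolves (lam : ZMod p) (hlam : lam = 0 ∨ lam = 1) (i : Fin n)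
    (hi : i.val + 2 ≤ n) : ∃ X : SquareData (pdg k n lam), X.Resolves (Lgen k lam i) ∧
      X.e = E k n (i.val + 1) ∧ (X.ea = E k n i.val ∧ X.eb = E k n (i.val + 2) ∨
        X.ea = E k n (i.val + 2) ∧ X.eb = E k n i.val) := by
  rcases hlam with rfl | rfl
  · exact ⟨_, squareZero_resolves i hi, rfl, .inl ⟨rfl, rfl⟩⟩
  · exact ⟨_, squareOne_resolves i hi, rfl, .inr ⟨rfl, rfl⟩⟩

end Zigzag

/-! ### The computation for simple modules -/

open PDGModule PComplex Zigzag

theorem mainTheorem8 {k : Type u} [Field k] {p : ℕ} [Fact p.Prime] [CharP k p]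
    (n : ℕ) (hn : 2 ≤ n) (lam : ZMod p) (hlam : lam = 0 ∨ lam = 1)
    (i j : Fin n) (hi : i.val + 1 < n) :
    -- `RHOM(L_i, L_j)`
    ((j = i →
        PDGModule.RHOMEquiv (Zigzag.L k lam i) (Zigzag.L k lam j)
          ((PComplex.V0 k p).directSum ((PComplex.V0 k p).shift (2 * (p : ℤ) - 2))) ∧
        PComplex.HomotopyEquivalent
          ((PComplex.V0 k p).directSum ((PComplex.V0 k p).shift (2 * (p : ℤ) - 2)))
          ((PComplex.V0 k p).directSum ((PComplex.V0 k p).shift (-2)).hunshift.hunshift)) ∧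
      ((j.val : ℤ) = (i.val : ℤ) + 1 ∨ (j.val : ℤ) = (i.val : ℤ) - 1 →
        PDGModule.RHOMEquiv (Zigzag.L k lam i) (Zigzag.L k lam j)
          ((PComplex.Vp2 k p).shift ((p : ℤ) - 1)) ∧
        PComplex.HomotopyEquivalent ((PComplex.Vp2 k p).shift ((p : ℤ) - 1))
          ((PComplex.V0 k p).shift (-1)).hunshift) ∧
      (1 < |(j.val : ℤ) - (i.val : ℤ)| →
        PDGModule.RHOMEquiv (Zigzag.L k lam i) (Zigzag.L k lam j) (PComplex.zero k p))) ∧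
    -- the derived tensor product of `_jL` and `L_i` over `A_n^!`
    ((j = i →
        PDGModule.LTensorEquiv (Zigzag.R k lam j) (Zigzag.L k lam i)
          (((PComplex.V0 k p).hshift.hshift.shift 2).directSum (PComplex.V0 k p))) ∧
      ((j.val : ℤ) = (i.val : ℤ) + 1 ∨ (j.val : ℤ) = (i.val : ℤ) - 1 →
        PDGModule.LTensorEquiv (Zigzag.R k lam j) (Zigzag.L k lam i)
          ((PComplex.Vp2 k p).shift (1 - (p : ℤ))) ∧
        PComplex.HomotopyEquivalent ((PComplex.Vp2 k p).shift (1 - (p : ℤ)))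
          ((PComplex.V0 k p).hshift.shift 1)) ∧
      (1 < |(j.val : ℤ) - (i.val : ℤ)| →
        PDGModule.LTensorEquiv (Zigzag.R k lam j) (Zigzag.L k lam i) (PComplex.zero k p))) := by
  -- One resolution of `L_i` serves for all `j` and for both functors; only the values of the
  -- character of `j` on its three idempotents matter.
  obtain ⟨X, H, he, hab⟩ := exists_resolves (k := k) lam hlam i hi
  have hP := H.isCofibrantReplacement
  have cL := L_actsBy (k := k) lam j
  have cR := R_actsBy (k := k) lam j
  have h0 : vertexMap k j X.e = if i = j then 1 else 0 := by rw [he, E_succ, vertexMap_e]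
  have heq : j = i → vertexMap k j X.e = 1 ∧ vertexMap k j X.ea = 0 ∧ vertexMap k j X.eb = 0 := by
    rintro rfl
    rw [h0, if_pos rfl]
    rcases hab with ⟨ha, hb⟩ | ⟨ha, hb⟩ <;> simp [ha, hb, vertexMap_E]
  -- Exactly one of the two strings belongs to the vertex `j`. Which one depends on `λ`, but both
  -- strings give the same complexes.
  have hadj : (j.val : ℤ) = (i.val : ℤ) + 1 ∨ (j.val : ℤ) = (i.val : ℤ) - 1 →
      vertexMap k j X.e = 0 ∧ (vertexMap k j X.ea = 1 ∧ vertexMap k j X.eb = 0 ∨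
        vertexMap k j X.ea = 0 ∧ vertexMap k j X.eb = 1) := by
    intro hj
    have hij : i ≠ j := by
      rintro rfl
      omega
    rw [h0, if_neg hij]
    refine ⟨rfl, ?_⟩
    rcases hab with ⟨ha, hb⟩ | ⟨ha, hb⟩ <;> rw [ha, hb, vertexMap_E, vertexMap_E] <;>
      rcases hj with hj | hj
    · exact .inr ⟨if_neg (by omega), if_pos (by omega)⟩
    · exact .inl ⟨if_pos (by omega), if_neg (by omega)⟩
    · exact .inl ⟨if_pos (by omega), if_neg (by omega)⟩
    · exact .inr ⟨if_neg (by omega), if_pos (by omega)⟩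
  have hfar : 1 < |(j.val : ℤ) - (i.val : ℤ)| →
      vertexMap k j X.e = 0 ∧ vertexMap k j X.ea = 0 ∧ vertexMap k j X.eb = 0 := by
    intro hj
    rw [lt_abs] at hj
    have hij : i ≠ j := by
      rintro rfl
      omega
    rw [h0, if_neg hij]
    rcases hab with ⟨ha, hb⟩ | ⟨ha, hb⟩ <;> rw [ha, hb, vertexMap_E, vertexMap_E] <;>
      exact ⟨rfl, if_neg (by omega), if_neg (by omega)⟩
  refine ⟨⟨fun hj => ?_, fun hj => ?_, fun hj => ?_⟩, fun hj => ?_, fun hj => ?_, fun hj => ?_⟩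
  · obtain ⟨h0, ha, hb⟩ := heq hj
    exact ⟨hP.rhomEquiv (X.HOM_of_map_e cL h0 ha hb),
      (homotopyEquivalent_refl _).directSum homotopyEquivalent_V0_hunshift_hunshift⟩
  · obtain ⟨h0, ⟨ha, hb⟩ | ⟨ha, hb⟩⟩ := hadj hj
    · exact ⟨hP.rhomEquiv (X.HOM_of_map_ea cL h0 ha hb), homotopyEquivalent_V0_hunshift⟩
    · exact ⟨hP.rhomEquiv (X.HOM_of_map_eb cL h0 ha hb), homotopyEquivalent_V0_hunshift⟩
  · obtain ⟨h0, ha, hb⟩ := hfar hj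
    exact hP.rhomEquiv (X.HOM_of_map_eq_zero cL h0 ha hb)
  · obtain ⟨h0, ha, hb⟩ := heq hj
    exact hP.ltensorEquiv ((X.tensor_of_map_e cR h0 ha hb).trans
      (homotopyEquivalent_V0_hshift_hshift.directSum (homotopyEquivalent_refl _)))
  · obtain ⟨h0, ⟨ha, hb⟩ | ⟨ha, hb⟩⟩ := hadj hj
    · exact ⟨hP.ltensorEquiv (X.tensor_of_map_ea cR h0 ha hb), homotopyEquivalent_V0_hshift_shift⟩
    · exact ⟨hP.ltensorEquiv (X.tensor_of_map_eb cR h0 ha hb), homotopyEquivalent_V0_hshift_shift⟩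
  · obtain ⟨h0, ha, hb⟩ := hfar hj
    exact hP.ltensorEquiv (X.tensor_of_map_eq_zero cR h0 ha hb)
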